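/- Let $(X,P)$ be a (finite-dimensional, smooth, Hausdorff) Poisson manifold, with $P$ also denoting the contraction $T^*X\to TX$, and let $f:S\to X$ be a (possibly only immersed) coisotropic submanifold: $f$ is a smooth immersion and, for every $s\in S$, $P$ maps the conormal space $N^*_sS=\{\xi\in T^*_{f(s)}X:\ \xi\circ df_s=0\}$ into $df_s(T_sS)$. *Conventions.* For a Lie algebroid $A\to M$ with anchor $\rho$, forms on the formal quotient stack $[M/A]$ are elements of the Weil algebra of $A$, $\Omega^{p,q}$ being the $p$-forms of cohomological degree $q$ (zero for $q<0$), with de Rham differential $d$ and internal differential $\delta$. Thus $\Omega^{p,0}=\Omega^p(M)$, with $\delta\eta=(-1)^p(a\mapsto L_{\rho a}\eta,\ a\mapsto\iota_{\rho a}\eta)$, and $\Omega^{p,1}$ consists of pairs $(L,l)$ of an operator $L:\Gamma(A)\to\Omega^p(M)$ and a bundle map $l:A\to\Lambda^{p-1}T^*M$ (its symbol) with $L(ga)=gL(a)+dg\wedge l(a)$, with $d(L,l)=(d\circ L,\ L-d\circ l)$; for $p=2$, $\delta(L,l)=0$ means that for all $a,b\in\Gamma(A)$ $$L_{\rho a}L(b)-L_{\rho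 b}L(a)=L([a,b]),\quad L_{\rho a}l(b)-\iota_{\rho b}L(a)=l([a,b]),\quad \iota_{\rho a}l(b)+\iota_{\rho b}l(a)=0 .$$ A $1$-shifted symplectic structure on $[M/A]$ is a pair $(\omega_0,\omega_1)\in\Omega^{2,1}\times\Omega^{3,0}$ with $\delta\omega_0=0$, $d\omega_0+\delta\omega_1=0$, $d\omega_1=0$, such that the symbol of $\omega_0$ induces a quasi-isomorphism from the tangent complex $A\xrightarrow{\rho}TM$ to the shifted cotangent complex $T^*M\xrightarrow{\rho^*}A^*$ (both in degrees $-1,0$). A Lagrangian structure on the map $[N/B]\to[M/A]$ given by a Lie algebroid morphism $(f,j)$ is a $\gamma\in\Omega^{2,0}=\Omega^2(N)$ with $\delta\gamma=(f,j)^*\omega_0$ and $d\gamma=f^*\omega_1$ such that $$(v,a)\mapsto-\iota_v\gamma+f^*l(a),\qquad w\mapsto\bigl(n\mapsto l(j n)(w)\bigr)$$ is a quasi-isomorphism from the relative tangent complex $B\xrightarrow{(\rho,\,j)}TN\oplus f^*A\xrightarrow{(df,\,-\rho)}f^*TM$ (in degrees $-1,0,1$) to the cotangent complex $T^*N\xrightarrow{\rho^*}B^*$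 (in degrees $0,1$), where $l$ is the symbol of $\omega_0$. *Statement.* 1. $T^*X$ with anchor $P$ and bracket $[\alpha,\beta]=L_{P\alpha}\beta-\iota_{P\beta}d\alpha$ is a Lie algebroid, and $(\omega_0,\omega_1)=(\Omega,0)$, where $\Omega$ is the de Rham operator $d:\Omega^1(X)\to\Omega^2(X)$ with symbol $\mathrm{id}_{T^*X}$, is a $1$-shifted symplectic structure on $[X/T^*X]$. 2. There is a unique Lie algebroid structure on the conormal bundle $N^*S\to S$ for which the inclusion $N^*S\to T^*X$ over $f$ is a morphism of Lie algebroids. 3. The induced map of quotient stacks $[S/N^*S]\to[X/T^*X]$ is Lagrangian with respect to $(\Omega,0)$; more precisely, $\gamma=0$ is a Lagrangian structure on it. -/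

import Mathlib

open scoped Manifold ContDiff Topology

noncomputable section

namespace CoisoLag

universe u v w u' v'

/-! ### Differential forms on smooth manifolds modelled on a finite-dimensional space `E` -/

section Forms

variable (E : Type u) [NormedAddCommGroup E] [NormedSpace ℝ E]
  (M : Type v) [TopologicalSpace M] [ChartedSpace E M]

/-- The fibre at `x` of `Λᵏ T*M`. -/
abbrev AltForm {M : Type v} [TopologicalSpace M] [ChartedSpace E M] (k : ℕ) (x : M) : Type u :=
  TangentSpace 𝓘(ℝ, E) x [⋀^Fin k]→L[ℝ] ℝ

/-- Set-theoretic `k`-forms on `M`; smoothness is the predicate `IsSmoothForm`. -/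
abbrev DForm (k : ℕ) : Type (max u v) := ∀ x : M, AltForm E k x

/-- Set-theoretic vector fields on `M`; smoothness is the predicate `IsSmoothVF`. -/
abbrev VField : Type (max u v) := ∀ x : M, TangentSpace 𝓘(ℝ, E) x

variable {M} [IsManifold 𝓘(ℝ, E) ∞ M]

/-- Smooth real functions. -/
def IsSmoothFn (g : M → ℝ) : Prop := ContMDiff 𝓘(ℝ, E) 𝓘(ℝ, ℝ) ∞ g

variable {E}

/-- Smooth vector fields. -/
def IsSmoothVF (V : VField E M) : Prop :=
  ContMDiff 𝓘(ℝ, E) 𝓘(ℝ, E).tangent ∞ (fun x => (⟨x, V x⟩ : TangentBundle 𝓘(ℝ, E) M))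

variable (E) in
/-- The coordinate frame at `x` of the preferred chart `φ` at `x₀`, as a linear map from `E` to
the tangent space at `x`; for `x` in the domain of `φ` this is the derivative of `φ⁻¹` at
`φ x`. -/
def coordFrame (x₀ x : M) : E →L[ℝ] TangentSpace 𝓘(ℝ, E) x :=
  (trivializationAt E (TangentSpace 𝓘(ℝ, E)) x₀).symmL ℝ x

/-- The coefficients of a `k`-covector at `x` in the coordinates of the chart at `x₀`. -/
def coords {k : ℕ} (x₀ x : M) (η : AltForm E k x) : E [⋀^Fin k]→L[ℝ] ℝ :=
  η.compContinuousLinearMap (coordFrame E x₀ x)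

/-- Let `f : N → M` be continuous. A section `ξ` of `f* Λᵏ T*M` is smooth if its coefficients in
local coordinates of `M` are smooth functions on `N`. -/
def IsSmoothAlong {E' : Type u'} [NormedAddCommGroup E'] [NormedSpace ℝ E']
    {N : Type v'} [TopologicalSpace N] [ChartedSpace E' N] (f : N → M) {k : ℕ}
    (ξ : ∀ t : N, AltForm E k (f t)) : Prop :=
  ∀ t₀ : N, ContMDiffAt 𝓘(ℝ, E') 𝓘(ℝ, E [⋀^Fin k]→L[ℝ] ℝ) ∞
    (fun t => coords (f t₀) (f t) (ξ t)) t₀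

/-- Smooth `k`-forms: the coefficients in local coordinates are smooth. -/
def IsSmoothForm {k : ℕ} (θ : DForm E M k) : Prop := IsSmoothAlong (E' := E) (fun x : M => x) θ

/-- The exterior derivative, computed at `x` in the preferred chart at `x`. -/
def dForm {k : ℕ} (θ : DForm E M k) : DForm E M (k + 1) := fun x =>
  ContinuousAlternatingMap.compContinuousLinearMap
    (extDeriv (fun y : E => coords x ((extChartAt 𝓘(ℝ, E) x).symm y)
      (θ ((extChartAt 𝓘(ℝ, E) x).symm y))) (extChartAt 𝓘(ℝ, E) x x))
    (mfderiv 𝓘(ℝ, E) 𝓘(ℝ, E) (extChartAt 𝓘(ℝ, E) x) x)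

/-- Contraction of a covector with a tangent vector in the first slot. -/
def contract {k : ℕ} {x : M} (v : TangentSpace 𝓘(ℝ, E) x) (η : AltForm E (k + 1) x) :
    AltForm E k x :=
  ContinuousAlternatingMap.curryLeft (E := E) η v

/-- The interior product `ι_V θ`. -/
def interior {k : ℕ} (V : VField E M) (θ : DForm E M (k + 1)) : DForm E M k :=
  fun x => contract (V x) (θ x)

/-- The Lie derivative `L_V θ = d ι_V θ + ι_V dθ` of a form of positive degree. -/
def lieDeriv {k : ℕ} (V : VField E M) (θ : DForm E M (k + 1)) : DForm E M (k + 1) :=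
  dForm (interior V θ) + interior V (dForm θ)

variable (E) in
/-- The derivative of a function along a tangent vector. -/
def dirDeriv (g : M → ℝ) (x : M) (v : TangentSpace 𝓘(ℝ, E) x) : ℝ :=
  mfderiv 𝓘(ℝ, E) 𝓘(ℝ, ℝ) g x v

variable (E) in
/-- The differential of a function as a `1`-form. -/
def dFun (g : M → ℝ) : DForm E M 1 := fun x =>
  ContinuousAlternatingMap.ofSubsingleton ℝ (TangentSpace 𝓘(ℝ, E) x) ℝ (0 : Fin 1)
    (mfderiv 𝓘(ℝ, E) 𝓘(ℝ, ℝ) g x)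

/-- The pairing of cotangent and tangent vectors. -/
def pairing (x : M) : AltForm E 1 x →ₗ[ℝ] TangentSpace 𝓘(ℝ, E) x →ₗ[ℝ] ℝ :=
  LinearMap.mk₂ ℝ (fun β v => β (fun _ => v))
    (fun _ _ _ => rfl) (fun _ _ _ => rfl)
    (fun β v w => ((ContinuousAlternatingMap.ofSubsingleton ℝ
        (TangentSpace 𝓘(ℝ, E) x) ℝ (0 : Fin 1)).symm β).map_add v w)
    (fun c β v => ((ContinuousAlternatingMap.ofSubsingleton ℝ
        (TangentSpace 𝓘(ℝ, E) x) ℝ (0 : Fin 1)).symm β).map_smul c v)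

/-- The value at `(u, v)` of the wedge product `dg ∧ β` of the differential of a function with a
covector `β`. -/
def wedgeVal (g : M → ℝ) (x : M) (β : AltForm E 1 x) (u v : TangentSpace 𝓘(ℝ, E) x) : ℝ :=
  dirDeriv E g x u * pairing x β v - dirDeriv E g x v * pairing x β u

/-- The linear map `v ↦ ι_v γ` defined by a `2`-covector. -/
def flat {x : M} (γ : AltForm E 2 x) : TangentSpace 𝓘(ℝ, E) x →ₗ[ℝ] AltForm E 1 x where
  toFun v := contract v γ
  map_add' v w := (ContinuousAlternatingMap.curryLeft (E := E) γ).map_add v w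
  map_smul' c v := (ContinuousAlternatingMap.curryLeft (E := E) γ).map_smul c v

/-- Pullback of covectors along the derivative of `f` at `s`. -/
def pullCov {E' : Type u'} [NormedAddCommGroup E'] [NormedSpace ℝ E']
    {N : Type v'} [TopologicalSpace N] [ChartedSpace E' N] (f : N → M) (k : ℕ) (s : N) :
    AltForm E k (f s) →ₗ[ℝ] AltForm E' k s where
  toFun η := η.compContinuousLinearMap (mfderiv 𝓘(ℝ, E') 𝓘(ℝ, E) f s)
  map_add' _ _ := rfl
  map_smul' _ _ := rfl

end Forms

/-! ### Vector bundles and Lie algebroids -/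

section Algebroids

variable (E : Type u) [NormedAddCommGroup E] [NormedSpace ℝ E]
  (M : Type v) [TopologicalSpace M] [ChartedSpace E M]

/-- A family of real vector spaces over `M` with a class of sections, called smooth.
The vector bundle axioms are the predicate `SectionBundle.IsVectorBundle`. -/
structure SectionBundle (M : Type v) where
  Fib : M → Type w
  [grp : ∀ x, AddCommGroup (Fib x)]
  [mod : ∀ x, Module ℝ (Fib x)]
  Smooth : (∀ x, Fib x) → Prop

attribute [instance] SectionBundle.grp SectionBundle.mod

variable {M}

/-- All set-theoretic sections. -/
abbrev SectionBundle.Sec (A : SectionBundle.{v, w} M) : Type (max v w) := ∀ x, A.Fib x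

/-- The smooth sections are those of a smooth vector bundle of finite rank with the given
fibres: they form a sheaf of modules over the smooth functions which has local frames. -/
structure SectionBundle.IsVectorBundle (A : SectionBundle.{v, w} M) : Prop where
  zero : A.Smooth 0
  add : ∀ a b : A.Sec, A.Smooth a → A.Smooth b → A.Smooth (a + b)
  smul : ∀ (g : M → ℝ) (a : A.Sec), IsSmoothFn E g → A.Smooth a → A.Smooth (fun x => g x • a x)
  isLocal : ∀ a : A.Sec, (∀ x, ∃ b : A.Sec, A.Smooth b ∧ ∀ᶠ y in 𝓝 x, a y = b y) → A.Smooth a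
  frame : ∀ x : M, ∃ (r : ℕ) (e : Fin r → A.Sec) (U : Set M), IsOpen U ∧ x ∈ U ∧
    (∀ i, A.Smooth (e i)) ∧
    (∀ y ∈ U, LinearIndependent ℝ (fun i => e i y) ∧
      Submodule.span ℝ (Set.range fun i => e i y) = ⊤) ∧
    ∀ a : A.Sec, A.Smooth a → ∃ c : Fin r → M → ℝ,
      (∀ i, ContMDiffOn 𝓘(ℝ, E) 𝓘(ℝ, ℝ) ∞ (c i) U) ∧ ∀ y ∈ U, a y = ∑ i, c i y • e i y

/-- The data of an anchor and a bracket on a bundle. Only the brackets of smooth sections are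
meaningful. -/
structure AlgebroidData (A : SectionBundle.{v, w} M) where
  anchor : ∀ x, A.Fib x →ₗ[ℝ] TangentSpace 𝓘(ℝ, E) x
  bracket : A.Sec → A.Sec → A.Sec

variable {E}

/-- The vector field `ρ(a)`. -/
def AlgebroidData.vf {A : SectionBundle.{v, w} M} (𝒜 : AlgebroidData E A) (a : A.Sec) :
    VField E M := fun x => 𝒜.anchor x (a x)

/-- Lie algebroids over `M`. -/
structure AlgebroidData.IsLieAlgebroid [IsManifold 𝓘(ℝ, E) ∞ M] {A : SectionBundle.{v, w} M}
    (𝒜 : AlgebroidData E A) : Prop where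
  isVectorBundle : A.IsVectorBundle E
  anchor_smooth : ∀ a, A.Smooth a → IsSmoothVF (𝒜.vf a)
  bracket_smooth : ∀ a b, A.Smooth a → A.Smooth b → A.Smooth (𝒜.bracket a b)
  bracket_add : ∀ a b c, A.Smooth a → A.Smooth b → A.Smooth c →
    𝒜.bracket a (b + c) = 𝒜.bracket a b + 𝒜.bracket a c
  bracket_skew : ∀ a b, A.Smooth a → A.Smooth b → 𝒜.bracket a b = - 𝒜.bracket b a
  bracket_leibniz : ∀ (g : M → ℝ) (a b : A.Sec), IsSmoothFn E g → A.Smooth a → A.Smooth b →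
    𝒜.bracket a (fun x => g x • b x) =
      fun x => g x • 𝒜.bracket a b x + dirDeriv E g x (𝒜.vf a x) • b x
  jacobi : ∀ a b c, A.Smooth a → A.Smooth b → A.Smooth c →
    𝒜.bracket a (𝒜.bracket b c) + 𝒜.bracket b (𝒜.bracket c a)
      + 𝒜.bracket c (𝒜.bracket a b) = 0
  anchor_bracket : ∀ a b, A.Smooth a → A.Smooth b →
    𝒜.vf (𝒜.bracket a b) = VectorField.mlieBracket 𝓘(ℝ, E) (𝒜.vf a) (𝒜.vf b)

section Morphisms

variable {E' : Type u'} [NormedAddCommGroup E'] [NormedSpace ℝ E']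
  {N : Type v'} [TopologicalSpace N] [ChartedSpace E' N]
  {A : SectionBundle.{v, w} M} {B : SectionBundle.{v', w} N}

/-- Near `s`, the section `j ∘ b` of `f* A` is the combination `∑ i, gᵢ · f* aᵢ` of pullbacks of
smooth sections `aᵢ` of `A` with smooth functions `gᵢ` on `N` as coefficients. -/
structure IsDecomposition (E' : Type u') [NormedAddCommGroup E'] [NormedSpace ℝ E']
    [ChartedSpace E' N] (f : N → M) (j : ∀ s, B.Fib s →ₗ[ℝ] A.Fib (f s)) (b : B.Sec) (s : N)
    {m : ℕ} (g : Fin m → N → ℝ) (a : Fin m → A.Sec) : Prop where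
  coeff_smooth : ∀ i, IsSmoothFn E' (g i)
  sec_smooth : ∀ i, A.Smooth (a i)
  eq : ∀ᶠ t in 𝓝 s, j t (b t) = ∑ i, g i t • a i (f t)

/-- Morphisms of Lie algebroids over a map `f : N → M` of the bases (in the sense of Higgins and
Mackenzie). The last field is the compatibility of the brackets. A morphism of Lie algebroids is
the same thing as a morphism `[N/B] → [M/A]` of the formal quotients compatible with the
atlases. -/
structure IsAlgebroidMorphism [IsManifold 𝓘(ℝ, E) ∞ M] [IsManifold 𝓘(ℝ, E') ∞ N]
    (f : N → M) (j : ∀ s, B.Fib s →ₗ[ℝ] A.Fib (f s))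
    (ℬ : AlgebroidData E' B) (𝒜 : AlgebroidData E A) : Prop where
  base_smooth : ContMDiff 𝓘(ℝ, E') 𝓘(ℝ, E) ∞ f
  smooth : ∀ b, B.Smooth b → ∀ s, ∃ (m : ℕ) (g : Fin m → N → ℝ) (a : Fin m → A.Sec),
    IsDecomposition E' f j b s g a
  anchor : ∀ s (n : B.Fib s),
    mfderiv 𝓘(ℝ, E') 𝓘(ℝ, E) f s (ℬ.anchor s n) = 𝒜.anchor (f s) (j s n)
  bracket : ∀ b b' : B.Sec, B.Smooth b → B.Smooth b' → ∀ (s : N) (m m' : ℕ)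
    (g : Fin m → N → ℝ) (a : Fin m → A.Sec) (g' : Fin m' → N → ℝ) (a' : Fin m' → A.Sec),
    IsDecomposition E' f j b s g a → IsDecomposition E' f j b' s g' a' →
    j s (ℬ.bracket b b' s) =
      ∑ i, ∑ k, (g i s * g' k s) • 𝒜.bracket (a i) (a' k) (f s)
        + ∑ k, dirDeriv E' (g' k) s (ℬ.vf b s) • a' k (f s)
        - ∑ i, dirDeriv E' (g i) s (ℬ.vf b' s) • a i (f s)

end Morphisms

end Algebroids

/-! ### Quasi-isomorphisms -/

/-- For complexes `V₀ → V₁ → V₂` and `W₀ → W₁ → W₂` (placed in degrees `-1, 0, 1` and zero in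
the other degrees), `φ` is a map of complexes that induces an isomorphism on cohomology. -/
structure IsQuasiIso {V₀ V₁ V₂ W₀ W₁ W₂ : Type*}
    [AddCommGroup V₀] [Module ℝ V₀] [AddCommGroup V₁] [Module ℝ V₁]
    [AddCommGroup V₂] [Module ℝ V₂] [AddCommGroup W₀] [Module ℝ W₀]
    [AddCommGroup W₁] [Module ℝ W₁] [AddCommGroup W₂] [Module ℝ W₂]
    (d₀ : V₀ →ₗ[ℝ] V₁) (d₁ : V₁ →ₗ[ℝ] V₂) (e₀ : W₀ →ₗ[ℝ] W₁) (e₁ : W₁ →ₗ[ℝ] W₂)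
    (φ₀ : V₀ →ₗ[ℝ] W₀) (φ₁ : V₁ →ₗ[ℝ] W₁) (φ₂ : V₂ →ₗ[ℝ] W₂) : Prop where
  dd : d₁ ∘ₗ d₀ = 0
  ee : e₁ ∘ₗ e₀ = 0
  comm₀ : φ₁ ∘ₗ d₀ = e₀ ∘ₗ φ₀
  comm₁ : φ₂ ∘ₗ d₁ = e₁ ∘ₗ φ₁
  inj₀ : ∀ x, d₀ x = 0 → φ₀ x = 0 → x = 0
  surj₀ : ∀ z, e₀ z = 0 → ∃ x, d₀ x = 0 ∧ φ₀ x = z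
  inj₁ : ∀ x, d₁ x = 0 → φ₁ x ∈ LinearMap.range e₀ → x ∈ LinearMap.range d₀
  surj₁ : ∀ z, e₁ z = 0 → ∃ x, d₁ x = 0 ∧ z - φ₁ x ∈ LinearMap.range e₀
  inj₂ : ∀ x, φ₂ x ∈ LinearMap.range e₁ → x ∈ LinearMap.range d₁
  surj₂ : ∀ z, ∃ x, z - φ₂ x ∈ LinearMap.range e₁

/-! ### Forms on the formal quotient stack `[M/A]` of a Lie algebroid

The bigraded space `Ω^{p,q}` of `p`-forms of cohomological degree `q` on `[M/A]` is the Weil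
algebra of `A` (differential forms on the graded manifold `A[1]`, with `q` the weight in `A[1]`);
it vanishes for `q < 0`. In low cohomological degrees its elements are:

* `Ω^{p,0}`: ordinary `p`-forms on `M`;
* `Ω^{p,1}`: pairs `(L, l)` of an operator `L` from sections of `A` to `p`-forms and a symbol
  `l : A → Λ^{p-1} T*M`, with `L (g a) = g L a + dg ∧ l a`;
* `Ω^{p,2}`: triples `(c₀(a, b), c₁(a | b), c₂(a, b))`, with values in forms of degree `p`, `p - 1`
  and `p - 2`.

The de Rham differential is `dη` on `Ω^{p,0}` and `d (L, l) = (d ∘ L, L - d ∘ l)` on `Ω^{p,1}`. The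
internal differential, up to the sign `(-1)^p` which makes it anticommute with `d`, is
`δη = (a ↦ L_{ρ a} η, a ↦ ι_{ρ a} η)` on `Ω^{p,0}`, and `δ (L, l)` has the components
`c₀(a, b) = L_{ρ a} (L b) - L_{ρ b} (L a) - L [a, b]`,
`c₁(a | b) = L_{ρ a} (l b) - l [a, b] - ι_{ρ b} (L a)` and
`c₂(a, b) = ι_{ρ a} (l b) + ι_{ρ b} (l a)`. -/

section Stacks

variable {E : Type u} [NormedAddCommGroup E] [NormedSpace ℝ E]
  {M : Type v} [TopologicalSpace M] [ChartedSpace E M] [IsManifold 𝓘(ℝ, E) ∞ M]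
  {A : SectionBundle.{v, w} M}

variable (E) in
/-- Data for an element of `Ω^{2,1}` on `[M/A]`; only the values on smooth sections are
meaningful. -/
structure TwoFormOne (A : SectionBundle.{v, w} M) where
  op : A.Sec → DForm E M 2
  symbol : ∀ x, A.Fib x →ₗ[ℝ] AltForm E 1 x

/-- The `1`-form `l(a)`. -/
def TwoFormOne.sym (θ : TwoFormOne E A) (a : A.Sec) : DForm E M 1 := fun x => θ.symbol x (a x)

/-- The data is an element of `Ω^{2,1}`. -/
structure TwoFormOne.IsForm (θ : TwoFormOne E A) : Prop where
  op_smooth : ∀ a, A.Smooth a → IsSmoothForm (θ.op a)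
  sym_smooth : ∀ a, A.Smooth a → IsSmoothForm (θ.sym a)
  op_add : ∀ a b, A.Smooth a → A.Smooth b → θ.op (a + b) = θ.op a + θ.op b
  op_smul : ∀ (g : M → ℝ) (a : A.Sec), IsSmoothFn E g → A.Smooth a → ∀ x u v,
    θ.op (fun y => g y • a y) x ![u, v] =
      g x * θ.op a x ![u, v] + wedgeVal g x (θ.sym a x) u v

/-- `δω₀ = 0` in `Ω^{2,2}`: the three components of `δω₀` vanish. -/
structure TwoFormOne.IsDeltaClosed (𝒜 : AlgebroidData E A) (θ : TwoFormOne E A) : Prop where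
  comp₀ : ∀ a b, A.Smooth a → A.Smooth b →
    lieDeriv (𝒜.vf a) (θ.op b) - lieDeriv (𝒜.vf b) (θ.op a) - θ.op (𝒜.bracket a b) = 0
  comp₁ : ∀ a b, A.Smooth a → A.Smooth b →
    lieDeriv (𝒜.vf a) (θ.sym b) - θ.sym (𝒜.bracket a b) - interior (𝒜.vf b) (θ.op a) = 0
  comp₂ : ∀ a b, A.Smooth a → A.Smooth b →
    interior (𝒜.vf a) (θ.sym b) + interior (𝒜.vf b) (θ.sym a) = 0

/-- The element `δγ` of `Ω^{2,1}` defined by an ordinary `2`-form `γ`. -/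
def deltaTwoForm (𝒜 : AlgebroidData E A) (γ : DForm E M 2) : TwoFormOne E A where
  op a := lieDeriv (𝒜.vf a) γ
  symbol x := flat (γ x) ∘ₗ 𝒜.anchor x

/-- `(ω₀, ω₁)`, with `ω₀ ∈ Ω^{2,1}` and `ω₁ ∈ Ω^{3,0}`, is a `1`-shifted symplectic structure on
the formal quotient stack `[M/A]`. There are no further components, as `Ω^{2+p,1-p} = 0` for
`p ≥ 2`. -/
structure IsOneShiftedSymplectic (𝒜 : AlgebroidData E A) (ω₀ : TwoFormOne E A)
    (ω₁ : DForm E M 3) : Prop where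
  isForm₀ : ω₀.IsForm
  isForm₁ : IsSmoothForm ω₁
  /-- `δω₀ = 0` -/
  closed₀ : ω₀.IsDeltaClosed 𝒜
  /-- `dω₀ + δω₁ = 0` in `Ω^{3,1}`, the component with values in `3`-forms -/
  closed₁_op : ∀ a, A.Smooth a → dForm (ω₀.op a) - lieDeriv (𝒜.vf a) ω₁ = 0
  /-- `dω₀ + δω₁ = 0` in `Ω^{3,1}`, the symbol -/
  closed₁_sym : ∀ a, A.Smooth a →
    ω₀.op a - dForm (ω₀.sym a) - interior (𝒜.vf a) ω₁ = 0
  /-- `dω₁ = 0` -/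
  closed₂ : dForm ω₁ = 0
  /-- `ω₀` induces a quasi-isomorphism from the tangent complex `A → TM` (in degrees `-1, 0`) to
  the shifted cotangent complex `T*M → A*` (in degrees `-1, 0`). For bounded complexes of vector
  bundles this is tested on the fibres at the points of the atlas `M`. -/
  nondegenerate : ∀ x : M, IsQuasiIso
    (𝒜.anchor x) (0 : TangentSpace 𝓘(ℝ, E) x →ₗ[ℝ] PUnit.{1})
    ((𝒜.anchor x).dualMap ∘ₗ pairing x) (0 : Module.Dual ℝ (A.Fib x) →ₗ[ℝ] PUnit.{1})
    (ω₀.symbol x)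
    (-((ω₀.symbol x).dualMap ∘ₗ (pairing (E := E) x).flip)) 0

section Lagrangian

variable {E' : Type u'} [NormedAddCommGroup E'] [NormedSpace ℝ E']
  {N : Type v'} [TopologicalSpace N] [ChartedSpace E' N] [IsManifold 𝓘(ℝ, E') ∞ N]
  {B : SectionBundle.{v', w} N}

/-- `θ' = F* θ` in `Ω^{2,1}` on `[N/B]`, where `F : [N/B] → [M/A]` is given by `(f, j)`: the symbol
of `F* θ` is `n ↦ f* (l (j n))`, and if `j b = ∑ i, gᵢ · f* aᵢ` then
`(F* L) b = ∑ i, (gᵢ · f* (L aᵢ) + dgᵢ ∧ f* (l aᵢ))`. -/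
structure IsStackPullback (f : N → M) (j : ∀ s, B.Fib s →ₗ[ℝ] A.Fib (f s))
    (θ : TwoFormOne E A) (θ' : TwoFormOne E' B) : Prop where
  symbol : ∀ s (n : B.Fib s), θ'.symbol s n = pullCov f 1 s (θ.symbol (f s) (j s n))
  op : ∀ b, B.Smooth b → ∀ (s : N) (m : ℕ) (g : Fin m → N → ℝ) (a : Fin m → A.Sec),
    IsDecomposition E' f j b s g a → ∀ u v : TangentSpace 𝓘(ℝ, E') s,
    θ'.op b s ![u, v] = ∑ i, (g i s * pullCov f 2 s (θ.op (a i) (f s)) ![u, v]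
      + wedgeVal (g i) s (pullCov f 1 s (θ.sym (a i) (f s))) u v)

/-- `γ ∈ Ω^{2,0}` is a Lagrangian structure on the morphism `F : [N/B] → [M/A]` given by `(f, j)`,
with respect to `(ω₀, ω₁)`. An isotropic structure has no further components, as
`Ω^{2+p,-p} = 0` for `p ≥ 1`. -/
structure IsLagrangianStructure (f : N → M) (j : ∀ s, B.Fib s →ₗ[ℝ] A.Fib (f s))
    (ℬ : AlgebroidData E' B) (𝒜 : AlgebroidData E A) (ω₀ : TwoFormOne E A) (ω₁ : DForm E M 3)
    (γ : DForm E' N 2) : Prop where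
  smooth : IsSmoothForm γ
  /-- `δγ = F* ω₀` -/
  isotropic₀ : IsStackPullback f j ω₀ (deltaTwoForm ℬ γ)
  /-- `dγ = F* ω₁` -/
  isotropic₁ : ∀ s, dForm γ s = pullCov f 3 s (ω₁ (f s))
  /-- `γ` induces a quasi-isomorphism from the relative tangent complex
  `B → TN ⊕ f* A → f* TM` (in degrees `-1, 0, 1`, with differentials `n ↦ (ρ n, j n)` and
  `(v, a) ↦ df v - ρ a`) to the cotangent complex `T*N → B*` (in degrees `0, 1`). -/
  nondegenerate : ∀ s : N, IsQuasiIso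
    ((ℬ.anchor s).prod (j s))
    (LinearMap.coprod (mfderiv 𝓘(ℝ, E') 𝓘(ℝ, E) f s).toLinearMap (-(𝒜.anchor (f s))))
    (0 : PUnit.{1} →ₗ[ℝ] AltForm E' 1 s)
    ((ℬ.anchor s).dualMap ∘ₗ pairing s)
    0
    (LinearMap.coprod (-(flat (γ s))) (pullCov f 1 s ∘ₗ ω₀.symbol (f s)))
    ((ω₀.symbol (f s) ∘ₗ j s).dualMap ∘ₗ (pairing (E := E) (f s)).flip)

end Lagrangian

end Stacks

/-! ### Poisson manifolds and coisotropic submanifolds -/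

section Poisson

variable {E : Type u} [NormedAddCommGroup E] [NormedSpace ℝ E]
  {M : Type v} [TopologicalSpace M] [ChartedSpace E M] [IsManifold 𝓘(ℝ, E) ∞ M]

variable (E M) in
/-- A smooth bivector field `P` on `M`, given by its contraction `P : T*M → TM`. -/
structure Bivector where
  sharp : ∀ x : M, AltForm E 1 x →ₗ[ℝ] TangentSpace 𝓘(ℝ, E) x
  skew : ∀ x α, pairing x α (sharp x α) = 0
  smooth : ∀ α : DForm E M 1, IsSmoothForm α → IsSmoothVF (fun x => sharp x (α x))

/-- The vector field `P α`. -/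
def Bivector.vf (P : Bivector E M) (α : DForm E M 1) : VField E M := fun x => P.sharp x (α x)

/-- The bracket `{g, h} = P(dg, dh)` of functions. -/
def Bivector.fnBracket (P : Bivector E M) (g h : M → ℝ) : M → ℝ :=
  fun x => dirDeriv E h x (P.vf (dFun E g) x)

/-- `P` is a Poisson structure: its bracket on smooth functions satisfies the Jacobi identity. -/
def Bivector.IsPoisson (P : Bivector E M) : Prop :=
  ∀ f g h : M → ℝ, IsSmoothFn E f → IsSmoothFn E g → IsSmoothFn E h →
    P.fnBracket f (P.fnBracket g h) + P.fnBracket g (P.fnBracket h f)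
      + P.fnBracket h (P.fnBracket f g) = 0

variable (E M) in
/-- The cotangent bundle. -/
def cotangentBundle : SectionBundle.{v, u} M where
  Fib x := AltForm E 1 x
  Smooth α := IsSmoothForm (E := E) α

/-- The Poisson Lie algebroid: the cotangent bundle with anchor `P` and bracket
`[α, β] = L_{P α} β - ι_{P β} dα`. -/
def poissonAlgebroid (P : Bivector E M) : AlgebroidData E (cotangentBundle E M) where
  anchor x := P.sharp x
  bracket α β := lieDeriv (P.vf α) β - interior (P.vf β) (dForm α)

variable (E M) in
/-- The canonical element of `Ω^{2,1}` on `[M/T*M]`: the de Rham differential from `1`-forms to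
`2`-forms, with symbol the identity. -/
def canonicalForm : TwoFormOne E (cotangentBundle E M) where
  op α := dForm (E := E) α
  symbol _ := LinearMap.id

variable {E' : Type u'} [NormedAddCommGroup E'] [NormedSpace ℝ E']
  {S : Type v'} [TopologicalSpace S] [ChartedSpace E' S]

variable (E E') in
/-- The conormal space of `f : S → M` at `s`: the annihilator of the image of `df`. -/
def conormalSpace (f : S → M) (s : S) : Submodule ℝ (AltForm E 1 (f s)) :=
  LinearMap.ker (pullCov (E := E) (E' := E') f 1 s)

variable (E E') in
/-- The conormal bundle of an immersed submanifold `f : S → M`, a subbundle of `f* T*M`. -/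
def conormalBundle (f : S → M) : SectionBundle.{v', u} S where
  Fib s := conormalSpace E E' f s
  Smooth ξ := IsSmoothAlong (E := E) (E' := E') f (fun s => (ξ s : AltForm E 1 (f s)))

variable (E E') in
/-- The inclusion of the conormal bundle in the cotangent bundle, over `f`. -/
def conormalInclusion (f : S → M) (s : S) :
    (conormalBundle E E' f).Fib s →ₗ[ℝ] (cotangentBundle E M).Fib (f s) :=
  (conormalSpace E E' f s).subtype

/-- `f : S → M` is coisotropic: `P` maps conormal vectors to vectors tangent to `S`. -/
def Bivector.IsCoisotropic (P : Bivector E M) (E' : Type u') [NormedAddCommGroup E']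
    [NormedSpace ℝ E'] [ChartedSpace E' S] (f : S → M) : Prop :=
  ∀ (s : S), ∀ ξ ∈ conormalSpace E E' f s,
    ∃ v : TangentSpace 𝓘(ℝ, E') s, mfderiv 𝓘(ℝ, E') 𝓘(ℝ, E) f s v = P.sharp (f s) ξ

end Poisson

end CoisoLag

end

open scoped Manifold ContDiff Topology

noncomputable section

namespace CoisoLag

universe u v w u' v'

set_option linter.unusedSectionVars false


/-! Everything about the bracket of `1`-forms comes from the formula `[α, β](w) = w(β(Pα)) + dβ(Pα,
w) - dα(Pβ, w)`: it is skew because `P` is, it obeys the Leibniz rule, and `[dg, dh] = d{g, h}`. By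
the Leibniz rule the defect of `P[α, β] = [Pα, Pβ]` is linear over functions in each argument.
Locally every `1`-form is a combination of exact ones (`oneForm_induction`), so it suffices to treat
`dg` and `dh`, where the defect is the Jacobi identity for functions (`Bivector.anchorAt`). Once the
anchor preserves brackets, the Jacobiator is linear over functions too, and on exact forms it is the
differential of the Jacobiator of functions (`Bivector.jacobiator_eq_zero`). Closedness of the
canonical form amounts to `d² = 0`, the definition of the bracket and the skewness of `P`; it is
nondegenerate because its symbol is the identity and the other component of the map is biduality up
to sign.

On `S` the anchor is forced: `Pξ` lies in the image of `df` by coisotropy, and `df` is injective.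
For the bracket, conormal sections `b`, `b'` are extended near a point to forms `β`, `β'` on `X`,
and `[β, β']` is evaluated along `f`. The result is conormal: `f*β = 0` gives `f*dβ = 0`, the vector
field `Pβ` is tangent to `S`, and `β'` kills it along `S`. It does not depend on the extensions: a
form `γ` vanishing along `S` is locally `∑ pᵢ dkᵢ` with `pᵢ = 0` along `S`, and the Leibniz rule
expresses `[β, γ]` through `pᵢ` and `(Pβ) pᵢ`, both zero along `S` since `Pβ` is tangent
(`IsExtensionAt.formBracket_eq`). Hence the algebroid axioms descend from `X` to `S`. Uniqueness
holds because `df` is injective and the morphism condition computes the bracket from any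
decomposition.

The pullback of the canonical form takes `b` to `f*dβ = d(f*β) = 0`, so `γ = 0` is isotropic.
Nondegeneracy (`isQuasiIso_conormal`) is linear algebra at a point: `f*` is onto on covectors,
vectors annihilated by the conormal space are tangent, finite-dimensional spaces are reflexive, and
`(f*α)(ρ n) = -n(Pα)`. -/

theorem two_le_infty : (2 : WithTop ℕ∞) ≤ ∞ := by
  exact ENat.LEInfty.out

/-! ### Smooth families of alternating forms on a vector space -/

section AlternatingSmooth

variable {E : Type*} [NormedAddCommGroup E] [NormedSpace ℝ E]
  {E' : Type*} [NormedAddCommGroup E'] [NormedSpace ℝ E']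
  {N : Type*} [TopologicalSpace N] [ChartedSpace E' N]

/-- The linear map evaluating an alternating form on tuples of basis vectors has a continuous
linear left inverse. -/
theorem exists_leftInverse_basis_eval (k : ℕ) {ι : Type*} [Fintype ι] (b : Module.Basis ι ℝ E) :
    ∃ R : ((Fin k → ι) → ℝ) →L[ℝ] (E [⋀^Fin k]→L[ℝ] ℝ),
      ∀ η : E [⋀^Fin k]→L[ℝ] ℝ, R (fun σ => η (fun i => b (σ i))) = η := by
  let T : (E [⋀^Fin k]→L[ℝ] ℝ) →ₗ[ℝ] ((Fin k → ι) → ℝ) :=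
    { toFun := fun η σ => η (fun i => b (σ i))
      map_add' := fun _ _ => rfl
      map_smul' := fun _ _ => rfl }
  have hT : LinearMap.ker T = ⊥ := by
    rw [LinearMap.ker_eq_bot]
    intro η η' h
    have h2 : η.toAlternatingMap = η'.toAlternatingMap := by
      refine AlternatingMap.coe_multilinearMap_injective ?_
      exact Module.Basis.ext_multilinear (fun _ => b) fun σ => congrFun h σ
    exact ContinuousAlternatingMap.toAlternatingMap_injective h2
  -- An injective linear map of vector spaces splits, and the splitting is continuous because it
  -- starts from a finite-dimensional space.
  obtain ⟨R, hR⟩ := LinearMap.exists_leftInverse_of_injective T hT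
  exact ⟨R.toContinuousLinearMap, fun η => LinearMap.congr_fun hR η⟩

variable [FiniteDimensional ℝ E]

/-- A family of alternating forms is smooth as soon as its values on constant vectors are. -/
theorem contMDiffAt_alternating_iff {k : ℕ} {F : N → E [⋀^Fin k]→L[ℝ] ℝ} {t : N} :
    ContMDiffAt 𝓘(ℝ, E') 𝓘(ℝ, E [⋀^Fin k]→L[ℝ] ℝ) ∞ F t ↔
      ∀ m : Fin k → E, ContMDiffAt 𝓘(ℝ, E') 𝓘(ℝ, ℝ) ∞ (fun s => F s m) t := by
  constructor
  · intro h m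
    exact (ContinuousAlternatingMap.apply ℝ E ℝ m).contMDiff.contMDiffAt.comp t h
  · intro h
    obtain ⟨R, hR⟩ := exists_leftInverse_basis_eval k (Module.finBasis ℝ E)
    have h1 : ContMDiffAt 𝓘(ℝ, E') 𝓘(ℝ, (Fin k → Fin (Module.finrank ℝ E)) → ℝ) ∞
        (fun s (σ : Fin k → Fin (Module.finrank ℝ E)) => F s (fun i => Module.finBasis ℝ E (σ i))) t :=
      contMDiffAt_pi_space.2 fun σ => h _
    have h2 := R.contMDiff.contMDiffAt.comp t h1
    refine h2.congr_of_eventuallyEq (Filter.Eventually.of_forall fun s => ?_)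
    exact (hR (F s)).symm

/-- The expression is linear in the form and polynomial in the linear map: composition with a tuple
`(A₁, …, Aₖ)` is continuous multilinear in the tuple, and is restricted here to the diagonal. -/
theorem contDiff_compContinuousLinearMap_apply {k : ℕ} (m : Fin k → E) :
    ContDiff ℝ ∞ (fun p : (E [⋀^Fin k]→L[ℝ] ℝ) × (E →L[ℝ] E) =>
      p.1.compContinuousLinearMap p.2 m) := by
  have h1 : ContDiff ℝ ∞ (fun p : (E [⋀^Fin k]→L[ℝ] ℝ) × (E →L[ℝ] E) =>
      ContinuousMultilinearMap.compContinuousLinearMapContinuousMultilinear ℝ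
        (fun _ : Fin k => E) (fun _ : Fin k => E) ℝ (fun _ => p.2)) :=
    (ContinuousMultilinearMap.contDiff _).comp (contDiff_pi.2 fun _ => contDiff_snd)
  have h2 : ContDiff ℝ ∞ (fun p : (E [⋀^Fin k]→L[ℝ] ℝ) × (E →L[ℝ] E) =>
      (ContinuousAlternatingMap.toContinuousMultilinearMapCLM ℝ) p.1) :=
    (ContinuousLinearMap.contDiff _).comp contDiff_fst
  exact (ContinuousMultilinearMap.apply ℝ (fun _ : Fin k => E) ℝ m).contDiff.comp (h1.clm_apply h2)

theorem contMDiffAt_alternating_comp {k : ℕ} {F : N → E [⋀^Fin k]→L[ℝ] ℝ} {A : N → E →L[ℝ] E}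
    {t : N} (hF : ContMDiffAt 𝓘(ℝ, E') 𝓘(ℝ, E [⋀^Fin k]→L[ℝ] ℝ) ∞ F t)
    (hA : ContMDiffAt 𝓘(ℝ, E') 𝓘(ℝ, E →L[ℝ] E) ∞ A t) :
    ContMDiffAt 𝓘(ℝ, E') 𝓘(ℝ, E [⋀^Fin k]→L[ℝ] ℝ) ∞
      (fun s => (F s).compContinuousLinearMap (A s)) t := by
  rw [contMDiffAt_alternating_iff]
  intro m
  exact (contDiff_compContinuousLinearMap_apply m).contMDiff.contMDiffAt.comp t
    (hF.prodMk_space hA)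

end AlternatingSmooth

/-! ### Forms in charts; pullback and exterior derivative -/

section Charts

variable {E : Type u} [NormedAddCommGroup E] [NormedSpace ℝ E]
  {M : Type v} [TopologicalSpace M] [ChartedSpace E M] [IsManifold 𝓘(ℝ, E) ∞ M]

/-- The derivative at `x` of the preferred chart at `x₀`. -/
def chartDeriv (x₀ x : M) : TangentSpace 𝓘(ℝ, E) x →L[ℝ] E :=
  mfderiv 𝓘(ℝ, E) 𝓘(ℝ, E) (extChartAt 𝓘(ℝ, E) x₀) x

theorem chartDeriv_eq_continuousLinearMapAt {x₀ x : M} (hx : x ∈ (chartAt E x₀).source) :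
    chartDeriv (E := E) x₀ x =
      (trivializationAt E (TangentSpace 𝓘(ℝ, E)) x₀).continuousLinearMapAt ℝ x :=
  (TangentBundle.continuousLinearMapAt_trivializationAt hx).symm

theorem coordFrame_chartDeriv {x₀ x : M} (hx : x ∈ (chartAt E x₀).source)
    (v : TangentSpace 𝓘(ℝ, E) x) : coordFrame E x₀ x (chartDeriv x₀ x v) = v := by
  have : x ∈ (trivializationAt E (TangentSpace 𝓘(ℝ, E)) x₀).baseSet := by simpa using hx
  rw [coordFrame, chartDeriv_eq_continuousLinearMapAt hx]
  exact (trivializationAt E (TangentSpace 𝓘(ℝ, E)) x₀).symmL_continuousLinearMapAt this v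

theorem coords_apply {k : ℕ} (x₀ x : M) (η : AltForm E k x) (m : Fin k → E) :
    coords x₀ x η m = η (fun i => coordFrame E x₀ x (m i)) := rfl

theorem apply_eq_coords {k : ℕ} {x₀ x : M} (hx : x ∈ (chartAt E x₀).source) (η : AltForm E k x)
    (m : Fin k → TangentSpace 𝓘(ℝ, E) x) :
    η m = coords x₀ x η (fun i => chartDeriv x₀ x (m i)) := by
  rw [coords_apply]
  simp only [coordFrame_chartDeriv hx]

theorem chartDeriv_self (x : M) (v : TangentSpace 𝓘(ℝ, E) x) : chartDeriv x x v = v := by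
  rw [chartDeriv, mfderiv_extChartAt_self]; rfl

/-- The change of coordinates from the chart at `x₀` to the chart at `x₁`. -/
def transition (x₀ x₁ x : M) : E →L[ℝ] E :=
  (trivializationAt E (TangentSpace 𝓘(ℝ, E)) x₀).coordChangeL ℝ
    (trivializationAt E (TangentSpace 𝓘(ℝ, E)) x₁) x

theorem transition_apply {x₀ x₁ x : M} (h₀ : x ∈ (chartAt E x₀).source)
    (h₁ : x ∈ (chartAt E x₁).source) (e : E) :
    transition x₀ x₁ x e = chartDeriv x₁ x (coordFrame E x₀ x e) := by
  rw [chartDeriv_eq_continuousLinearMapAt h₁, transition, coordFrame,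
    Bundle.Trivialization.continuousLinearMapAt_apply, Bundle.Trivialization.symmL_apply,
    ContinuousLinearEquiv.coe_coe, Bundle.Trivialization.coordChangeL_apply _ _
      ⟨by simpa using h₀, by simpa using h₁⟩,
    Bundle.Trivialization.coe_linearMapAt_of_mem _ (by simpa using h₁)]
  simpa using h₀

theorem contMDiffAt_transition {x₀ x₁ x : M} (h₀ : x ∈ (chartAt E x₀).source)
    (h₁ : x ∈ (chartAt E x₁).source) :
    ContMDiffAt 𝓘(ℝ, E) 𝓘(ℝ, E →L[ℝ] E) ∞ (fun y => transition (E := E) x₀ x₁ y) x :=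
  contMDiffAt_coordChangeL (by simpa using h₀) (by simpa using h₁)

theorem coords_transition {k : ℕ} {x₀ x₁ x : M} (h₀ : x ∈ (chartAt E x₀).source)
    (h₁ : x ∈ (chartAt E x₁).source) (η : AltForm E k x) :
    coords x₀ x η = (coords x₁ x η).compContinuousLinearMap (transition x₀ x₁ x) := by
  ext m
  rw [coords_apply, ContinuousAlternatingMap.compContinuousLinearMap_apply, coords_apply]
  congr 1
  ext i
  simp only [Function.comp]
  rw [transition_apply h₀ h₁, coordFrame_chartDeriv h₁]

theorem coordFrame_eq_mfderiv {x₀ : M} {y : E} (hy : y ∈ (extChartAt 𝓘(ℝ, E) x₀).target) :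
    coordFrame E x₀ ((extChartAt 𝓘(ℝ, E) x₀).symm y) =
      mfderiv 𝓘(ℝ, E) 𝓘(ℝ, E) (extChartAt 𝓘(ℝ, E) x₀).symm y := by
  have hx : (extChartAt 𝓘(ℝ, E) x₀).symm y ∈ (chartAt E x₀).source := by
    simpa using (extChartAt 𝓘(ℝ, E) x₀).map_target hy
  rw [coordFrame, TangentBundle.symmL_trivializationAt hx, (extChartAt 𝓘(ℝ, E) x₀).right_inv hy,
    modelWithCornersSelf_coe, Set.range_id, mfderivWithin_univ]

theorem contMDiffAt_extChartAt_symm' {x₀ : M} {y : E} (hy : y ∈ (extChartAt 𝓘(ℝ, E) x₀).target) :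
    ContMDiffAt 𝓘(ℝ, E) 𝓘(ℝ, E) ∞ (extChartAt 𝓘(ℝ, E) x₀).symm y :=
  (contMDiffOn_extChartAt_symm x₀).contMDiffAt
    ((isOpen_extChartAt_target x₀).mem_nhds hy)

theorem chart_source_mem_nhds {x₀ x : M} (hx : x ∈ (chartAt E x₀).source) :
    (chartAt E x₀).source ∈ 𝓝 x := (chartAt E x₀).open_source.mem_nhds hx

variable [FiniteDimensional ℝ E] {E' : Type u'} [NormedAddCommGroup E'] [NormedSpace ℝ E']
    {N : Type v'} [TopologicalSpace N] [ChartedSpace E' N]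

/-- The coefficients of a smooth section of `f* Λᵏ T*M` in any preferred chart are smooth. -/
theorem IsSmoothAlong.contMDiffAt_coords {f : N → M} {k : ℕ} {ξ : ∀ t : N, AltForm E k (f t)}
    (hξ : IsSmoothAlong (E' := E') f ξ) {t : N} (hf : ContMDiffAt 𝓘(ℝ, E') 𝓘(ℝ, E) ∞ f t)
    {x₀ : M} (ht : f t ∈ (chartAt E x₀).source) :
    ContMDiffAt 𝓘(ℝ, E') 𝓘(ℝ, E [⋀^Fin k]→L[ℝ] ℝ) ∞ (fun s => coords x₀ (f s) (ξ s)) t := by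
  have h := contMDiffAt_alternating_comp (hξ t)
    ((contMDiffAt_transition ht (mem_chart_source E (f t))).comp t hf)
  refine h.congr_of_eventuallyEq ?_
  filter_upwards [hf.continuousAt (chart_source_mem_nhds ht),
    hf.continuousAt (chart_source_mem_nhds (mem_chart_source E (f t)))] with s h0 h1
  exact coords_transition h0 h1 _

/-- The expression of a form in the preferred chart at `x₀`. -/
def chartRep {k : ℕ} (x₀ : M) (θ : DForm E M k) (y : E) : E [⋀^Fin k]→L[ℝ] ℝ :=
  coords x₀ ((extChartAt 𝓘(ℝ, E) x₀).symm y) (θ ((extChartAt 𝓘(ℝ, E) x₀).symm y))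

theorem dForm_apply {k : ℕ} (θ : DForm E M k) (x : M) (m : Fin (k + 1) → TangentSpace 𝓘(ℝ, E) x) :
    dForm θ x m = extDeriv (chartRep x θ) (extChartAt 𝓘(ℝ, E) x x)
      (fun i => chartDeriv x x (m i)) := rfl

theorem IsSmoothForm.contDiffAt_chartRep {k : ℕ} {θ : DForm E M k} (hθ : IsSmoothForm θ)
    {x₀ : M} {y : E} (hy : y ∈ (extChartAt 𝓘(ℝ, E) x₀).target) :
    ContDiffAt ℝ ∞ (chartRep x₀ θ) y := by
  have hx : (extChartAt 𝓘(ℝ, E) x₀).symm y ∈ (chartAt E x₀).source := by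
    simpa using (extChartAt 𝓘(ℝ, E) x₀).map_target hy
  have h3 := IsSmoothAlong.contMDiffAt_coords (f := fun x : M => x) hθ contMDiffAt_id hx
  rw [← contMDiffAt_iff_contDiffAt]
  exact h3.comp _ (contMDiffAt_extChartAt_symm' hy)

/-- The pullback of a form. -/
def pullForm (f : N → M) {k : ℕ} (θ : DForm E M k) : DForm E' N k :=
  fun s => pullCov f k s (θ (f s))

theorem pullForm_apply (f : N → M) {k : ℕ} (θ : DForm E M k) (s : N)
    (m : Fin k → TangentSpace 𝓘(ℝ, E') s) :
    pullForm f θ s m = θ (f s) (fun i => mfderiv 𝓘(ℝ, E') 𝓘(ℝ, E) f s (m i)) := rfl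

variable [FiniteDimensional ℝ E'] [IsManifold 𝓘(ℝ, E') ∞ N]

theorem fderiv_chart_comp {f : N → M} {s₀ : N} {x₀ : M} {y : E'}
    (hy : y ∈ (extChartAt 𝓘(ℝ, E') s₀).target)
    (hf : MDifferentiableAt 𝓘(ℝ, E') 𝓘(ℝ, E) f ((extChartAt 𝓘(ℝ, E') s₀).symm y))
    (hx : f ((extChartAt 𝓘(ℝ, E') s₀).symm y) ∈ (chartAt E x₀).source) (e : E') :
    fderiv ℝ (extChartAt 𝓘(ℝ, E) x₀ ∘ f ∘ (extChartAt 𝓘(ℝ, E') s₀).symm) y e =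
    chartDeriv x₀ (f ((extChartAt 𝓘(ℝ, E') s₀).symm y))
      (mfderiv 𝓘(ℝ, E') 𝓘(ℝ, E) f ((extChartAt 𝓘(ℝ, E') s₀).symm y)
        (coordFrame E' s₀ ((extChartAt 𝓘(ℝ, E') s₀).symm y) e)) := by
  have h1 := (contMDiffAt_extChartAt_symm' hy).mdifferentiableAt (by simp)
  have h2 := (hf.hasMFDerivAt.comp y h1.hasMFDerivAt)
  have h3 : MDifferentiableAt 𝓘(ℝ, E) 𝓘(ℝ, E) (extChartAt 𝓘(ℝ, E) x₀)
    ((f ∘ (extChartAt 𝓘(ℝ, E') s₀).symm) y) := mdifferentiableAt_extChartAt hx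
  have h4 := (h3.hasMFDerivAt.comp y h2).mfderiv
  rw [coordFrame_eq_mfderiv hy, chartDeriv, ← mfderiv_eq_fderiv]
  exact DFunLike.congr_fun h4 e

theorem chartRep_pullForm {f : N → M} {k : ℕ} {θ : DForm E M k} {s₀ : N} {x₀ : M} {y : E'}
    (hy : y ∈ (extChartAt 𝓘(ℝ, E') s₀).target)
    (hf : MDifferentiableAt 𝓘(ℝ, E') 𝓘(ℝ, E) f ((extChartAt 𝓘(ℝ, E') s₀).symm y))
    (hx : f ((extChartAt 𝓘(ℝ, E') s₀).symm y) ∈ (chartAt E x₀).source) :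
    chartRep s₀ (pullForm f θ) y =
      (chartRep x₀ θ ((extChartAt 𝓘(ℝ, E) x₀ ∘ f ∘ (extChartAt 𝓘(ℝ, E') s₀).symm) y)
        ).compContinuousLinearMap
        (fderiv ℝ (extChartAt 𝓘(ℝ, E) x₀ ∘ f ∘ (extChartAt 𝓘(ℝ, E') s₀).symm) y) := by
  have h2 : (extChartAt 𝓘(ℝ, E) x₀).symm
      (extChartAt 𝓘(ℝ, E) x₀ (f ((extChartAt 𝓘(ℝ, E') s₀).symm y))) =
        f ((extChartAt 𝓘(ℝ, E') s₀).symm y) :=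
    (extChartAt 𝓘(ℝ, E) x₀).left_inv (by simpa using hx)
  ext m
  rw [chartRep, coords_apply, pullForm_apply, apply_eq_coords hx, chartRep]
  simp only [Function.comp_apply]
  rw [h2, ContinuousAlternatingMap.compContinuousLinearMap_apply]
  congr 1
  ext i
  exact (fderiv_chart_comp hy hf hx _).symm

/-- The pullback of an exterior derivative, in local coordinates. -/
theorem coords_pullForm_dForm {f : N → M} (hf : ContMDiff 𝓘(ℝ, E') 𝓘(ℝ, E) ∞ f) {k : ℕ}
    {θ : DForm E M k} (hθ : IsSmoothForm θ) {s₀ s : N} (hs : s ∈ (chartAt E' s₀).source) :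
    coords s₀ s (pullForm f (dForm θ) s) =
      extDeriv (chartRep s₀ (pullForm f θ)) (extChartAt 𝓘(ℝ, E') s₀ s) := by
  obtain ⟨y, hy, rfl⟩ : ∃ y ∈ (extChartAt 𝓘(ℝ, E') s₀).target,
      (extChartAt 𝓘(ℝ, E') s₀).symm y = s :=
    ⟨_, (extChartAt 𝓘(ℝ, E') s₀).map_source (by simpa using hs),
      (extChartAt 𝓘(ℝ, E') s₀).left_inv (by simpa using hs)⟩
  rw [(extChartAt 𝓘(ℝ, E') s₀).right_inv hy]
  set s := (extChartAt 𝓘(ℝ, E') s₀).symm y with hsdef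
  have hx : f s ∈ (chartAt E (f s)).source := mem_chart_source E (f s)
  have hcont : ContinuousAt (f ∘ (extChartAt 𝓘(ℝ, E') s₀).symm) y :=
    hf.continuous.continuousAt.comp (contMDiffAt_extChartAt_symm' hy).continuousAt
  -- The chart of the target is frozen at `f s`. Near `y` the form is then an honest pullback
  -- between vector spaces, to which `extDeriv_pullback` applies.
  have hev : chartRep s₀ (pullForm f θ) =ᶠ[𝓝 y] fun z =>
      (chartRep (f s) θ ((extChartAt 𝓘(ℝ, E) (f s) ∘ f ∘ (extChartAt 𝓘(ℝ, E') s₀).symm) z)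
        ).compContinuousLinearMap
        (fderiv ℝ (extChartAt 𝓘(ℝ, E) (f s) ∘ f ∘ (extChartAt 𝓘(ℝ, E') s₀).symm) z) := by
    filter_upwards [(isOpen_extChartAt_target (I := 𝓘(ℝ, E')) s₀).mem_nhds hy,
      hcont (chart_source_mem_nhds hx)] with z hz hz'
    exact chartRep_pullForm hz (hf.mdifferentiableAt (by simp)) hz'
  rw [hev.extDeriv_eq, extDeriv_pullback (r := ∞)]
  · ext m
    rw [coords_apply, pullForm_apply, dForm_apply,
      ContinuousAlternatingMap.compContinuousLinearMap_apply]
    congr 1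
    ext i
    exact (fderiv_chart_comp hy (hf.mdifferentiableAt (by simp)) hx _).symm
  · exact (hθ.contDiffAt_chartRep (mem_extChartAt_target (f s))).differentiableAt (by simp)
  · rw [← contMDiffAt_iff_contDiffAt]
    exact (contMDiffAt_extChartAt (x := f s)).comp y
      (hf.contMDiffAt.comp y (contMDiffAt_extChartAt_symm' hy))
  · simpa using two_le_infty

/-- `dForm` uses a different chart at every point. Independence of the chart is the pullback formula
for the identity map. -/
theorem coords_dForm {k : ℕ} {θ : DForm E M k} (hθ : IsSmoothForm θ) {x₀ x : M}
    (hx : x ∈ (chartAt E x₀).source) :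
    coords x₀ x (dForm θ x) = extDeriv (chartRep x₀ θ) (extChartAt 𝓘(ℝ, E) x₀ x) := by
  have hid : ∀ {k : ℕ} (η : DForm E M k), pullForm (fun x : M => x) η = η := by
    intro k η
    funext s
    ext m
    rw [pullForm_apply]
    have : mfderiv 𝓘(ℝ, E) 𝓘(ℝ, E) (fun x : M => x) s = ContinuousLinearMap.id ℝ _ := mfderiv_id
    rw [this]
    rfl
  have := coords_pullForm_dForm (f := fun x : M => x) contMDiff_id hθ hx
  rwa [hid, hid] at this

/-- The exterior derivative commutes with pullback. -/
theorem dForm_pullForm {f : N → M} (hf : ContMDiff 𝓘(ℝ, E') 𝓘(ℝ, E) ∞ f) {k : ℕ}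
    {θ : DForm E M k} (hθ : IsSmoothForm θ) :
    dForm (pullForm f θ) = pullForm (E' := E') f (dForm θ) := by
  funext s
  ext m
  rw [apply_eq_coords (mem_chart_source E' s),
    apply_eq_coords (mem_chart_source E' s) (pullForm f (dForm θ) s),
    coords_pullForm_dForm hf hθ (mem_chart_source E' s), coords_apply, dForm_apply]
  congr 1
  ext i
  rw [coordFrame_chartDeriv (mem_chart_source E' s)]

theorem contDiffAt_extDeriv {k : ℕ} {θ : E → E [⋀^Fin k]→L[ℝ] ℝ} {y : E}
    (hθ : ContDiffAt ℝ ∞ θ y) : ContDiffAt ℝ ∞ (extDeriv θ) y := by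
  have h := (ContinuousAlternatingMap.alternatizeUncurryFinCLM ℝ E ℝ (n := k)
    ).contDiff.contDiffAt.comp y (hθ.fderiv_right (m := ∞) (by simp))
  exact h

theorem isSmoothForm_dForm {k : ℕ} {θ : DForm E M k} (hθ : IsSmoothForm θ) :
    IsSmoothForm (dForm θ) := by
  intro x
  have h1 := contDiffAt_extDeriv (hθ.contDiffAt_chartRep (mem_extChartAt_target x))
  have h2 := h1.contMDiffAt.comp x (contMDiffAt_extChartAt (n := ∞))
  refine h2.congr_of_eventuallyEq ?_
  filter_upwards [chart_source_mem_nhds (mem_chart_source E x)] with y hy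
  exact coords_dForm hθ hy

theorem dForm_dForm {k : ℕ} {θ : DForm E M k} (hθ : IsSmoothForm θ) :
    dForm (dForm θ) = 0 := by
  funext x
  ext m
  -- At the centre of the chart this is the definition of `dForm`; the outer derivative needs it at
  -- nearby points as well, where it rests on independence of the chart.
  have hev : chartRep x (dForm θ) =ᶠ[𝓝 (extChartAt 𝓘(ℝ, E) x x)]
      extDeriv (chartRep x θ) := by
    filter_upwards [extChartAt_target_mem_nhds (I := 𝓘(ℝ, E)) x] with y hy
    have hx : (extChartAt 𝓘(ℝ, E) x).symm y ∈ (chartAt E x).source := by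
      simpa using (extChartAt 𝓘(ℝ, E) x).map_target hy
    rw [chartRep, coords_dForm hθ hx, (extChartAt 𝓘(ℝ, E) x).right_inv hy]
  rw [dForm_apply, hev.extDeriv_eq, extDeriv_extDeriv_apply
    (hθ.contDiffAt_chartRep (mem_extChartAt_target x)) (by simpa using two_le_infty)]
  rfl

theorem chartRep_congr {k : ℕ} {θ θ' : DForm E M k} {x : M} (h : ∀ᶠ y in 𝓝 x, θ y = θ' y) :
    chartRep x θ =ᶠ[𝓝 (extChartAt 𝓘(ℝ, E) x x)] chartRep x θ' := by
  have hc : Filter.Tendsto (extChartAt 𝓘(ℝ, E) x).symm (𝓝 (extChartAt 𝓘(ℝ, E) x x)) (𝓝 x) := by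
    simpa [ContinuousAt] using continuousAt_extChartAt_symm (I := 𝓘(ℝ, E)) x
  filter_upwards [hc.eventually h] with y hy
  rw [chartRep, chartRep, hy]

theorem dForm_congr {k : ℕ} {θ θ' : DForm E M k} {x : M} (h : ∀ᶠ y in 𝓝 x, θ y = θ' y) :
    dForm θ x = dForm θ' x := by
  ext m
  rw [dForm_apply, dForm_apply, (chartRep_congr h).extDeriv_eq]

theorem dForm_add {k : ℕ} {θ θ' : DForm E M k} (hθ : IsSmoothForm θ) (hθ' : IsSmoothForm θ') :
    dForm (θ + θ') = dForm θ + dForm θ' := by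
  funext x
  ext m
  have : chartRep x (θ + θ') = chartRep x θ + chartRep x θ' := rfl
  rw [Pi.add_apply, ContinuousAlternatingMap.add_apply, dForm_apply, this, extDeriv_add
    ((hθ.contDiffAt_chartRep (mem_extChartAt_target x)).differentiableAt (by simp))
    ((hθ'.contDiffAt_chartRep (mem_extChartAt_target x)).differentiableAt (by simp))]
  rfl

end Charts


/-! ### Smooth sections, contractions and derivatives of functions -/

section SmoothForms

variable {E : Type u} [NormedAddCommGroup E] [NormedSpace ℝ E] [FiniteDimensional ℝ E]
  {M : Type v} [TopologicalSpace M] [ChartedSpace E M] [IsManifold 𝓘(ℝ, E) ∞ M]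
  {E' : Type u'} [NormedAddCommGroup E'] [NormedSpace ℝ E']
  {N : Type v'} [TopologicalSpace N] [ChartedSpace E' N]

theorem isSmoothAlong_zero (f : N → M) (k : ℕ) :
    IsSmoothAlong (E' := E') f (fun t => (0 : AltForm E k (f t))) :=
  fun t => (contMDiffAt_const (c := (0 : E [⋀^Fin k]→L[ℝ] ℝ)) :
    ContMDiffAt 𝓘(ℝ, E') 𝓘(ℝ, E [⋀^Fin k]→L[ℝ] ℝ) ∞ (fun _ => (0 : E [⋀^Fin k]→L[ℝ] ℝ)) t)

theorem IsSmoothAlong.add {f : N → M} {k : ℕ} {ξ ζ : ∀ t : N, AltForm E k (f t)}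
    (hξ : IsSmoothAlong (E' := E') f ξ) (hζ : IsSmoothAlong (E' := E') f ζ) :
    IsSmoothAlong (E' := E') f (fun t => ξ t + ζ t) :=
  fun t => (hξ t).add (hζ t)

theorem IsSmoothAlong.sub {f : N → M} {k : ℕ} {ξ ζ : ∀ t : N, AltForm E k (f t)}
    (hξ : IsSmoothAlong (E' := E') f ξ) (hζ : IsSmoothAlong (E' := E') f ζ) :
    IsSmoothAlong (E' := E') f (fun t => ξ t - ζ t) :=
  fun t => (hξ t).sub (hζ t)

theorem IsSmoothAlong.smul {f : N → M} {k : ℕ} {ξ : ∀ t : N, AltForm E k (f t)} {g : N → ℝ}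
    (hg : IsSmoothFn E' g) (hξ : IsSmoothAlong (E' := E') f ξ) :
    IsSmoothAlong (E' := E') f (fun t => g t • ξ t) :=
  fun t => (hg t).smul (hξ t)

theorem isSmoothAlong_of_eventuallyEq {f : N → M} {k : ℕ} {ξ : ∀ t : N, AltForm E k (f t)}
    (h : ∀ t, ∃ ζ : ∀ t : N, AltForm E k (f t), IsSmoothAlong (E' := E') f ζ ∧
      ∀ᶠ s in 𝓝 t, ξ s = ζ s) : IsSmoothAlong (E' := E') f ξ := by
  intro t
  obtain ⟨ζ, hζ, hev⟩ := h t
  refine (hζ t).congr_of_eventuallyEq ?_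
  filter_upwards [hev] with s hs
  rw [hs]

/-- A smooth form restricts to a smooth section along any smooth map. -/
theorem IsSmoothForm.along {k : ℕ} {θ : DForm E M k} (hθ : IsSmoothForm θ) {f : N → M}
    (hf : ContMDiff 𝓘(ℝ, E') 𝓘(ℝ, E) ∞ f) : IsSmoothAlong (E' := E') f (fun t => θ (f t)) :=
  fun t => (hθ (f t)).comp t (hf t)

theorem isSmoothVF_iff {V : VField E M} :
    IsSmoothVF V ↔ ∀ x, ContMDiffAt 𝓘(ℝ, E) 𝓘(ℝ, E) ∞ (fun y => chartDeriv x y (V y)) x := by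
  refine forall_congr' fun x => ?_
  rw [Bundle.contMDiffAt_section]
  refine Filter.EventuallyEq.contMDiffAt_iff ?_
  filter_upwards [chart_source_mem_nhds (mem_chart_source E x)] with y hy
  rw [chartDeriv_eq_continuousLinearMapAt hy]
  exact (Bundle.Trivialization.continuousLinearMapAt_apply_of_mem ℝ _ (by simpa using hy) _).symm

theorem IsSmoothVF.add {V W : VField E M} (hV : IsSmoothVF V) (hW : IsSmoothVF W) :
    IsSmoothVF (V + W) := by
  rw [isSmoothVF_iff] at *
  intro x
  refine ((hV x).add (hW x)).congr_of_eventuallyEq (Filter.Eventually.of_forall fun y => ?_)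
  exact map_add _ _ _

theorem contract_apply {k : ℕ} {x : M} (v : TangentSpace 𝓘(ℝ, E) x) (η : AltForm E (k + 1) x)
    (m : Fin k → TangentSpace 𝓘(ℝ, E) x) : contract v η m = η (Fin.cons v m) := rfl

theorem coords_contract {k : ℕ} {x₀ x : M} (hx : x ∈ (chartAt E x₀).source)
    (v : TangentSpace 𝓘(ℝ, E) x) (η : AltForm E (k + 1) x) :
    coords x₀ x (contract v η) = (coords x₀ x η).curryLeft (chartDeriv x₀ x v) := by
  ext m
  rw [coords_apply, contract_apply, ContinuousAlternatingMap.curryLeft_apply_apply, coords_apply]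
  congr 1
  ext i
  refine Fin.cases ?_ (fun j => ?_) i
  · exact (coordFrame_chartDeriv hx v).symm
  · rfl

/-- The contraction of a smooth section of `f* Λᵏ T*M` with a smooth vector field. -/
theorem IsSmoothAlong.contract {f : N → M} (hf : ContMDiff 𝓘(ℝ, E') 𝓘(ℝ, E) ∞ f) {k : ℕ}
    {ξ : ∀ t : N, AltForm E (k + 1) (f t)}
    (hξ : IsSmoothAlong (E' := E') f ξ) {V : VField E M} (hV : IsSmoothVF V) :
    IsSmoothAlong (E' := E') f (fun t => contract (V (f t)) (ξ t)) := by
  intro t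
  have h1 := (isSmoothVF_iff.1 hV (f t)).comp t (hf t)
  rw [contMDiffAt_alternating_iff]
  intro m
  let b := Module.finBasis ℝ E
  -- Expanding the vector field in a fixed basis of `E` reduces the claim to products of smooth
  -- scalar functions.
  have h2 : ContMDiffAt 𝓘(ℝ, E') 𝓘(ℝ, ℝ) ∞ (fun s => ∑ i,
      (b.coord i).toContinuousLinearMap (chartDeriv (f t) (f s) (V (f s))) *
        coords (f t) (f s) (ξ s) (Fin.cons (b i) m)) t := by
    refine contMDiffAt_finsetSum fun i _ => ?_
    exact ((b.coord i).toContinuousLinearMap.contMDiff.contMDiffAt.comp t h1).mul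
      (contMDiffAt_alternating_iff.1 (hξ t) _)
  refine h2.congr_of_eventuallyEq ?_
  filter_upwards [(hf t).continuousAt (chart_source_mem_nhds (mem_chart_source E (f t)))] with s hs
  rw [coords_contract hs]
  conv_lhs => rw [← b.sum_repr (chartDeriv (f t) (f s) (V (f s)))]
  rw [map_sum, ContinuousAlternatingMap.sum_apply]
  refine Finset.sum_congr rfl fun i _ => ?_
  rw [map_smul]
  rfl

theorem isSmoothForm_interior {k : ℕ} {V : VField E M} (hV : IsSmoothVF V)
    {θ : DForm E M (k + 1)} (hθ : IsSmoothForm θ) : IsSmoothForm (interior V θ) :=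
  IsSmoothAlong.contract contMDiff_id hθ hV

theorem pairing_apply {x : M} (β : AltForm E 1 x) (v : TangentSpace 𝓘(ℝ, E) x) :
    pairing x β v = β (fun _ => v) := rfl

theorem altForm_one_ext {x : M} {α β : AltForm E 1 x} (h : ∀ v, pairing x α v = pairing x β v) :
    α = β := by
  ext m
  have : m = fun _ => m 0 := by ext i; rw [Subsingleton.elim i 0]
  rw [this]
  exact h _

/-- The function `t ↦ ξ t (V (f t))` is smooth. -/
theorem IsSmoothAlong.pairing {f : N → M} (hf : ContMDiff 𝓘(ℝ, E') 𝓘(ℝ, E) ∞ f)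
    {ξ : ∀ t : N, AltForm E 1 (f t)}
    (hξ : IsSmoothAlong (E' := E') f ξ) {V : VField E M} (hV : IsSmoothVF V) :
    IsSmoothFn E' (fun t => pairing (f t) (ξ t) (V (f t))) := by
  intro t
  -- The contraction is a form of degree `0`, evaluated here on the empty tuple.
  have h := contMDiffAt_alternating_iff.1 (IsSmoothAlong.contract hf hξ hV t) (fun i => i.elim0)
  refine h.congr_of_eventuallyEq (Filter.Eventually.of_forall fun s => ?_)
  simp only [coords_apply, contract_apply, pairing_apply]
  congr 1
  ext i
  rw [Subsingleton.elim i 0]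
  rfl

theorem isSmoothFn_pairing {β : DForm E M 1} (hβ : IsSmoothForm β) {V : VField E M}
    (hV : IsSmoothVF V) : IsSmoothFn E (fun x => pairing x (β x) (V x)) :=
  IsSmoothAlong.pairing contMDiff_id hβ hV

/-- A function as a form of degree zero. -/
def constForm (g : M → ℝ) : DForm E M 0 := fun x =>
  ContinuousAlternatingMap.constOfIsEmpty ℝ (TangentSpace 𝓘(ℝ, E) x) (Fin 0) (g x)

theorem isSmoothForm_constForm {g : M → ℝ} (hg : IsSmoothFn E g) :
    IsSmoothForm (constForm (E := E) g) :=
  fun x => contMDiffAt_alternating_iff.2 fun _ => hg x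

theorem dirDeriv_eq_fderiv {g : M → ℝ} {x₀ x : M} (hg : MDifferentiableAt 𝓘(ℝ, E) 𝓘(ℝ, ℝ) g x)
    (hx : x ∈ (chartAt E x₀).source) (v : TangentSpace 𝓘(ℝ, E) x) :
    dirDeriv E g x v = fderiv ℝ (g ∘ (extChartAt 𝓘(ℝ, E) x₀).symm) (extChartAt 𝓘(ℝ, E) x₀ x)
      (chartDeriv x₀ x v) := by
  obtain ⟨y, hy, rfl⟩ : ∃ y ∈ (extChartAt 𝓘(ℝ, E) x₀).target,
      (extChartAt 𝓘(ℝ, E) x₀).symm y = x :=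
    ⟨_, (extChartAt 𝓘(ℝ, E) x₀).map_source (by simpa using hx),
      (extChartAt 𝓘(ℝ, E) x₀).left_inv (by simpa using hx)⟩
  have h1 := (contMDiffAt_extChartAt_symm' hy).mdifferentiableAt (by simp)
  have h2 := mfderiv_comp y hg h1
  have h0 : fderiv ℝ (g ∘ (extChartAt 𝓘(ℝ, E) x₀).symm) y =
      mfderiv 𝓘(ℝ, E) 𝓘(ℝ, ℝ) (g ∘ (extChartAt 𝓘(ℝ, E) x₀).symm) y := mfderiv_eq_fderiv.symm
  rw [(extChartAt 𝓘(ℝ, E) x₀).right_inv hy, h0, h2]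
  have h3 : mfderiv 𝓘(ℝ, E) 𝓘(ℝ, E) (extChartAt 𝓘(ℝ, E) x₀).symm y
      (chartDeriv (E := E) x₀ ((extChartAt 𝓘(ℝ, E) x₀).symm y) v) = v := by
    rw [← coordFrame_eq_mfderiv hy]
    exact coordFrame_chartDeriv hx v
  exact (congrArg (mfderiv 𝓘(ℝ, E) 𝓘(ℝ, ℝ) g ((extChartAt 𝓘(ℝ, E) x₀).symm y)) h3).symm

theorem dForm_constForm {g : M → ℝ} (hg : IsSmoothFn E g) :
    dForm (constForm (E := E) g) = dFun E g := by
  funext x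
  refine altForm_one_ext fun v => ?_
  rw [pairing_apply, dForm_apply]
  have : chartRep x (constForm (E := E) g) = fun y =>
    ContinuousAlternatingMap.constOfIsEmpty ℝ E (Fin 0) ((g ∘ (extChartAt 𝓘(ℝ, E) x).symm) y) := rfl
  rw [this, extDeriv_constOfIsEmpty]
  exact (dirDeriv_eq_fderiv ((hg x).mdifferentiableAt (by simp)) (mem_chart_source E x) v).symm

theorem isSmoothForm_dFun {g : M → ℝ} (hg : IsSmoothFn E g) : IsSmoothForm (dFun E g) := by
  rw [← dForm_constForm hg]
  exact isSmoothForm_dForm (isSmoothForm_constForm hg)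

theorem dForm_dFun {g : M → ℝ} (hg : IsSmoothFn E g) : dForm (dFun E g) = 0 := by
  rw [← dForm_constForm hg]
  exact dForm_dForm (isSmoothForm_constForm hg)

theorem pairing_dFun (g : M → ℝ) (x : M) (v : TangentSpace 𝓘(ℝ, E) x) :
    pairing x (dFun E g x) v = dirDeriv E g x v := rfl

theorem interior_eq_constForm (V : VField E M) (β : DForm E M 1) :
    interior V β = constForm (fun x => pairing x (β x) (V x)) := by
  funext x
  ext m
  show β x (Fin.cons (V x) m) = β x (fun _ => V x)
  congr 1
  ext i
  fin_cases i
  rfl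

theorem dForm_interior {V : VField E M} (hV : IsSmoothVF V) {β : DForm E M 1}
    (hβ : IsSmoothForm β) :
    dForm (interior V β) = dFun E (fun x => pairing x (β x) (V x)) := by
  rw [interior_eq_constForm, dForm_constForm (isSmoothFn_pairing hβ hV)]

theorem isSmoothFn_dirDeriv {g : M → ℝ} (hg : IsSmoothFn E g) {V : VField E M}
    (hV : IsSmoothVF V) : IsSmoothFn E (fun x => dirDeriv E g x (V x)) :=
  isSmoothFn_pairing (isSmoothForm_dFun hg) hV

theorem IsSmoothFn.mdifferentiableAt {g : M → ℝ} (hg : IsSmoothFn E g) (x : M) :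
    MDifferentiableAt 𝓘(ℝ, E) 𝓘(ℝ, ℝ) g x := (hg x).mdifferentiableAt (by simp)

theorem dirDeriv_add {g h : M → ℝ} (hg : IsSmoothFn E g) (hh : IsSmoothFn E h) (x : M)
    (v : TangentSpace 𝓘(ℝ, E) x) :
    dirDeriv E (fun y => g y + h y) x v = dirDeriv E g x v + dirDeriv E h x v := by
  have := mfderiv_add (hg.mdifferentiableAt x) (hh.mdifferentiableAt x)
  exact DFunLike.congr_fun this v

theorem dirDeriv_neg (g : M → ℝ) (x : M) (v : TangentSpace 𝓘(ℝ, E) x) :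
    dirDeriv E (fun y => - g y) x v = - dirDeriv E g x v := by
  have : mfderiv 𝓘(ℝ, E) 𝓘(ℝ, ℝ) (-g) x = -mfderiv 𝓘(ℝ, E) 𝓘(ℝ, ℝ) g x := mfderiv_neg
  exact DFunLike.congr_fun this v

theorem dirDeriv_mul {g h : M → ℝ} (hg : IsSmoothFn E g) (hh : IsSmoothFn E h) (x : M)
    (v : TangentSpace 𝓘(ℝ, E) x) :
    dirDeriv E (fun y => g y * h y) x v = g x * dirDeriv E h x v + h x * dirDeriv E g x v := by
  have := ((hg.mdifferentiableAt x).hasMFDerivAt.mul (hh.mdifferentiableAt x).hasMFDerivAt).mfderiv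
  exact DFunLike.congr_fun this v

theorem dirDeriv_const (c : ℝ) (x : M) (v : TangentSpace 𝓘(ℝ, E) x) :
    dirDeriv E (fun _ => c) x v = 0 := by
  rw [dirDeriv, mfderiv_const]; rfl

theorem dirDeriv_congr {g h : M → ℝ} {x : M} (hgh : ∀ᶠ y in 𝓝 x, g y = h y)
    (v : TangentSpace 𝓘(ℝ, E) x) : dirDeriv E g x v = dirDeriv E h x v := by
  rw [dirDeriv, dirDeriv, Filter.EventuallyEq.mfderiv_eq hgh]
  rfl

theorem dirDeriv_comp {f : N → M} {s : N} (hf : MDifferentiableAt 𝓘(ℝ, E') 𝓘(ℝ, E) f s)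
    {g : M → ℝ} (hg : IsSmoothFn E g) (v : TangentSpace 𝓘(ℝ, E') s) :
    dirDeriv E' (fun t => g (f t)) s v =
      dirDeriv E g (f s) (mfderiv 𝓘(ℝ, E') 𝓘(ℝ, E) f s v) := by
  have := mfderiv_comp s (hg.mdifferentiableAt (f s)) hf
  exact DFunLike.congr_fun this v

/-- The product rule for the exterior derivative of `g β`. -/
theorem dForm_smul {g : M → ℝ} (hg : IsSmoothFn E g) {β : DForm E M 1} (hβ : IsSmoothForm β)
    (x : M) (a b : TangentSpace 𝓘(ℝ, E) x) :
    dForm (fun y => g y • β y) x ![a, b] = g x * dForm β x ![a, b] + wedgeVal g x (β x) a b := by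
  have hd := (hβ.contDiffAt_chartRep (mem_extChartAt_target x)).differentiableAt (by simp)
  have hgd : DifferentiableAt ℝ (g ∘ (extChartAt 𝓘(ℝ, E) x).symm) (extChartAt 𝓘(ℝ, E) x x) := by
    rw [← mdifferentiableAt_iff_differentiableAt]
    refine MDifferentiableAt.comp _ (hg.mdifferentiableAt _) ?_
    exact (contMDiffAt_extChartAt_symm' (mem_extChartAt_target x)).mdifferentiableAt (by simp)
  have hrep : chartRep x (fun y => g y • β y) =
    fun y => (g ∘ (extChartAt 𝓘(ℝ, E) x).symm) y • chartRep x β y := rfl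
  have hx : (extChartAt 𝓘(ℝ, E) x).symm (extChartAt 𝓘(ℝ, E) x x) = x := extChartAt_to_inv x
  have key : ∀ w : TangentSpace 𝓘(ℝ, E) x,
      chartRep x β (extChartAt 𝓘(ℝ, E) x x) (fun _ => chartDeriv x x w) = pairing x (β x) w := by
    intro w
    rw [chartRep, hx, ← apply_eq_coords (mem_chart_source E x)]
    rfl
  rw [dForm_apply, dForm_apply, hrep, extDeriv, extDeriv,
    ContinuousAlternatingMap.alternatizeUncurryFin_apply,
    ContinuousAlternatingMap.alternatizeUncurryFin_apply, fderiv_fun_smul hgd hd, wedgeVal,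
    dirDeriv_eq_fderiv (hg.mdifferentiableAt x) (mem_chart_source E x),
    dirDeriv_eq_fderiv (hg.mdifferentiableAt x) (mem_chart_source E x), ← key, ← key]
  -- The alternating sum defining `extDeriv` has two terms, one for each vector that is singled out;
  -- `t0` and `t1` identify the remaining argument.
  have t0 : (Fin.tail fun i => chartDeriv x x (![a, b] i)) = fun _ : Fin 1 => chartDeriv x x b := by
    ext i; fin_cases i; rfl
  have t1 : (Fin.removeNth 1 fun i => chartDeriv x x (![a, b] i)) =
      fun _ : Fin 1 => chartDeriv x x a := by
    ext i; fin_cases i; rfl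
  simp [Fin.sum_univ_two, t0, t1]
  ring

end SmoothForms


/-! ### Cut-offs, coordinate frames and the Lie bracket as a commutator -/

section Frames

variable {E : Type u} [NormedAddCommGroup E] [NormedSpace ℝ E] [FiniteDimensional ℝ E]
  {M : Type v} [TopologicalSpace M] [ChartedSpace E M] [IsManifold 𝓘(ℝ, E) ∞ M]

/-- The algebroid axioms concern globally defined sections, so local coordinates have to be cut off.
Hausdorffness enters here: a compactly supported function in a chart extends smoothly by zero
because its support is closed in `M`. -/
theorem exists_bump [T2Space M] {x : M} {U : Set M} (hU : U ∈ 𝓝 x) :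
    ∃ χ : M → ℝ, IsSmoothFn E χ ∧ tsupport χ ⊆ U ∧ ∀ᶠ y in 𝓝 x, χ y = 1 := by
  obtain ⟨χ, -, hχ⟩ := (SmoothBumpFunction.nhds_basis_tsupport (I := 𝓘(ℝ, E)) x).mem_iff.1 hU
  exact ⟨χ, χ.contMDiff, hχ, χ.eventuallyEq_one⟩

theorem isSmoothFn_bump_mul {χ g : M → ℝ} {U : Set M} (hU : IsOpen U) (hχ : IsSmoothFn E χ)
    (hs : tsupport χ ⊆ U) (hg : ContMDiffOn 𝓘(ℝ, E) 𝓘(ℝ, ℝ) ∞ g U) :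
    IsSmoothFn E (fun y => χ y * g y) := by
  refine contMDiff_of_tsupport fun x hx => ?_
  have hx' : x ∈ U := hs (closure_mono (Function.support_mul_subset_left _ _) hx)
  exact (hχ x).mul (hg.contMDiffAt (hU.mem_nhds hx'))

/-- A function which is smooth near `x` agrees near `x` with a smooth function. -/
theorem exists_smooth_extension [T2Space M] {g : M → ℝ} {U : Set M} (hU : IsOpen U) {x : M}
    (hx : x ∈ U) (hg : ContMDiffOn 𝓘(ℝ, E) 𝓘(ℝ, ℝ) ∞ g U) :
    ∃ g' : M → ℝ, IsSmoothFn E g' ∧ ∀ᶠ y in 𝓝 x, g' y = g y := by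
  obtain ⟨χ, hχ, hs, h1⟩ := exists_bump (E := E) (hU.mem_nhds hx)
  refine ⟨_, isSmoothFn_bump_mul hU hχ hs hg, ?_⟩
  filter_upwards [h1] with y hy
  rw [hy, one_mul]

/-- Smooth functions `h i` and smooth vector fields `W i` which on `U` are coordinates and the
corresponding coordinate vector fields. -/
structure IsCoordFrame {ι : Type*} [Fintype ι] [DecidableEq ι] (h : ι → M → ℝ)
    (W : ι → VField E M) (U : Set M) : Prop where
  isOpen : IsOpen U
  smooth_fn : ∀ i, IsSmoothFn E (h i)
  smooth_vf : ∀ i, IsSmoothVF (W i)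
  dual : ∀ y ∈ U, ∀ i j, dirDeriv E (h i) y (W j y) = if i = j then 1 else 0
  expand : ∀ y ∈ U, ∀ v, v = ∑ i, dirDeriv E (h i) y v • W i y

theorem contMDiffOn_chart {ψ : OpenPartialHomeomorph M E}
    (hψ : ψ ∈ IsManifold.maximalAtlas 𝓘(ℝ, E) ∞ M) :
    ContMDiffOn 𝓘(ℝ, E) 𝓘(ℝ, E) ∞ ψ ψ.source :=
  contMDiffOn_of_mem_maximalAtlas hψ

theorem chart_mdifferentiable {ψ : OpenPartialHomeomorph M E}
    (hψ : ψ ∈ IsManifold.maximalAtlas 𝓘(ℝ, E) ∞ M) : ψ.MDifferentiable 𝓘(ℝ, E) 𝓘(ℝ, E) :=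
  ⟨(contMDiffOn_of_mem_maximalAtlas hψ).mdifferentiableOn (by simp),
    (contMDiffOn_symm_of_mem_maximalAtlas hψ).mdifferentiableOn (by simp)⟩

theorem IsSmoothVF.smul {g : M → ℝ} (hg : IsSmoothFn E g) {V : VField E M} (hV : IsSmoothVF V) :
    IsSmoothVF (fun x => g x • V x) := by
  rw [isSmoothVF_iff] at *
  intro x
  refine ((hg x).smul (hV x)).congr_of_eventuallyEq (Filter.Eventually.of_forall fun y => ?_)
  exact map_smul _ _ _

theorem isSmoothVF_zero : IsSmoothVF (0 : VField E M) := by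
  rw [isSmoothVF_iff]
  intro x
  refine (contMDiffAt_const (c := (0 : E))).congr_of_eventuallyEq
    (Filter.Eventually.of_forall fun y => ?_)
  exact map_zero _

theorem isSmoothVF_sum {ι : Type*} (s : Finset ι) {V : ι → VField E M}
    (hV : ∀ i, IsSmoothVF (V i)) : IsSmoothVF (fun x => ∑ i ∈ s, V i x) := by
  classical
  induction s using Finset.induction_on with
  | empty => simp only [Finset.sum_empty]; exact isSmoothVF_zero
  | insert a s ha ih =>
    simp only [Finset.sum_insert ha]
    exact (hV a).add ih

theorem isSmoothVF_of_eventuallyEq {V : VField E M}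
    (h : ∀ x, ∃ W : VField E M, IsSmoothVF W ∧ ∀ᶠ y in 𝓝 x, V y = W y) : IsSmoothVF V := by
  rw [isSmoothVF_iff]
  intro x
  obtain ⟨W, hW, hev⟩ := h x
  refine (isSmoothVF_iff.1 hW x).congr_of_eventuallyEq ?_
  filter_upwards [hev] with y hy
  rw [hy]

/-- The coordinate vector fields of a chart, cut off by a bump function, are smooth. -/
theorem isSmoothVF_bump_chart {ψ : OpenPartialHomeomorph M E}
    (hψ : ψ ∈ IsManifold.maximalAtlas 𝓘(ℝ, E) ∞ M) {χ : M → ℝ} (hχ : IsSmoothFn E χ)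
    (hs : tsupport χ ⊆ ψ.source) (e : E) :
    IsSmoothVF (fun y => χ y • ((mfderiv 𝓘(ℝ, E) 𝓘(ℝ, E) ψ y).inverse e :
      TangentSpace 𝓘(ℝ, E) y)) := by
  rw [isSmoothVF_iff]
  intro z
  by_cases hz : z ∈ ψ.source
  -- In the chart at `z` the field is `χ` times the derivative of the transition map `extChartAt z ∘
  -- ψ⁻¹` applied to `e`, which is visibly smooth.
  · have hτ : ContDiffAt ℝ ∞ (extChartAt 𝓘(ℝ, E) z ∘ ψ.symm) (ψ z) := by
      rw [← contMDiffAt_iff_contDiffAt]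
      have h1 : ContMDiffAt 𝓘(ℝ, E) 𝓘(ℝ, E) ∞ ψ.symm (ψ z) :=
        (contMDiffOn_symm_of_mem_maximalAtlas hψ).contMDiffAt
          (ψ.open_target.mem_nhds (ψ.map_source hz))
      have h2 : ContMDiffAt 𝓘(ℝ, E) 𝓘(ℝ, E) ∞ (extChartAt 𝓘(ℝ, E) z) (ψ.symm (ψ z)) := by
        rw [ψ.left_inv hz]; exact contMDiffAt_extChartAt
      exact h2.comp _ h1
    have h3 : ContMDiffAt 𝓘(ℝ, E) 𝓘(ℝ, E) ∞
        (fun y => fderiv ℝ (extChartAt 𝓘(ℝ, E) z ∘ ψ.symm) (ψ y) e) z := by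
      have h4 : ContDiffAt ℝ ∞ (fun y => fderiv ℝ (extChartAt 𝓘(ℝ, E) z ∘ ψ.symm) y e) (ψ z) :=
        (hτ.fderiv_right (m := ∞) (by simp)).clm_apply contDiffAt_const
      exact h4.contMDiffAt.comp z ((contMDiffOn_chart hψ).contMDiffAt (ψ.open_source.mem_nhds hz))
    refine ((hχ z).smul h3).congr_of_eventuallyEq ?_
    filter_upwards [ψ.open_source.mem_nhds hz, chart_source_mem_nhds (mem_chart_source E z)]
      with y hy hy'
    rw [map_smul]
    congr 1
    let L := (chart_mdifferentiable hψ).mfderiv hy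
    have hL : mfderiv 𝓘(ℝ, E) 𝓘(ℝ, E) ψ y = L := rfl
    rw [hL, ContinuousLinearMap.inverse_equiv]
    obtain ⟨v, rfl⟩ := L.surjective e
    have h5 : chartDeriv z y v =
        fderiv ℝ (extChartAt 𝓘(ℝ, E) z ∘ ψ.symm) (ψ y) (L v) := by
      have h6 : MDifferentiableAt 𝓘(ℝ, E) 𝓘(ℝ, E) (extChartAt 𝓘(ℝ, E) z ∘ ψ.symm) (ψ y) := by
        have h1 : MDifferentiableAt 𝓘(ℝ, E) 𝓘(ℝ, E) ψ.symm (ψ y) :=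
          (chart_mdifferentiable hψ).mdifferentiableAt_symm (ψ.map_source hy)
        have h2 : MDifferentiableAt 𝓘(ℝ, E) 𝓘(ℝ, E) (extChartAt 𝓘(ℝ, E) z) (ψ.symm (ψ y)) := by
          rw [ψ.left_inv hy]; exact mdifferentiableAt_extChartAt hy'
        exact h2.comp _ h1
      have h7 := mfderiv_comp y h6 ((chart_mdifferentiable hψ).mdifferentiableAt hy)
      have h8 : ((extChartAt 𝓘(ℝ, E) z ∘ ψ.symm) ∘ ψ) =ᶠ[𝓝 y] extChartAt 𝓘(ℝ, E) z := by
        filter_upwards [ψ.open_source.mem_nhds hy] with w hw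
        simp only [Function.comp_apply, ψ.left_inv hw]
      rw [h8.mfderiv_eq] at h7
      have h9 := DFunLike.congr_fun h7 v
      rw [mfderiv_eq_fderiv] at h9
      exact h9
    exact (congrArg (chartDeriv z y) (L.symm_apply_apply v)).trans h5
  -- Off the domain of `ψ` the value of `inverse` carries no meaning, but `χ` vanishes near `z`.
  · have h1 : ∀ᶠ y in 𝓝 z, χ y = 0 := by
      have : z ∉ tsupport χ := fun h => hz (hs h)
      exact notMem_tsupport_iff_eventuallyEq.1 this
    refine (contMDiffAt_const (c := (0 : E))).congr_of_eventuallyEq ?_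
    filter_upwards [h1] with y hy
    rw [hy, zero_smul, map_zero]

/-- The coordinates and coordinate fields of `ψ` are multiplied by a bump function, and `U` is an
open set where that function is `1`. Any chart of the maximal atlas and any basis are allowed,
because the slice charts of an immersion are used later. -/
theorem exists_coordFrame [T2Space M] {ι : Type*} [Fintype ι] [DecidableEq ι]
    (b : Module.Basis ι ℝ E) {ψ : OpenPartialHomeomorph M E}
    (hψ : ψ ∈ IsManifold.maximalAtlas 𝓘(ℝ, E) ∞ M) {x : M} (hx : x ∈ ψ.source) :
    ∃ (h : ι → M → ℝ) (W : ι → VField E M) (U : Set M), IsCoordFrame h W U ∧ x ∈ U ∧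
      ∀ i, ∀ y ∈ U, h i y = b.coord i (ψ y) := by
  obtain ⟨χ, hχ, hs, h1⟩ := exists_bump (E := E) (ψ.open_source.mem_nhds hx)
  obtain ⟨U, hU1, hU, hxU⟩ := mem_nhds_iff.1 (Filter.inter_mem h1 (ψ.open_source.mem_nhds hx))
  have hcoord : ∀ i, ContMDiffOn 𝓘(ℝ, E) 𝓘(ℝ, ℝ) ∞ (fun y => b.coord i (ψ y)) ψ.source :=
    fun i => (b.coord i).toContinuousLinearMap.contMDiff.comp_contMDiffOn (contMDiffOn_chart hψ)
  have hχ1 : ∀ y ∈ U, χ y = 1 := fun y hy => (hU1 hy).1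
  have hsrc : ∀ y ∈ U, y ∈ ψ.source := fun y hy => (hU1 hy).2
  have hd : ∀ y ∈ U, ∀ i (v : TangentSpace 𝓘(ℝ, E) y),
      dirDeriv E (fun y => χ y * b.coord i (ψ y)) y v =
        b.coord i (mfderiv 𝓘(ℝ, E) 𝓘(ℝ, E) ψ y v) := by
    intro y hy i v
    have hev : (fun y => χ y * b.coord i (ψ y)) =ᶠ[𝓝 y]
        ((b.coord i).toContinuousLinearMap ∘ ψ) := by
      filter_upwards [hU.mem_nhds hy] with z hz
      rw [hχ1 z hz, one_mul]; rfl
    rw [dirDeriv, hev.mfderiv_eq]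
    have h2 := mfderiv_comp y ((b.coord i).toContinuousLinearMap.mdifferentiableAt)
      ((chart_mdifferentiable hψ).mdifferentiableAt (hsrc y hy))
    rw [h2, ContinuousLinearMap.mfderiv_eq]
    rfl
  refine ⟨fun i y => χ y * b.coord i (ψ y), fun i y => χ y •
    ((mfderiv 𝓘(ℝ, E) 𝓘(ℝ, E) ψ y).inverse (b i) : TangentSpace 𝓘(ℝ, E) y), U,
    ⟨hU, fun i => isSmoothFn_bump_mul ψ.open_source hχ hs (hcoord i),
      fun i => isSmoothVF_bump_chart hψ hχ hs (b i), ?_, ?_⟩, hxU, ?_⟩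
  · intro y hy i j
    let L := (chart_mdifferentiable hψ).mfderiv (hsrc y hy)
    have hL : mfderiv 𝓘(ℝ, E) 𝓘(ℝ, E) ψ y = L := rfl
    rw [hd y hy, hχ1 y hy, one_smul, hL, ContinuousLinearMap.inverse_equiv]
    have := L.apply_symm_apply (b j)
    rw [ContinuousLinearEquiv.coe_coe]
    refine (congrArg (b.coord i) this).trans ?_
    rw [Module.Basis.coord_apply, Module.Basis.repr_self, Finsupp.single_apply]
    simp only [eq_comm]
  · intro y hy v
    let L := (chart_mdifferentiable hψ).mfderiv (hsrc y hy)
    have hL : mfderiv 𝓘(ℝ, E) 𝓘(ℝ, E) ψ y = L := rfl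
    simp only [hd y hy, hχ1 y hy, one_smul, hL, ContinuousLinearMap.inverse_equiv]
    apply L.injective
    rw [map_sum]
    simp only [map_smul]
    have h2 : ∀ i, L ((L.symm : TangentSpace 𝓘(ℝ, E) (ψ y) →L[ℝ] TangentSpace 𝓘(ℝ, E) y) (b i)) = b i :=
      fun i => L.apply_symm_apply (b i)
    simp only [h2]
    exact (b.sum_repr (L v)).symm
  · intro i y hy
    show χ y * _ = _
    rw [hχ1 y hy, one_mul]

theorem exists_coordFrame_at [T2Space M] (x : M) :
    ∃ (h : Fin (Module.finrank ℝ E) → M → ℝ) (W : Fin (Module.finrank ℝ E) → VField E M)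
      (U : Set M), IsCoordFrame h W U ∧ x ∈ U := by
  obtain ⟨h, W, U, hF, hx, -⟩ := exists_coordFrame (Module.finBasis ℝ E)
    (IsManifold.chart_mem_maximalAtlas (I := 𝓘(ℝ, E)) (n := ∞) x) (mem_chart_source E x)
  exact ⟨h, W, U, hF, hx⟩

variable {ι : Type*} [Fintype ι] [DecidableEq ι] {h : ι → M → ℝ} {W : ι → VField E M} {U : Set M}

theorem IsCoordFrame.expand_form (hF : IsCoordFrame h W U) {y : M} (hy : y ∈ U)
    (η : AltForm E 1 y) : η = ∑ i, pairing y η (W i y) • dFun E (h i) y := by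
  refine altForm_one_ext fun v => ?_
  conv_lhs => rw [hF.expand y hy v]
  rw [map_sum, map_sum, LinearMap.sum_apply]
  refine Finset.sum_congr rfl fun i _ => ?_
  rw [map_smul, map_smul, LinearMap.smul_apply, pairing_dFun, smul_eq_mul, smul_eq_mul, mul_comm]

theorem isSmoothForm_sum {κ : Type*} (s : Finset κ) {k : ℕ} {θ : κ → DForm E M k}
    (hθ : ∀ i, IsSmoothForm (θ i)) : IsSmoothForm (fun x => ∑ i ∈ s, θ i x) := by
  classical
  induction s using Finset.induction_on with
  | empty =>
    simp only [Finset.sum_empty]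
    exact isSmoothAlong_zero (E' := E) (fun x : M => x) k
  | insert a s ha ih =>
    simp only [Finset.sum_insert ha]
    exact IsSmoothAlong.add (hθ a) ih

/-- To prove a property of the germ at `x` of smooth `1`-forms, it suffices to consider exact
forms, sums, and products with functions. -/
theorem oneForm_induction [T2Space M] (x : M) {Q : DForm E M 1 → Prop}
    (exact : ∀ g, IsSmoothFn E g → Q (dFun E g))
    (add : ∀ a b, IsSmoothForm a → IsSmoothForm b → Q a → Q b → Q (a + b))
    (smul : ∀ (g : M → ℝ) a, IsSmoothFn E g → IsSmoothForm a → Q a → Q (fun y => g y • a y))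
    (congr : ∀ a b, IsSmoothForm a → IsSmoothForm b → (∀ᶠ y in 𝓝 x, a y = b y) → Q a → Q b)
    (a : DForm E M 1) (ha : IsSmoothForm a) : Q a := by
  classical
  obtain ⟨h, W, U, hF, hx⟩ := exists_coordFrame_at (E := E) x
  have hc : ∀ i, IsSmoothFn E (fun y => pairing y (a y) (W i y)) :=
    fun i => isSmoothFn_pairing ha (hF.smooth_vf i)
  have hterm : ∀ i, IsSmoothForm (fun y => pairing y (a y) (W i y) • dFun E (h i) y) :=
    fun i => IsSmoothAlong.smul (hc i) (isSmoothForm_dFun (hF.smooth_fn i))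
  have hsum : ∀ s : Finset (Fin (Module.finrank ℝ E)),
      Q (fun y => ∑ i ∈ s, pairing y (a y) (W i y) • dFun E (h i) y) := by
    intro s
    induction s using Finset.induction_on with
    | empty =>
      -- None of the hypotheses gives `Q 0` directly; the zero form is written as `0 • d0`.
      have h0 : Q (fun y => (fun _ : M => (0 : ℝ)) y • dFun E (fun _ : M => (0 : ℝ)) y) :=
        smul (fun _ => 0) _ contMDiff_const (isSmoothForm_dFun contMDiff_const)
          (exact _ contMDiff_const)
      simpa using h0
    | insert i s hi ih =>
      simp only [Finset.sum_insert hi]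
      exact add _ _ (hterm i) (isSmoothForm_sum s hterm)
        (smul _ _ (hc i) (isSmoothForm_dFun (hF.smooth_fn i)) (exact _ (hF.smooth_fn i))) ih
  refine congr _ _ (isSmoothForm_sum Finset.univ hterm) ha ?_ (hsum Finset.univ)
  filter_upwards [hF.isOpen.mem_nhds hx] with y hy
  exact (hF.expand_form hy (a y)).symm

/-- The cut-off coordinates are globally smooth, and their derivatives at `x` determine a tangent
vector. -/
theorem tangent_ext [T2Space M] {x : M} {v w : TangentSpace 𝓘(ℝ, E) x}
    (hvw : ∀ g, IsSmoothFn E g → dirDeriv E g x v = dirDeriv E g x w) : v = w := by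
  obtain ⟨h, W, U, hF, hx⟩ := exists_coordFrame_at (E := E) x
  rw [hF.expand x hx v, hF.expand x hx w]
  exact Finset.sum_congr rfl fun i _ => by rw [hvw _ (hF.smooth_fn i)]

/-- A vector field is smooth if it maps smooth functions to smooth functions. -/
theorem isSmoothVF_of_dirDeriv [T2Space M] {V : VField E M}
    (hV : ∀ g, IsSmoothFn E g → IsSmoothFn E (fun x => dirDeriv E g x (V x))) :
    IsSmoothVF V := by
  refine isSmoothVF_of_eventuallyEq fun x => ?_
  obtain ⟨h, W, U, hF, hx⟩ := exists_coordFrame_at (E := E) x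
  refine ⟨_, isSmoothVF_sum Finset.univ fun i => (hF.smooth_vf i).smul (hV _ (hF.smooth_fn i)), ?_⟩
  filter_upwards [hF.isOpen.mem_nhds hx] with y hy
  exact hF.expand y hy (V y)

/-- The Lie bracket is the commutator of derivations. -/
theorem dirDeriv_mlieBracket {V W : VField E M} (hV : IsSmoothVF V) (hW : IsSmoothVF W)
    {g : M → ℝ} (hg : IsSmoothFn E g) (x : M) :
    dirDeriv E g x (VectorField.mlieBracket 𝓘(ℝ, E) V W x) =
      dirDeriv E (fun y => dirDeriv E g y (W y)) x (V x)
        - dirDeriv E (fun y => dirDeriv E g y (V y)) x (W x) := by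
  set φ := extChartAt 𝓘(ℝ, E) x with hφ
  have hnhds : φ.target ∈ 𝓝 (φ x) := extChartAt_target_mem_nhds (I := 𝓘(ℝ, E)) x
  have hinv : φ.symm (φ x) = x := extChartAt_to_inv x
  have hsymm : ∀ y ∈ φ.target, φ.symm y ∈ (chartAt E x).source := fun y hy => by
    have := φ.map_target hy
    rwa [hφ, extChartAt_source] at this
  have hsmooth : ∀ {V : VField E M}, IsSmoothVF V →
      ContDiffAt ℝ ∞ (fun y => chartDeriv x (φ.symm y) (V (φ.symm y))) (φ x) := by
    intro V hV
    rw [← contMDiffAt_iff_contDiffAt]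
    have h1 : ContMDiffAt 𝓘(ℝ, E) 𝓘(ℝ, E) ∞ (fun y => chartDeriv x y (V y)) (φ.symm (φ x)) := by
      rw [hinv]; exact isSmoothVF_iff.1 hV x
    exact h1.comp (φ x) (contMDiffAt_extChartAt_symm' (mem_extChartAt_target x))
  have hgs : ContDiffAt ℝ ∞ (g ∘ φ.symm) (φ x) := by
    rw [← contMDiffAt_iff_contDiffAt]
    exact (hg _).comp _ (contMDiffAt_extChartAt_symm' (mem_extChartAt_target x))
  have hderiv : ∀ {V : VField E M}, (fun y => dirDeriv E g y (V y)) ∘ φ.symm =ᶠ[𝓝 (φ x)]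
      fun y => fderiv ℝ (g ∘ φ.symm) y (chartDeriv x (φ.symm y) (V (φ.symm y))) := by
    intro V
    filter_upwards [hnhds] with y hy
    simp only [Function.comp_apply]
    rw [dirDeriv_eq_fderiv (hg.mdifferentiableAt _) (hsymm y hy), ← hφ, φ.right_inv hy]
  let pb : VField E M → E → E := fun V =>
    VectorField.mpullbackWithin 𝓘(ℝ, E) 𝓘(ℝ, E) φ.symm V (Set.range 𝓘(ℝ, E))
  have hpull : ∀ {V : VField E M},
      -- The pullback by `φ.symm` in the definition of `mlieBracket` is, near `φ x`, the expression
      -- of the vector field in coordinates.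
      pb V =ᶠ[𝓝 (φ x)] fun y => chartDeriv x (φ.symm y) (V (φ.symm y)) := by
    intro V
    filter_upwards [hnhds] with y hy
    show (mfderivWithin 𝓘(ℝ, E) 𝓘(ℝ, E) φ.symm (Set.range 𝓘(ℝ, E)) y).inverse (V (φ.symm y)) = _
    refine (isInvertible_mfderivWithin_extChartAt_symm hy).inverse_apply_eq.2 ?_
    rw [modelWithCornersSelf_coe, Set.range_id, mfderivWithin_univ, ← coordFrame_eq_mfderiv hy]
    exact (coordFrame_chartDeriv (hsymm y hy) _).symm
  have hval : ∀ V : VField E M, chartDeriv x (φ.symm (φ x)) (V (φ.symm (φ x))) = V x := by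
    intro V
    rw [hinv, chartDeriv_self]
  have hbr : VectorField.mlieBracket 𝓘(ℝ, E) V W x =
      VectorField.lieBracket ℝ (fun y => chartDeriv x (φ.symm y) (V (φ.symm y)))
        (fun y => chartDeriv x (φ.symm y) (W (φ.symm y))) (φ x) := by
    rw [VectorField.mlieBracket, VectorField.mlieBracketWithin_apply]
    refine (isInvertible_mfderiv_extChartAt (mem_extChartAt_source x)).inverse_apply_eq.2 ?_
    refine Eq.trans ?_ (chartDeriv_self (E := E) x _).symm
    have hset : φ.symm ⁻¹' Set.univ ∩ Set.range 𝓘(ℝ, E) = Set.univ := by simp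
    show VectorField.lieBracketWithin ℝ (pb V) (pb W) (φ.symm ⁻¹' Set.univ ∩ Set.range 𝓘(ℝ, E))
      (φ x) = _
    rw [hset, VectorField.lieBracketWithin_univ]
    exact Filter.EventuallyEq.lieBracket_vectorField_eq hpull hpull
  -- An iterated derivative splits into a Hessian term of `g` and a term that differentiates the
  -- vector field.
  have hG : ∀ {V : VField E M}, IsSmoothVF V → ∀ v : TangentSpace 𝓘(ℝ, E) x,
      dirDeriv E (fun y => dirDeriv E g y (V y)) x v =
        fderiv ℝ (fderiv ℝ (g ∘ φ.symm)) (φ x) v (V x) + fderiv ℝ (g ∘ φ.symm) (φ x)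
          (fderiv ℝ (fun y => chartDeriv x (φ.symm y) (V (φ.symm y))) (φ x) v) := by
    intro V hV v
    rw [dirDeriv_eq_fderiv ((isSmoothFn_dirDeriv hg hV).mdifferentiableAt x)
      (mem_chart_source E x), hderiv.fderiv_eq, chartDeriv_self, fderiv_clm_apply
        ((hgs.fderiv_right (m := ∞) (by simp)).differentiableAt (by simp))
        ((hsmooth hV).differentiableAt (by simp))]
    rw [hval, add_comm]
    rfl
  -- The Hessian terms cancel in the commutator by symmetry, which leaves the bracket of the
  -- coordinate expressions.
  have hsym := hgs.isSymmSndFDerivAt (by simpa using two_le_infty) (V x) (W x)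
  rw [hG hV, hG hW, dirDeriv_eq_fderiv (hg.mdifferentiableAt x) (mem_chart_source E x),
    chartDeriv_self, hbr, VectorField.lieBracket_eq, map_sub]
  simp only [hval]
  rw [hsym]
  simp only [← hφ]
  ring

end Frames


/-! ### The bracket of 1-forms: Leibniz rule, anchor identity, Jacobi identity -/

section PoissonBracket

variable {E : Type u} [NormedAddCommGroup E] [NormedSpace ℝ E] [FiniteDimensional ℝ E]
  {M : Type v} [TopologicalSpace M] [ChartedSpace E M] [IsManifold 𝓘(ℝ, E) ∞ M]

theorem two_form_apply {x : M} (η : AltForm E 2 x) (v w : TangentSpace 𝓘(ℝ, E) x) :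
    η ![v, w] = pairing x (flat η v) w := by
  show η ![v, w] = η (Fin.cons v fun _ => w)
  congr 1
  ext i
  fin_cases i <;> rfl

theorem isSmoothForm_add {k : ℕ} {α β : DForm E M k} (hα : IsSmoothForm α)
    (hβ : IsSmoothForm β) : IsSmoothForm (α + β) := IsSmoothAlong.add hα hβ

/-- Polarization of `skew`. -/
theorem Bivector.skew' (P : Bivector E M) (x : M) (α β : AltForm E 1 x) :
    pairing x α (P.sharp x β) = - pairing x β (P.sharp x α) := by
  have h := P.skew x (α + β)
  simp only [map_add, LinearMap.add_apply, P.skew, zero_add, add_zero] at h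
  linarith

theorem Bivector.isSmoothVF (P : Bivector E M) {α : DForm E M 1} (hα : IsSmoothForm α) :
    IsSmoothVF (P.vf α) := P.smooth α hα

/-- The bracket of `1`-forms defined by a bivector. -/
def Bivector.formBracket (P : Bivector E M) (α β : DForm E M 1) : DForm E M 1 :=
  lieDeriv (P.vf α) β - interior (P.vf β) (dForm α)

/-- The working formula for the bracket: `ι_{Pα} β` is a function, so its exterior derivative is a
directional derivative. -/
theorem Bivector.pairing_formBracket (P : Bivector E M) {α β : DForm E M 1} (hα : IsSmoothForm α)
    (hβ : IsSmoothForm β) (x : M) (w : TangentSpace 𝓘(ℝ, E) x) :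
    pairing x (P.formBracket α β x) w =
      dirDeriv E (fun y => pairing y (β y) (P.vf α y)) x w
        + pairing x (flat (dForm β x) (P.vf α x)) w - pairing x (flat (dForm α x) (P.vf β x)) w := by
  rw [formBracket, lieDeriv, dForm_interior (P.isSmoothVF hα) hβ]
  rfl

theorem Bivector.isSmoothForm_formBracket (P : Bivector E M) {α β : DForm E M 1}
    (hα : IsSmoothForm α) (hβ : IsSmoothForm β) : IsSmoothForm (P.formBracket α β) :=
  IsSmoothAlong.sub (IsSmoothAlong.add
    (isSmoothForm_dForm (isSmoothForm_interior (P.isSmoothVF hα) hβ))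
    (isSmoothForm_interior (P.isSmoothVF hα) (isSmoothForm_dForm hβ)))
    (isSmoothForm_interior (P.isSmoothVF hβ) (isSmoothForm_dForm hα))

theorem Bivector.formBracket_skew (P : Bivector E M) {α β : DForm E M 1} (hα : IsSmoothForm α)
    (hβ : IsSmoothForm β) : P.formBracket α β = - P.formBracket β α := by
  funext x
  refine altForm_one_ext fun w => ?_
  rw [Pi.neg_apply, map_neg, LinearMap.neg_apply, P.pairing_formBracket hα hβ,
    P.pairing_formBracket hβ hα]
  have h : (fun y => pairing y (β y) (P.vf α y)) = fun y => - pairing y (α y) (P.vf β y) :=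
    funext fun y => P.skew' y _ _
  rw [h, dirDeriv_neg]
  ring

theorem Bivector.formBracket_add (P : Bivector E M) {α β γ : DForm E M 1} (hα : IsSmoothForm α)
    (hβ : IsSmoothForm β) (hγ : IsSmoothForm γ) :
    P.formBracket α (β + γ) = P.formBracket α β + P.formBracket α γ := by
  funext x
  refine altForm_one_ext fun w => ?_
  rw [Pi.add_apply, map_add, LinearMap.add_apply, P.pairing_formBracket hα (isSmoothForm_add hβ hγ),
    P.pairing_formBracket hα hβ, P.pairing_formBracket hα hγ, dForm_add hβ hγ]
  have h1 : (fun y => pairing y ((β + γ) y) (P.vf α y)) =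
    fun y => pairing y (β y) (P.vf α y) + pairing y (γ y) (P.vf α y) := rfl
  have h2 : P.vf (β + γ) x = P.vf β x + P.vf γ x := map_add _ _ _
  have h3 : pairing x (flat ((dForm β + dForm γ) x) (P.vf α x)) w =
    pairing x (flat (dForm β x) (P.vf α x)) w + pairing x (flat (dForm γ x) (P.vf α x)) w := rfl
  rw [h1, dirDeriv_add (isSmoothFn_pairing hβ (P.isSmoothVF hα))
    (isSmoothFn_pairing hγ (P.isSmoothVF hα)), h2, h3, map_add, map_add, LinearMap.add_apply]
  ring

/-- Differentiating `g β(Pα)` produces `dg(w) β(Pα)`, which cancels against half of `(dg ∧ β)(Pα,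
w)`; the other half is the anchor term. -/
theorem Bivector.formBracket_smul (P : Bivector E M) {g : M → ℝ} (hg : IsSmoothFn E g)
    {α β : DForm E M 1} (hα : IsSmoothForm α) (hβ : IsSmoothForm β) :
    P.formBracket α (fun y => g y • β y) = fun x => g x • P.formBracket α β x +
      dirDeriv E g x (P.vf α x) • β x := by
  funext x
  refine altForm_one_ext fun w => ?_
  rw [map_add, map_smul, map_smul, LinearMap.add_apply, LinearMap.smul_apply,
    LinearMap.smul_apply, P.pairing_formBracket hα (IsSmoothAlong.smul hg hβ),
    P.pairing_formBracket hα hβ, ← two_form_apply, dForm_smul hg hβ, wedgeVal, two_form_apply]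
  have h1 : (fun y => pairing y (g y • β y) (P.vf α y)) =
    fun y => g y * pairing y (β y) (P.vf α y) := funext fun y => by
      rw [map_smul, LinearMap.smul_apply, smul_eq_mul]
  have h2 : P.vf (fun y => g y • β y) x = g x • P.vf β x := map_smul _ _ _
  rw [h1, dirDeriv_mul hg (isSmoothFn_pairing hβ (P.isSmoothVF hα)), h2, map_smul, map_smul,
    LinearMap.smul_apply]
  simp only [smul_eq_mul]
  ring

theorem Bivector.formBracket_add_left (P : Bivector E M) {α β γ : DForm E M 1}
    (hα : IsSmoothForm α) (hβ : IsSmoothForm β) (hγ : IsSmoothForm γ) :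
    P.formBracket (α + β) γ = P.formBracket α γ + P.formBracket β γ := by
  rw [P.formBracket_skew (isSmoothForm_add hα hβ) hγ, P.formBracket_add hγ hα hβ,
    P.formBracket_skew hα hγ, P.formBracket_skew hβ hγ, neg_add]

theorem Bivector.formBracket_smul_left (P : Bivector E M) {g : M → ℝ} (hg : IsSmoothFn E g)
    {α β : DForm E M 1} (hα : IsSmoothForm α) (hβ : IsSmoothForm β) :
    P.formBracket (fun y => g y • α y) β = fun x => g x • P.formBracket α β x -
      dirDeriv E g x (P.vf β x) • α x := by
  rw [P.formBracket_skew (IsSmoothAlong.smul hg hα) hβ, P.formBracket_smul hg hβ hα,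
    P.formBracket_skew hα hβ]
  funext x
  simp only [Pi.neg_apply, smul_neg]
  abel

theorem Bivector.formBracket_congr (P : Bivector E M) {α α' β β' : DForm E M 1} {x : M}
    (hα : ∀ᶠ y in 𝓝 x, α y = α' y) (hβ : ∀ᶠ y in 𝓝 x, β y = β' y) :
    P.formBracket α β x = P.formBracket α' β' x := by
  have h1 : ∀ᶠ y in 𝓝 x, interior (P.vf α) β y = interior (P.vf α') β' y := by
    filter_upwards [hα, hβ] with y h1 h2
    simp only [interior, Bivector.vf, h1, h2]
  simp only [formBracket, lieDeriv, Pi.sub_apply, Pi.add_apply, dForm_congr h1, interior,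
    dForm_congr hα, dForm_congr hβ, Bivector.vf, hα.self_of_nhds, hβ.self_of_nhds]

theorem Bivector.formBracket_congr_eventually (P : Bivector E M) {α α' β β' : DForm E M 1} {x : M}
    (hα : ∀ᶠ y in 𝓝 x, α y = α' y) (hβ : ∀ᶠ y in 𝓝 x, β y = β' y) :
    ∀ᶠ y in 𝓝 x, P.formBracket α β y = P.formBracket α' β' y := by
  filter_upwards [hα.eventually_nhds, hβ.eventually_nhds] with y h1 h2
  exact P.formBracket_congr h1 h2

theorem Bivector.isSmoothFn_fnBracket (P : Bivector E M) {g h : M → ℝ} (hg : IsSmoothFn E g)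
    (hh : IsSmoothFn E h) : IsSmoothFn E (P.fnBracket g h) :=
  isSmoothFn_dirDeriv hh (P.isSmoothVF (isSmoothForm_dFun hg))

theorem Bivector.fnBracket_skew (P : Bivector E M) (g h : M → ℝ) :
    P.fnBracket g h = - P.fnBracket h g :=
  funext fun x => P.skew' x (dFun E h x) (dFun E g x)

/-- Two terms of the bracket vanish by `d² = 0`, and the third is the differential of `dh(P dg) =
{g, h}`. -/
theorem Bivector.formBracket_dFun (P : Bivector E M) {g h : M → ℝ} (hg : IsSmoothFn E g)
    (hh : IsSmoothFn E h) :
    P.formBracket (dFun E g) (dFun E h) = dFun E (P.fnBracket g h) := by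
  funext x
  refine altForm_one_ext fun w => ?_
  have hflat : ∀ v : TangentSpace 𝓘(ℝ, E) x,
      pairing x (flat ((0 : DForm E M 2) x) v) w = 0 := fun _ => rfl
  rw [P.pairing_formBracket (isSmoothForm_dFun hg) (isSmoothForm_dFun hh), dForm_dFun hg,
    dForm_dFun hh, hflat, hflat, add_zero, sub_zero]
  rfl

/-- `P` maps the bracket of `1`-forms to the commutator of derivations. -/
def Bivector.AnchorAt (P : Bivector E M) (x : M) (α β : DForm E M 1) : Prop :=
  ∀ g, IsSmoothFn E g → dirDeriv E g x (P.vf (P.formBracket α β) x) =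
    dirDeriv E (fun y => dirDeriv E g y (P.vf β y)) x (P.vf α x)
      - dirDeriv E (fun y => dirDeriv E g y (P.vf α y)) x (P.vf β x)

theorem Bivector.AnchorAt.symm {P : Bivector E M} {x : M} {α β : DForm E M 1}
    (hα : IsSmoothForm α) (hβ : IsSmoothForm β) (h : P.AnchorAt x α β) : P.AnchorAt x β α := by
  intro g hg
  have h1 : P.vf (P.formBracket β α) x = - P.vf (P.formBracket α β) x := by
    rw [P.formBracket_skew hβ hα]
    exact map_neg _ _
  have hneg : ∀ v : TangentSpace 𝓘(ℝ, E) x, dirDeriv E g x (-v) = - dirDeriv E g x v :=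
    fun v => map_neg _ _
  rw [h1, hneg, h g hg]
  ring

theorem Bivector.AnchorAt.add {P : Bivector E M} {x : M} {α β γ : DForm E M 1}
    (hα : IsSmoothForm α) (hβ : IsSmoothForm β) (hγ : IsSmoothForm γ) (h : P.AnchorAt x α γ)
    (h' : P.AnchorAt x β γ) : P.AnchorAt x (α + β) γ := by
  intro g hg
  have h1 : P.vf (P.formBracket (α + β) γ) x =
      P.vf (P.formBracket α γ) x + P.vf (P.formBracket β γ) x := by
    rw [P.formBracket_add_left hα hβ hγ]
    exact map_add _ _ _
  have hvf : ∀ y, P.vf (α + β) y = P.vf α y + P.vf β y := fun y => map_add _ _ _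
  have hlin : ∀ (g : M → ℝ) (y : M) (v w : TangentSpace 𝓘(ℝ, E) y),
    dirDeriv E g y (v + w) = dirDeriv E g y v + dirDeriv E g y w := fun g y v w => map_add _ _ _
  simp only [h1, hvf, hlin, h g hg, h' g hg]
  rw [dirDeriv_add (isSmoothFn_dirDeriv hg (P.isSmoothVF hα))
    (isSmoothFn_dirDeriv hg (P.isSmoothVF hβ))]
  ring

/-- Both sides acquire the same extra term `-(Pβ)(k) (Pα)(g)`, so the defect is linear over
functions in `α`. -/
theorem Bivector.AnchorAt.smul {P : Bivector E M} {x : M} {α β : DForm E M 1} {k : M → ℝ}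
    (hk : IsSmoothFn E k) (hα : IsSmoothForm α) (hβ : IsSmoothForm β)
    (h : P.AnchorAt x α β) : P.AnchorAt x (fun y => k y • α y) β := by
  intro g hg
  have h1 : P.vf (P.formBracket (fun y => k y • α y) β) x =
      k x • P.vf (P.formBracket α β) x - dirDeriv E k x (P.vf β x) • P.vf α x := by
    rw [P.formBracket_smul_left hk hα hβ]
    refine (map_sub _ _ _).trans ?_
    rw [map_smul, map_smul]
    rfl
  have hvf : ∀ y, P.vf (fun y => k y • α y) y = k y • P.vf α y := fun y => map_smul _ _ _
  have hsub : ∀ (v w : TangentSpace 𝓘(ℝ, E) x),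
    dirDeriv E g x (v - w) = dirDeriv E g x v - dirDeriv E g x w := fun v w => map_sub _ _ _
  have hsm : ∀ (g : M → ℝ) (y : M) (c : ℝ) (v : TangentSpace 𝓘(ℝ, E) y),
    dirDeriv E g y (c • v) = c * dirDeriv E g y v := fun g y c v => map_smul _ _ _
  simp only [h1, hvf, hsub, hsm, h g hg]
  rw [dirDeriv_mul hk (isSmoothFn_dirDeriv hg (P.isSmoothVF hα))]
  ring

theorem Bivector.AnchorAt.congr {P : Bivector E M} {x : M} {α α' β : DForm E M 1}
    (hev : ∀ᶠ y in 𝓝 x, α y = α' y) (h : P.AnchorAt x α β) : P.AnchorAt x α' β := by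
  intro g hg
  have h1 : P.vf (P.formBracket α' β) x = P.vf (P.formBracket α β) x := by
    simp only [Bivector.vf, P.formBracket_congr hev (Filter.Eventually.of_forall fun y => rfl :
      ∀ᶠ y in 𝓝 x, β y = β y)]
  have h2 : P.vf α' x = P.vf α x := by simp only [Bivector.vf, hev.self_of_nhds]
  rw [h1, h2, h g hg]
  congr 1
  refine dirDeriv_congr ?_ _
  filter_upwards [hev] with y hy
  simp only [Bivector.vf, hy]

/-- Additivity, function-linearity and locality reduce each argument to exact forms, the second one
by way of symmetry. For `dg` and `dh` tested on `k` the statement is the Jacobi identity for `g, h,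
k`. -/
theorem Bivector.anchorAt [T2Space M] {P : Bivector E M} (hP : P.IsPoisson) (x : M)
    {α β : DForm E M 1} (hα : IsSmoothForm α) (hβ : IsSmoothForm β) : P.AnchorAt x α β := by
  have hexact : ∀ g h, IsSmoothFn E g → IsSmoothFn E h →
      P.AnchorAt x (dFun E g) (dFun E h) := by
    intro g h hg hh k hk
    rw [P.formBracket_dFun hg hh]
    have hJ := congrFun (hP g h k hg hh hk) x
    simp only [Pi.add_apply, Pi.zero_apply] at hJ
    have e1 : dirDeriv E k x (P.vf (dFun E (P.fnBracket g h)) x) =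
      P.fnBracket (P.fnBracket g h) k x := rfl
    have e2 : dirDeriv E (fun y => dirDeriv E k y (P.vf (dFun E h) y)) x (P.vf (dFun E g) x) =
      P.fnBracket g (P.fnBracket h k) x := rfl
    have e3 : dirDeriv E (fun y => dirDeriv E k y (P.vf (dFun E g) y)) x (P.vf (dFun E h) x) =
      P.fnBracket h (P.fnBracket g k) x := rfl
    have e4 : P.fnBracket h (P.fnBracket k g) x = - P.fnBracket h (P.fnBracket g k) x := by
      rw [P.fnBracket_skew k g]
      exact dirDeriv_neg _ _ _
    rw [e1, e2, e3, P.fnBracket_skew]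
    rw [e4] at hJ
    simp only [Pi.neg_apply]
    linarith
  have hleft : ∀ a, IsSmoothForm a → ∀ h, IsSmoothFn E h → P.AnchorAt x a (dFun E h) := by
    intro a ha h hh
    exact oneForm_induction x (Q := fun a => P.AnchorAt x a (dFun E h))
      (fun g hg => hexact g h hg hh)
      (fun a b ha hb => Bivector.AnchorAt.add ha hb (isSmoothForm_dFun hh))
      (fun g a hg ha => Bivector.AnchorAt.smul hg ha (isSmoothForm_dFun hh))
      (fun a b _ _ hev => Bivector.AnchorAt.congr hev) a ha
  refine Bivector.AnchorAt.symm hβ hα ?_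
  exact oneForm_induction x (Q := fun b => P.AnchorAt x b α)
    (fun g hg => (hleft α hα g hg).symm hα (isSmoothForm_dFun hg))
    (fun a b ha hb => Bivector.AnchorAt.add ha hb hα)
    (fun g a hg ha => Bivector.AnchorAt.smul hg ha hα)
    (fun a b _ _ hev => Bivector.AnchorAt.congr hev) β hβ

theorem Bivector.formBracket_neg (P : Bivector E M) {α β : DForm E M 1} (hα : IsSmoothForm α)
    (hβ : IsSmoothForm β) : P.formBracket α (-β) = - P.formBracket α β := by
  have h := P.formBracket_smul (g := fun _ => -1) contMDiff_const hα hβ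
  have h1 : (fun y => (-1 : ℝ) • β y) = -β := funext fun y => neg_one_smul ℝ (β y)
  rw [h1] at h
  rw [h]
  funext x
  rw [dirDeriv_const, zero_smul, add_zero]
  exact neg_one_smul ℝ (P.formBracket α β x)

/-- The Jacobiator of the bracket of `1`-forms. -/
def Bivector.jacobiator (P : Bivector E M) (a b c : DForm E M 1) : DForm E M 1 :=
  P.formBracket a (P.formBracket b c) + P.formBracket b (P.formBracket c a)
    + P.formBracket c (P.formBracket a b)

theorem Bivector.jacobiator_cycle (P : Bivector E M) (a b c : DForm E M 1) :
    P.jacobiator b c a = P.jacobiator a b c := by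
  simp only [jacobiator]
  abel

/-- In this form `c` always sits in the second slot of a bracket, where the Leibniz rule applies
directly. -/
theorem Bivector.jacobiator_eq (P : Bivector E M) {a b c : DForm E M 1} (ha : IsSmoothForm a)
    (hb : IsSmoothForm b) (hc : IsSmoothForm c) :
    P.jacobiator a b c = P.formBracket a (P.formBracket b c) - P.formBracket b (P.formBracket a c)
      - P.formBracket (P.formBracket a b) c := by
  rw [jacobiator, P.formBracket_skew hc ha, P.formBracket_neg hb (P.isSmoothForm_formBracket ha hc),
    P.formBracket_skew hc (P.isSmoothForm_formBracket ha hb)]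
  abel

theorem Bivector.jacobiator_add (P : Bivector E M) {a b c d : DForm E M 1} (ha : IsSmoothForm a)
    (hb : IsSmoothForm b) (hc : IsSmoothForm c) (hd : IsSmoothForm d) :
    P.jacobiator a b (c + d) = P.jacobiator a b c + P.jacobiator a b d := by
  rw [P.jacobiator_eq ha hb (isSmoothForm_add hc hd), P.jacobiator_eq ha hb hc,
    P.jacobiator_eq ha hb hd, P.formBracket_add hb hc hd, P.formBracket_add ha hc hd,
    P.formBracket_add (P.isSmoothForm_formBracket ha hb) hc hd,
    P.formBracket_add ha (P.isSmoothForm_formBracket hb hc) (P.isSmoothForm_formBracket hb hd),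
    P.formBracket_add hb (P.isSmoothForm_formBracket ha hc) (P.isSmoothForm_formBracket ha hd)]
  abel

/-- The terms with one derivative of `g` along `Pa` or `Pb` cancel. What remains is `c` times `[Pa,
Pb] g - P[a, b] g`, which is zero by the anchor identity. -/
theorem Bivector.jacobiator_smul [T2Space M] {P : Bivector E M} (hP : P.IsPoisson) {g : M → ℝ}
    (hg : IsSmoothFn E g) {a b c : DForm E M 1} (ha : IsSmoothForm a)
    (hb : IsSmoothForm b) (hc : IsSmoothForm c) (x : M) :
    P.jacobiator a b (fun y => g y • c y) x = g x • P.jacobiator a b c x := by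
  have hgc : IsSmoothForm (fun y => g y • c y) := IsSmoothAlong.smul hg hc
  have key : ∀ {a b : DForm E M 1}, IsSmoothForm a → IsSmoothForm b →
      P.formBracket a (P.formBracket b (fun y => g y • c y)) x =
        g x • P.formBracket a (P.formBracket b c) x
          + dirDeriv E g x (P.vf a x) • P.formBracket b c x
          + (dirDeriv E g x (P.vf b x) • P.formBracket a c x
          + dirDeriv E (fun y => dirDeriv E g y (P.vf b y)) x (P.vf a x) • c x) := by
    intro a b ha hb
    have hbg : IsSmoothFn E (fun y => dirDeriv E g y (P.vf b y)) :=
      isSmoothFn_dirDeriv hg (P.isSmoothVF hb)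
    have hsplit : P.formBracket b (fun y => g y • c y) =
      (fun y => g y • P.formBracket b c y) + (fun y => dirDeriv E g y (P.vf b y) • c y) :=
      P.formBracket_smul hg hb hc
    rw [hsplit, P.formBracket_add ha (IsSmoothAlong.smul hg (P.isSmoothForm_formBracket hb hc))
      (IsSmoothAlong.smul hbg hc), P.formBracket_smul hg ha (P.isSmoothForm_formBracket hb hc),
      P.formBracket_smul hbg ha hc]
    rfl
  rw [P.jacobiator_eq ha hb hgc, P.jacobiator_eq ha hb hc]
  simp only [Pi.sub_apply]
  have h3 : P.formBracket (P.formBracket a b) (fun y => g y • c y) x =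
      g x • P.formBracket (P.formBracket a b) c x
        + dirDeriv E g x (P.vf (P.formBracket a b) x) • c x :=
    congrFun (P.formBracket_smul hg (P.isSmoothForm_formBracket ha hb) hc) x
  rw [Bivector.anchorAt hP x ha hb g hg] at h3
  rw [key ha hb, key hb ha, h3]
  module

theorem Bivector.jacobiator_congr (P : Bivector E M) {a b c d : DForm E M 1} {x : M}
    (hev : ∀ᶠ y in 𝓝 x, c y = d y) : P.jacobiator a b c x = P.jacobiator a b d x := by
  have hr : ∀ a : DForm E M 1, ∀ᶠ y in 𝓝 x, a y = a y :=
    fun a => Filter.Eventually.of_forall fun y => rfl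
  simp only [jacobiator, Pi.add_apply]
  rw [P.formBracket_congr (hr a) (P.formBracket_congr_eventually (hr b) hev),
    P.formBracket_congr (hr b) (P.formBracket_congr_eventually hev (hr a)),
    P.formBracket_congr hev (hr (P.formBracket a b))]

/-- Tensoriality is only known in the last argument; cyclic invariance brings each argument there in
turn. On exact forms the Jacobiator is `d` of the Jacobiator of functions. -/
theorem Bivector.jacobiator_eq_zero [T2Space M] {P : Bivector E M} (hP : P.IsPoisson)
    {a b c : DForm E M 1} (ha : IsSmoothForm a) (hb : IsSmoothForm b) (hc : IsSmoothForm c) :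
    P.jacobiator a b c = 0 := by
  funext x
  have ind : ∀ {a b : DForm E M 1}, IsSmoothForm a → IsSmoothForm b →
      (∀ g, IsSmoothFn E g → P.jacobiator a b (dFun E g) x = 0) →
      ∀ c, IsSmoothForm c → P.jacobiator a b c x = 0 := by
    intro a b ha hb hexact c hc
    refine oneForm_induction x (Q := fun c => P.jacobiator a b c x = 0) hexact ?_ ?_ ?_ c hc
    · intro c d hc hd h1 h2
      rw [P.jacobiator_add ha hb hc hd, Pi.add_apply, h1, h2, add_zero]
    · intro g c hg hc h1
      rw [Bivector.jacobiator_smul hP hg ha hb hc, h1, smul_zero]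
    · intro c d _ _ hev h1
      rw [← P.jacobiator_congr hev, h1]
  have hexact : ∀ f g h, IsSmoothFn E f → IsSmoothFn E g → IsSmoothFn E h →
      P.jacobiator (dFun E f) (dFun E g) (dFun E h) x = 0 := by
    intro f g h hf hg hh
    have hd : ∀ {f g : M → ℝ}, IsSmoothFn E f → IsSmoothFn E g →
        dFun E f + dFun E g = dFun E (f + g) := by
      intro f g hf hg
      funext x
      exact altForm_one_ext fun v => (dirDeriv_add hf hg x v).symm
    have h1 := P.isSmoothFn_fnBracket hf (P.isSmoothFn_fnBracket hg hh)
    have h2 := P.isSmoothFn_fnBracket hg (P.isSmoothFn_fnBracket hh hf)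
    have h3 := P.isSmoothFn_fnBracket hh (P.isSmoothFn_fnBracket hf hg)
    rw [jacobiator, P.formBracket_dFun hg hh, P.formBracket_dFun hh hf, P.formBracket_dFun hf hg,
      P.formBracket_dFun hf (P.isSmoothFn_fnBracket hg hh),
      P.formBracket_dFun hg (P.isSmoothFn_fnBracket hh hf),
      P.formBracket_dFun hh (P.isSmoothFn_fnBracket hf hg), hd h1 h2, hd (h1.add h2) h3,
      hP f g h hf hg hh]
    exact altForm_one_ext fun v => dirDeriv_const 0 x v
  have h1 : ∀ f g, IsSmoothFn E f → IsSmoothFn E g → ∀ c, IsSmoothForm c →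
      P.jacobiator (dFun E f) (dFun E g) c x = 0 := fun f g hf hg =>
    ind (isSmoothForm_dFun hf) (isSmoothForm_dFun hg) fun h hh => hexact f g h hf hg hh
  have h2 : ∀ f, IsSmoothFn E f → ∀ c, IsSmoothForm c → ∀ b, IsSmoothForm b →
      P.jacobiator c (dFun E f) b x = 0 := fun f hf c hc =>
    ind hc (isSmoothForm_dFun hf) fun g hg => by
      rw [← P.jacobiator_cycle]; exact h1 f g hf hg c hc
  refine ind ha hb (fun g hg => ?_) c hc
  rw [← P.jacobiator_cycle]
  exact h2 g hg b hb a ha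

end PoissonBracket


/-! ### Biduality for tangent spaces -/

section Duality

variable {E : Type u} [NormedAddCommGroup E] [NormedSpace ℝ E] [FiniteDimensional ℝ E]
  {M : Type v} [TopologicalSpace M] [ChartedSpace E M] [IsManifold 𝓘(ℝ, E) ∞ M]

/-- The covector at `x` defined by a linear functional. -/
def covectorOfDual (x : M) : Module.Dual ℝ (TangentSpace 𝓘(ℝ, E) x) →ₗ[ℝ] AltForm E 1 x where
  toFun φ := ContinuousAlternatingMap.ofSubsingleton ℝ E ℝ (0 : Fin 1)
    (LinearMap.toContinuousLinearMap (show E →ₗ[ℝ] ℝ from φ))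
  map_add' _ _ := rfl
  map_smul' _ _ := rfl

theorem tangent_ext_of_pairing {x : M} {v w : TangentSpace 𝓘(ℝ, E) x}
    (h : ∀ α : AltForm E 1 x, pairing x α v = pairing x α w) : v = w :=
  Module.eval_apply_injective ℝ (V := E) (LinearMap.ext fun φ : Module.Dual ℝ E =>
    h (covectorOfDual x φ))

/-- Linear functionals on a cotangent space are given by tangent vectors. -/
theorem exists_tangent_of_dual {x : M} (z : Module.Dual ℝ (AltForm E 1 x)) :
    ∃ v : TangentSpace 𝓘(ℝ, E) x, ∀ α, z α = pairing x α v := by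
  refine ⟨(Module.evalEquiv ℝ E).symm (z ∘ₗ covectorOfDual x), fun α => ?_⟩
  have h := DFunLike.congr_fun
    ((Module.evalEquiv ℝ E).apply_symm_apply (z ∘ₗ covectorOfDual x)) (pairing x α)
  refine Eq.trans ?_ h.symm
  exact congrArg z (altForm_one_ext fun v => rfl)

end Duality

/-! ### The Poisson algebroid and its 1-shifted symplectic structure -/

section PoissonAlgebroid

variable {E : Type u} [NormedAddCommGroup E] [NormedSpace ℝ E] [FiniteDimensional ℝ E]
  {M : Type v} [TopologicalSpace M] [T2Space M] [ChartedSpace E M] [IsManifold 𝓘(ℝ, E) ∞ M]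

theorem IsCoordFrame.linearIndependent {ι : Type*} [Fintype ι] [DecidableEq ι] {h : ι → M → ℝ}
    {W : ι → VField E M} {U : Set M} (hF : IsCoordFrame h W U) {y : M} (hy : y ∈ U) :
    LinearIndependent ℝ (fun i => dFun E (h i) y) := by
  rw [Fintype.linearIndependent_iff]
  intro c hc i
  have h1 := congrArg (fun η => pairing y η (W i y)) hc
  simp only [map_sum, map_smul, LinearMap.sum_apply, LinearMap.smul_apply, pairing_dFun,
    hF.dual y hy, smul_eq_mul, mul_ite, mul_one, mul_zero, Finset.sum_ite_eq', Finset.mem_univ,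
    if_true, map_zero, LinearMap.zero_apply] at h1
  exact h1

theorem isVectorBundle_cotangentBundle : (cotangentBundle E M).IsVectorBundle E where
  zero := isSmoothAlong_zero (E := E) (E' := E) (fun x : M => x) 1
  add _ _ ha hb := IsSmoothAlong.add (E := E) (E' := E) ha hb
  smul _ _ hg ha := IsSmoothAlong.smul (E := E) (E' := E) hg ha
  isLocal _ h := isSmoothAlong_of_eventuallyEq (E := E) (E' := E) h
  frame x := by
    obtain ⟨h, W, U, hF, hx⟩ := exists_coordFrame_at (E := E) x
    refine ⟨_, fun i => dFun E (h i), U, hF.isOpen, hx, fun i => isSmoothForm_dFun (hF.smooth_fn i),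
      fun y hy => ⟨hF.linearIndependent hy, ?_⟩, fun a ha => ⟨fun i y => pairing y (a y) (W i y),
        fun i => (isSmoothFn_pairing ha (hF.smooth_vf i)).contMDiffOn,
        fun y hy => hF.expand_form hy (a y)⟩⟩
    refine eq_top_iff.2 fun η _ => ?_
    have := hF.expand_form hy η
    rw [this]
    exact Submodule.sum_mem _ fun i _ => Submodule.smul_mem _ _ (Submodule.subset_span ⟨i, rfl⟩)

theorem isLieAlgebroid_poissonAlgebroid {P : Bivector E M} (hP : P.IsPoisson) :
    (poissonAlgebroid P).IsLieAlgebroid where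
  isVectorBundle := isVectorBundle_cotangentBundle
  anchor_smooth _ ha := P.isSmoothVF ha
  bracket_smooth _ _ ha hb := P.isSmoothForm_formBracket ha hb
  bracket_add _ _ _ ha hb hc := P.formBracket_add ha hb hc
  bracket_skew _ _ ha hb := P.formBracket_skew ha hb
  bracket_leibniz _ _ _ hg ha hb := P.formBracket_smul hg ha hb
  jacobi _ _ _ ha hb hc := Bivector.jacobiator_eq_zero hP ha hb hc
  anchor_bracket a b ha hb := by
    funext x
    refine tangent_ext fun g hg => ?_
    exact (Bivector.anchorAt hP x ha hb g hg).trans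
      (dirDeriv_mlieBracket (P.isSmoothVF ha) (P.isSmoothVF hb) hg x).symm

theorem dForm_zero {k : ℕ} : dForm (0 : DForm E M k) = 0 := by
  have h := dForm_add (isSmoothAlong_zero (E := E) (E' := E) (fun x : M => x) k)
    (isSmoothAlong_zero (E := E) (E' := E) (fun x : M => x) k)
  have h' : dForm ((0 : DForm E M k) + 0) = dForm (0 : DForm E M k) + dForm (0 : DForm E M k) := h
  rw [add_zero] at h'
  exact left_eq_add.1 h'

theorem interior_zero {k : ℕ} (V : VField E M) : interior V (0 : DForm E M (k + 1)) = 0 := rfl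

theorem lieDeriv_zero {k : ℕ} (V : VField E M) : lieDeriv V (0 : DForm E M (k + 1)) = 0 := by
  rw [lieDeriv, dForm_zero, interior_zero, interior_zero, dForm_zero, add_zero]

/-- The map is the identity in degree `-1` and minus biduality in degree `0`, hence an isomorphism
of complexes whatever the rank of `P`; it commutes with the differentials because `P` is skew.
Degree `1` is zero. -/
theorem isQuasiIso_canonicalForm (P : Bivector E M) (x : M) : IsQuasiIso
    (P.sharp x) (0 : TangentSpace 𝓘(ℝ, E) x →ₗ[ℝ] PUnit.{1})
    ((P.sharp x).dualMap ∘ₗ pairing x) (0 : Module.Dual ℝ (AltForm E 1 x) →ₗ[ℝ] PUnit.{1})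
    (LinearMap.id : AltForm E 1 x →ₗ[ℝ] AltForm E 1 x)
    (-((LinearMap.id : AltForm E 1 x →ₗ[ℝ] AltForm E 1 x).dualMap ∘ₗ
      (pairing (E := E) x).flip)) 0 where
  dd := rfl
  ee := rfl
  comm₀ := LinearMap.ext fun α => LinearMap.ext fun β => by
    exact (P.skew' x α β).symm
  comm₁ := rfl
  inj₀ _ _ h := h
  surj₀ z hz := by
    refine ⟨z, tangent_ext_of_pairing fun α => ?_, rfl⟩
    rw [P.skew', map_zero, neg_eq_zero]
    exact DFunLike.congr_fun hz α
  inj₁ v _ := by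
    rintro ⟨α, hα⟩
    refine ⟨α, tangent_ext_of_pairing fun β => ?_⟩
    have h : pairing x α (P.sharp x β) = - pairing x β v := DFunLike.congr_fun hα β
    rw [P.skew', neg_inj] at h
    exact h
  surj₁ z _ := by
    obtain ⟨v, hv⟩ := exists_tangent_of_dual z
    refine ⟨-v, rfl, 0, ?_⟩
    rw [map_zero]
    refine (sub_eq_zero.2 (LinearMap.ext fun α => ?_)).symm
    rw [hv]
    show _ = - pairing x α (-v)
    rw [map_neg, neg_neg]
  inj₂ v _ := ⟨0, Subsingleton.elim _ _⟩
  surj₂ z := ⟨0, 0, Subsingleton.elim _ _⟩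

/-- Since `d² = 0`, the Lie derivative of `db` is `d ι db`. The identity is the exterior derivative
of the definition of the bracket, in which the term `d ι_{Pa} b` is already closed. -/
theorem Bivector.lieDeriv_dForm_sub (P : Bivector E M) {a b : DForm E M 1} (ha : IsSmoothForm a)
    (hb : IsSmoothForm b) :
    lieDeriv (P.vf a) (dForm b) - lieDeriv (P.vf b) (dForm a) - dForm (P.formBracket a b) = 0 := by
  have hp := isSmoothForm_interior (P.isSmoothVF ha) (isSmoothForm_dForm hb)
  have hq := isSmoothForm_interior (P.isSmoothVF hb) (isSmoothForm_dForm ha)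
  have he := isSmoothForm_interior (P.isSmoothVF ha) hb
  have hbr : P.formBracket a b + interior (P.vf b) (dForm a) =
      dForm (interior (P.vf a) b) + interior (P.vf a) (dForm b) := by
    rw [Bivector.formBracket, lieDeriv, sub_add_cancel]
  have h : dForm (P.formBracket a b + interior (P.vf b) (dForm a)) =
      dForm (dForm (interior (P.vf a) b) + interior (P.vf a) (dForm b)) := by rw [hbr]
  rw [dForm_add (P.isSmoothForm_formBracket ha hb) hq, dForm_add (isSmoothForm_dForm he) hp,
    dForm_dForm he, zero_add] at h
  rw [lieDeriv, lieDeriv, dForm_dForm ha, dForm_dForm hb, interior_zero, interior_zero,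
    add_zero, add_zero, ← h, add_sub_cancel_right, sub_self]

theorem Bivector.interior_add_interior (P : Bivector E M) (a b : DForm E M 1) :
    interior (P.vf a) b + interior (P.vf b) a = 0 := by
  rw [interior_eq_constForm, interior_eq_constForm]
  funext x
  ext m
  show pairing x (b x) (P.sharp x (a x)) + pairing x (a x) (P.sharp x (b x)) = 0
  rw [P.skew', neg_add_cancel]

/-- Of the components of `δΩ = 0`, `comp₁` is the definition of the bracket, `comp₀` is its exterior
derivative, and `comp₂` is skewness of `P`. -/
theorem isOneShiftedSymplectic_canonicalForm (P : Bivector E M) :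
    IsOneShiftedSymplectic (poissonAlgebroid P) (canonicalForm E M) 0 where
  isForm₀ :=
    { op_smooth := fun _ ha => isSmoothForm_dForm ha
      sym_smooth := fun _ ha => ha
      op_add := fun _ _ ha hb => dForm_add ha hb
      op_smul := fun _ _ hg ha => dForm_smul hg ha }
  isForm₁ := isSmoothAlong_zero (E := E) (E' := E) (fun x : M => x) 3
  closed₀ :=
    { comp₀ := fun _ _ ha hb => P.lieDeriv_dForm_sub ha hb
      comp₁ := fun a b _ _ => by
        show lieDeriv (P.vf a) b - (lieDeriv (P.vf a) b - interior (P.vf b) (dForm (E := E) a))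
          - interior (P.vf b) (dForm (E := E) a) = 0
        rw [sub_sub_cancel, sub_self]
      comp₂ := fun a b _ _ => P.interior_add_interior a b }
  closed₁_op a ha := by
    rw [lieDeriv_zero, sub_zero]
    exact dForm_dForm ha
  closed₁_sym a _ := by
    rw [interior_zero, sub_zero]
    exact sub_self (dForm (E := E) a)
  closed₂ := dForm_zero
  nondegenerate x := isQuasiIso_canonicalForm P x

end PoissonAlgebroid


/-! ### Slice coordinates, local extension and the conormal bundle -/

section Immersion

variable {E : Type u} [NormedAddCommGroup E] [NormedSpace ℝ E] [FiniteDimensional ℝ E]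
  {X : Type v} [TopologicalSpace X] [T2Space X] [ChartedSpace E X] [IsManifold 𝓘(ℝ, E) ∞ X]
  {E' : Type u'} [NormedAddCommGroup E'] [NormedSpace ℝ E'] [FiniteDimensional ℝ E']
  {S : Type v'} [TopologicalSpace S] [T2Space S] [ChartedSpace E' S] [IsManifold 𝓘(ℝ, E') ∞ S]
  {f : S → X}

theorem immersion_eq_in_charts {s : S} (hs : Manifold.IsImmersionAt 𝓘(ℝ, E') 𝓘(ℝ, E) ∞ f s)
    {t : S} (ht : t ∈ hs.domChart.source) :
    hs.codChart (f t) = hs.equiv (hs.domChart t, 0) := by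
  have ht' : hs.domChart t ∈ (hs.domChart.extend 𝓘(ℝ, E')).target := by
    simpa using hs.domChart.map_source ht
  have h := hs.writtenInCharts ht'
  simpa [hs.domChart.left_inv ht] using h

/-- In the local normal form `u ↦ (u, 0)` of an immersion, a basis of `E'` together with one of the
complement gives coordinates on `X`: the first group restricts to coordinates on `S`, the second
vanishes. The set `V` is a neighbourhood in `S` and not in the image, so `f` need not be injective.
-/
theorem exists_sliceFrame (hf : Manifold.IsImmersion 𝓘(ℝ, E') 𝓘(ℝ, E) ∞ f) (s : S) :
    ∃ (p q : ℕ) (h' : Fin p → S → ℝ) (W' : Fin p → VField E' S) (V : Set S)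
      (h : Fin p ⊕ Fin q → X → ℝ) (W : Fin p ⊕ Fin q → VField E X) (U : Set X),
      IsCoordFrame h' W' V ∧ IsCoordFrame h W U ∧ s ∈ V ∧ (∀ t ∈ V, f t ∈ U) ∧
      (∀ i, ∀ t ∈ V, h (Sum.inl i) (f t) = h' i t) ∧
      ∀ j, ∀ t ∈ V, h (Sum.inr j) (f t) = 0 := by
  have hs := hf.isImmersionAt s
  -- The complement embeds in the finite-dimensional space `E`.
  have hfin : FiniteDimensional ℝ hs.complement :=
    Module.Finite.of_injective
      (hs.equiv.toLinearEquiv.toLinearMap ∘ₗ LinearMap.inr ℝ E' hs.complement)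
      (hs.equiv.injective.comp (LinearMap.inr_injective))
  set b' := Module.finBasis ℝ E'
  set b₂ := Module.finBasis ℝ hs.complement
  obtain ⟨h', W', V, hF', hsV, hh'⟩ := exists_coordFrame b' hs.domChart_mem_maximalAtlas
    hs.mem_domChart_source
  obtain ⟨h, W, U, hF, hsU, hh⟩ := exists_coordFrame ((b'.prod b₂).map hs.equiv.toLinearEquiv)
    hs.codChart_mem_maximalAtlas hs.mem_codChart_source
  have hcont : Continuous f := hf.contMDiff.continuous
  refine ⟨_, _, h', W', V ∩ (hs.domChart.source ∩ f ⁻¹' U), h, W, U,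
    ⟨hF'.isOpen.inter (hs.domChart.open_source.inter (hF.isOpen.preimage hcont)), hF'.smooth_fn,
      hF'.smooth_vf, fun y hy => hF'.dual y hy.1, fun y hy => hF'.expand y hy.1⟩, hF,
    ⟨hsV, hs.mem_domChart_source, hsU⟩, fun t ht => ht.2.2, fun i t ht => ?_, fun j t ht => ?_⟩
  · rw [hh _ _ ht.2.2, hh' _ _ ht.1, immersion_eq_in_charts hs ht.2.1]
    simp
  · rw [hh _ _ ht.2.2, immersion_eq_in_charts hs ht.2.1]
    simp

/-- Smooth functions extend locally along an immersion. -/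
theorem exists_fn_extension (hf : Manifold.IsImmersion 𝓘(ℝ, E') 𝓘(ℝ, E) ∞ f) (s : S)
    {q : S → ℝ} (hq : IsSmoothFn E' q) :
    ∃ q' : X → ℝ, IsSmoothFn E q' ∧ ∀ᶠ t in 𝓝 s, q' (f t) = q t := by
  have hs := hf.isImmersionAt s
  have hcont : Continuous f := hf.contMDiff.continuous
  -- In the slice charts `π` is a left inverse of `f`; the extension of `q` is `q ∘ π`, constant in
  -- the direction of the complement.
  set π : E →L[ℝ] E' := (ContinuousLinearMap.fst ℝ E' hs.complement).comp
    hs.equiv.symm.toContinuousLinearMap with hπ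
  have hπf : ∀ t ∈ hs.domChart.source, π (hs.codChart (f t)) = hs.domChart t := by
    intro t ht
    rw [immersion_eq_in_charts hs ht, hπ]
    simp
  have hpi : ContMDiffOn 𝓘(ℝ, E) 𝓘(ℝ, E') ∞ (fun y => π (hs.codChart y)) hs.codChart.source :=
    π.contMDiff.comp_contMDiffOn (contMDiffOn_chart hs.codChart_mem_maximalAtlas)
  have hO : IsOpen (hs.codChart.source ∩ (fun y => π (hs.codChart y)) ⁻¹' hs.domChart.target) :=
    hpi.continuousOn.isOpen_inter_preimage hs.codChart.open_source hs.domChart.open_target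
  have hsmooth : ContMDiffOn 𝓘(ℝ, E) 𝓘(ℝ, ℝ) ∞
      (fun y => q (hs.domChart.symm (π (hs.codChart y))))
      (hs.codChart.source ∩ (fun y => π (hs.codChart y)) ⁻¹' hs.domChart.target) :=
    hq.comp_contMDiffOn ((contMDiffOn_symm_of_mem_maximalAtlas hs.domChart_mem_maximalAtlas).comp
      (hpi.mono Set.inter_subset_left) Set.inter_subset_right)
  have hfs : f s ∈ hs.codChart.source ∩ (fun y => π (hs.codChart y)) ⁻¹' hs.domChart.target := by
    refine ⟨hs.mem_codChart_source, ?_⟩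
    rw [Set.mem_preimage, hπf s hs.mem_domChart_source]
    exact hs.domChart.map_source hs.mem_domChart_source
  obtain ⟨q', hq', hev⟩ := exists_smooth_extension hO hfs hsmooth
  refine ⟨q', hq', ?_⟩
  filter_upwards [hcont.continuousAt.eventually hev,
    hs.domChart.open_source.mem_nhds hs.mem_domChart_source] with t ht ht'
  rw [ht, hπf t ht', hs.domChart.left_inv ht']

/-- Every function on `S` is locally the restriction of one on `X`, so its derivative along `v`
depends only on `df v`. -/
theorem mfderiv_injective_of_immersion (hf : Manifold.IsImmersion 𝓘(ℝ, E') 𝓘(ℝ, E) ∞ f) (s : S)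
    {v w : TangentSpace 𝓘(ℝ, E') s}
    (h : mfderiv 𝓘(ℝ, E') 𝓘(ℝ, E) f s v = mfderiv 𝓘(ℝ, E') 𝓘(ℝ, E) f s w) : v = w := by
  refine tangent_ext fun g hg => ?_
  obtain ⟨g', hg', hev⟩ := exists_fn_extension hf s hg
  have hfd := (hf.contMDiff s).mdifferentiableAt (by simp : (∞ : WithTop ℕ∞) ≠ 0)
  rw [← dirDeriv_congr hev v, ← dirDeriv_congr hev w, dirDeriv_comp hfd hg', dirDeriv_comp hfd hg',
    h]

/-- Sections of `f* T*X` extend locally along an immersion. -/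
theorem exists_form_extension (hf : Manifold.IsImmersion 𝓘(ℝ, E') 𝓘(ℝ, E) ∞ f) (s : S)
    {ξ : ∀ t : S, AltForm E 1 (f t)} (hξ : IsSmoothAlong (E' := E') f ξ) :
    ∃ β : DForm E X 1, IsSmoothForm β ∧ ∀ᶠ t in 𝓝 s, β (f t) = ξ t := by
  obtain ⟨h, W, U, hF, hsU⟩ := exists_coordFrame_at (E := E) (f s)
  have hq : ∀ i, IsSmoothFn E' (fun t => pairing (f t) (ξ t) (W i (f t))) :=
    fun i => IsSmoothAlong.pairing hf.contMDiff hξ (hF.smooth_vf i)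
  choose q hqs hqe using fun i => exists_fn_extension hf s (hq i)
  refine ⟨fun y => ∑ i, q i y • dFun E (h i) y, isSmoothForm_sum Finset.univ fun i =>
    IsSmoothAlong.smul (hqs i) (isSmoothForm_dFun (hF.smooth_fn i)), ?_⟩
  filter_upwards [hf.contMDiff.continuous.continuousAt.eventually (hF.isOpen.mem_nhds hsU),
    Filter.eventually_all.2 hqe] with t ht hqt
  rw [hF.expand_form ht (ξ t)]
  exact Finset.sum_congr rfl fun i _ => by rw [hqt i]

theorem mem_conormalSpace_iff {s : S} {η : AltForm E 1 (f s)} :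
    η ∈ conormalSpace E E' f s ↔
      ∀ v : TangentSpace 𝓘(ℝ, E') s, pairing (f s) η (mfderiv 𝓘(ℝ, E') 𝓘(ℝ, E) f s v) = 0 := by
  refine ⟨fun h v => congrArg (fun θ => pairing s θ v) (LinearMap.mem_ker.1 h), fun h => ?_⟩
  exact LinearMap.mem_ker.2 (altForm_one_ext fun v => h v)

/-- The differentials of the transversal slice coordinates form a local frame. -/
theorem isVectorBundle_conormalBundle (hf : Manifold.IsImmersion 𝓘(ℝ, E') 𝓘(ℝ, E) ∞ f) :
    (conormalBundle E E' f).IsVectorBundle E' where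
  zero := isSmoothAlong_zero (E := E) (E' := E') f 1
  add _ _ ha hb := IsSmoothAlong.add (E := E) (E' := E') ha hb
  smul _ _ hg ha := IsSmoothAlong.smul (E := E) (E' := E') hg ha
  isLocal a h := isSmoothAlong_of_eventuallyEq (E := E) (E' := E') fun t => by
    obtain ⟨b, hb, hev⟩ := h t
    exact ⟨_, hb, hev.mono fun y hy => congrArg Subtype.val hy⟩
  frame s := by
    obtain ⟨p, q, h', W', V, h, W, U, hF', hF, hsV, hVU, hl, hr⟩ := exists_sliceFrame hf s
    obtain ⟨χ, hχ, hχV, hχ1⟩ := exists_bump (E := E') (hF'.isOpen.mem_nhds hsV)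
    obtain ⟨V', hV'1, hV', hsV'⟩ := mem_nhds_iff.1 (Filter.inter_mem hχ1 (hF'.isOpen.mem_nhds hsV))
    have hfd : ∀ t, MDifferentiableAt 𝓘(ℝ, E') 𝓘(ℝ, E) f t :=
      fun t => (hf.contMDiff t).mdifferentiableAt (by simp)
    have hcon : ∀ j, ∀ t ∈ V, dFun E (h (Sum.inr j)) (f t) ∈ conormalSpace E E' f t := by
      intro j t ht
      refine mem_conormalSpace_iff.2 fun v => ?_
      rw [pairing_dFun, ← dirDeriv_comp (hfd t) (hF.smooth_fn _), ← dirDeriv_const 0 t v]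
      exact dirDeriv_congr (Filter.eventually_of_mem (hF'.isOpen.mem_nhds ht) (hr j)) v
    -- The tangential coordinate fields of `X` are images under `df`, so conormal covectors have no
    -- components along the corresponding differentials.
    have hW : ∀ i, ∀ t ∈ V, W (Sum.inl i) (f t) = mfderiv 𝓘(ℝ, E') 𝓘(ℝ, E) f t (W' i t) := by
      intro i t ht
      have hd : ∀ k, dirDeriv E (h k) (f t) (mfderiv 𝓘(ℝ, E') 𝓘(ℝ, E) f t (W' i t)) =
          if k = Sum.inl i then 1 else 0 := by
        intro k
        rw [← dirDeriv_comp (hfd t) (hF.smooth_fn _)]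
        rcases k with k | k
        · rw [dirDeriv_congr (Filter.eventually_of_mem (hF'.isOpen.mem_nhds ht) (hl k)),
            hF'.dual t ht]
          simp only [Sum.inl.injEq]
        · rw [dirDeriv_congr (Filter.eventually_of_mem (hF'.isOpen.mem_nhds ht) (hr k)),
            dirDeriv_const]
          simp
      rw [hF.expand (f t) (hVU t ht) (mfderiv 𝓘(ℝ, E') 𝓘(ℝ, E) f t (W' i t))]
      simp only [hd, ite_smul, one_smul, zero_smul, Finset.sum_ite_eq', Finset.mem_univ, if_true]
    have hexp : ∀ t ∈ V, ∀ η ∈ conormalSpace E E' f t, η =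
        ∑ j, pairing (f t) η (W (Sum.inr j) (f t)) • dFun E (h (Sum.inr j)) (f t) := by
      intro t ht η hη
      conv_lhs => rw [hF.expand_form (hVU t ht) η]
      rw [Fintype.sum_sum_type, Finset.sum_eq_zero, zero_add]
      intro i _
      rw [hW i t ht, mem_conormalSpace_iff.1 hη, zero_smul]
    -- A section of the conormal bundle must be conormal at every point, while these covectors are
    -- known to be so only on `V`; hence the cut-off by `χ`, which is `1` on `V'`.
    let e : Fin q → (conormalBundle E E' f).Sec := fun j t =>
      ⟨χ t • dFun E (h (Sum.inr j)) (f t), by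
        by_cases ht : t ∈ V
        · exact Submodule.smul_mem _ _ (hcon j t ht)
        · have : χ t = 0 := image_eq_zero_of_notMem_tsupport fun h => ht (hχV h)
          rw [this, zero_smul]
          exact Submodule.zero_mem _⟩
    have he : ∀ j, ∀ t ∈ V', (e j t).1 = dFun E (h (Sum.inr j)) (f t) := by
      intro j t ht
      have : χ t = 1 := (hV'1 ht).1
      show χ t • dFun E (h (Sum.inr j)) (f t) = _
      rw [this, one_smul]
    have hexp' : ∀ t ∈ V', ∀ η : (conormalBundle E E' f).Fib t, η =
        ∑ j, pairing (f t) η.1 (W (Sum.inr j) (f t)) • e j t := by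
      intro t ht η
      refine Subtype.ext ((hexp t (hV'1 ht).2 η.1 η.2).trans ?_)
      refine Eq.trans ?_ (map_sum (conormalSpace E E' f t).subtype _ _).symm
      refine Finset.sum_congr rfl fun j _ => ?_
      rw [← he j t ht]
      rfl
    refine ⟨q, e, V', hV', hsV', fun j => IsSmoothAlong.smul hχ
      ((isSmoothForm_dFun (hF.smooth_fn _)).along hf.contMDiff), fun t ht => ⟨?_, ?_⟩,
      fun a ha => ⟨fun j t => pairing (f t) (a t).1 (W (Sum.inr j) (f t)), fun j =>
        (IsSmoothAlong.pairing hf.contMDiff ha (hF.smooth_vf _)).contMDiffOn,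
        fun t ht => hexp' t ht (a t)⟩⟩
    · refine LinearIndependent.of_comp (conormalSpace E E' f t).subtype ?_
      have := (hF.linearIndependent (hVU t (hV'1 ht).2)).comp Sum.inr Sum.inr_injective
      convert this using 1
      funext j
      exact he j t ht
    · refine eq_top_iff.2 fun η _ => ?_
      rw [hexp' t ht η]
      exact Submodule.sum_mem _ fun i _ => Submodule.smul_mem _ _ (Submodule.subset_span ⟨i, rfl⟩)

end Immersion


/-! ### The bracket of linear combinations -/

section BracketSums

variable {E : Type u} [NormedAddCommGroup E] [NormedSpace ℝ E] [FiniteDimensional ℝ E]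
  {M : Type v} [TopologicalSpace M] [ChartedSpace E M] [IsManifold 𝓘(ℝ, E) ∞ M]

theorem Bivector.formBracket_zero [T2Space M] (P : Bivector E M) {α : DForm E M 1}
    (hα : IsSmoothForm α) : P.formBracket α 0 = 0 := by
  have h0 : IsSmoothForm (0 : DForm E M 1) := isSmoothAlong_zero (E := E) (E' := E) (fun x : M => x) 1
  have h := P.formBracket_add hα h0 h0
  rw [add_zero] at h
  exact left_eq_add.1 h

theorem Bivector.formBracket_sum_smul [T2Space M] (P : Bivector E M) {α : DForm E M 1}
    (hα : IsSmoothForm α) {κ : Type*} (I : Finset κ) {g : κ → M → ℝ} {a : κ → DForm E M 1}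
    (hg : ∀ i, IsSmoothFn E (g i)) (ha : ∀ i, IsSmoothForm (a i)) (x : M) :
    P.formBracket α (fun y => ∑ i ∈ I, g i y • a i y) x =
      ∑ i ∈ I, (g i x • P.formBracket α (a i) x + dirDeriv E (g i) x (P.vf α x) • a i x) := by
  classical
  induction I using Finset.induction_on with
  | empty =>
    simp only [Finset.sum_empty]
    exact congrFun (P.formBracket_zero hα) x
  | insert i I hi ih =>
    simp only [Finset.sum_insert hi]
    rw [← ih]
    have h1 : IsSmoothForm (fun y => g i y • a i y) := IsSmoothAlong.smul (hg i) (ha i)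
    have h2 : IsSmoothForm (fun y => ∑ i ∈ I, g i y • a i y) :=
      isSmoothForm_sum I fun i => IsSmoothAlong.smul (hg i) (ha i)
    have h3 := congrFun (P.formBracket_add hα h1 h2) x
    have h4 := congrFun (P.formBracket_smul (hg i) hα (ha i)) x
    exact h3.trans (congrArg (· + _) h4)

/-- The Leibniz rule in both arguments, arranged as in the field `bracket` of `IsAlgebroidMorphism`.
-/
theorem Bivector.formBracket_sum_smul_sum_smul [T2Space M] (P : Bivector E M) {m m' : ℕ}
    {g : Fin m → M → ℝ} {a : Fin m → DForm E M 1} {g' : Fin m' → M → ℝ} {a' : Fin m' → DForm E M 1}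
    (hg : ∀ i, IsSmoothFn E (g i)) (ha : ∀ i, IsSmoothForm (a i))
    (hg' : ∀ i, IsSmoothFn E (g' i)) (ha' : ∀ i, IsSmoothForm (a' i)) (x : M) :
    P.formBracket (fun y => ∑ i, g i y • a i y) (fun y => ∑ k, g' k y • a' k y) x =
      ∑ i, ∑ k, (g i x * g' k x) • P.formBracket (a i) (a' k) x
        + ∑ k, dirDeriv E (g' k) x (P.vf (fun y => ∑ i, g i y • a i y) x) • a' k x
        - ∑ i, dirDeriv E (g i) x (P.vf (fun y => ∑ k, g' k y • a' k y) x) • a i x := by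
  have hβ : IsSmoothForm (fun y => ∑ i, g i y • a i y) :=
    isSmoothForm_sum _ fun i => IsSmoothAlong.smul (hg i) (ha i)
  have hleft : ∀ k, P.formBracket (fun y => ∑ i, g i y • a i y) (a' k) x =
      ∑ i, (g i x • P.formBracket (a i) (a' k) x - dirDeriv E (g i) x (P.vf (a' k) x) • a i x) := by
    intro k
    rw [P.formBracket_skew hβ (ha' k), Pi.neg_apply,
      P.formBracket_sum_smul (ha' k) Finset.univ hg ha, ← Finset.sum_neg_distrib]
    refine Finset.sum_congr rfl fun i _ => ?_
    rw [P.formBracket_skew (ha i) (ha' k), Pi.neg_apply]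
    module
  have hanchor : ∀ i, dirDeriv E (g i) x (P.vf (fun y => ∑ k, g' k y • a' k y) x) =
      ∑ k, g' k x * dirDeriv E (g i) x (P.vf (a' k) x) := by
    intro i
    show pairing x (dFun E (g i) x) (P.sharp x (∑ k, g' k x • a' k x)) = _
    rw [map_sum, map_sum]
    refine Finset.sum_congr rfl fun k _ => ?_
    rw [map_smul, map_smul]
    rfl
  rw [P.formBracket_sum_smul hβ Finset.univ hg' ha', Finset.sum_add_distrib]
  simp only [hleft, hanchor, Finset.sum_smul, Finset.smul_sum]
  rw [Finset.sum_comm (γ := Fin m'), add_sub_right_comm]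
  congr 1
  rw [← Finset.sum_sub_distrib]
  refine Finset.sum_congr rfl fun i _ => ?_
  rw [← Finset.sum_sub_distrib]
  refine Finset.sum_congr rfl fun k _ => ?_
  module

end BracketSums

/-! ### Anchor and bracket on the conormal bundle of a coisotropic submanifold -/

section Conormal

variable {E : Type u} [NormedAddCommGroup E] [NormedSpace ℝ E] [FiniteDimensional ℝ E]
  {X : Type v} [TopologicalSpace X] [T2Space X] [ChartedSpace E X] [IsManifold 𝓘(ℝ, E) ∞ X]
  {E' : Type u'} [NormedAddCommGroup E'] [NormedSpace ℝ E'] [FiniteDimensional ℝ E']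
  {S : Type v'} [TopologicalSpace S] [T2Space S] [ChartedSpace E' S] [IsManifold 𝓘(ℝ, E') ∞ S]
  {f : S → X} {P : Bivector E X}

/-- The `1`-form `β` on `X` restricts near `s` to the section `b` of the conormal bundle. -/
structure IsExtensionAt (s : S) (β : DForm E X 1) (b : ∀ t, conormalSpace E E' f t) : Prop where
  smooth : IsSmoothForm β
  eq : ∀ᶠ t in 𝓝 s, β (f t) = b t

theorem IsExtensionAt.eventually {s : S} {β : DForm E X 1} {b : ∀ t, conormalSpace E E' f t}
    (h : IsExtensionAt s β b) : ∀ᶠ t in 𝓝 s, IsExtensionAt t β b := by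
  filter_upwards [h.eq.eventually_nhds] with t ht
  exact ⟨h.smooth, ht⟩

theorem IsExtensionAt.pullForm_eq_zero {s : S} {β : DForm E X 1}
    {b : ∀ t, conormalSpace E E' f t} (h : IsExtensionAt s β b) :
    ∀ᶠ t in 𝓝 s, pullForm (E' := E') f β t = (0 : DForm E' S 1) t := by
  filter_upwards [h.eq] with t ht
  show pullCov f 1 t (β (f t)) = 0
  rw [ht]
  exact (b t).2

theorem exists_extension (hf : Manifold.IsImmersion 𝓘(ℝ, E') 𝓘(ℝ, E) ∞ f) (s : S)
    {b : ∀ t, conormalSpace E E' f t}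
    (hb : IsSmoothAlong (E := E) (E' := E') f (fun t => (b t : AltForm E 1 (f t)))) :
    ∃ β, IsExtensionAt s β b := by
  obtain ⟨β, hβ, hev⟩ := exists_form_extension hf s hb
  exact ⟨β, hβ, hev⟩

/-- Near `s` the pullback `f*β` is zero, since `b` is conormal; hence so is `f*dβ = d(f*β)`. -/
theorem IsExtensionAt.dForm_apply_mfderiv (hf : ContMDiff 𝓘(ℝ, E') 𝓘(ℝ, E) ∞ f) {s : S}
    {β : DForm E X 1} {b : ∀ t, conormalSpace E E' f t} (h : IsExtensionAt s β b)
    (u v : TangentSpace 𝓘(ℝ, E') s) :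
    pairing (f s) (flat (dForm β (f s)) (mfderiv 𝓘(ℝ, E') 𝓘(ℝ, E) f s u))
      (mfderiv 𝓘(ℝ, E') 𝓘(ℝ, E) f s v) = 0 := by
  have h1 : dForm (pullForm (E' := E') f β) s = pullForm f (dForm β) s :=
    congrFun (dForm_pullForm hf h.smooth) s
  rw [dForm_congr h.pullForm_eq_zero, dForm_zero] at h1
  have h2 : pairing s (flat (pullForm (E' := E') f (dForm β) s) u) v = 0 := by
    rw [← h1]; rfl
  rw [← two_form_apply] at h2 ⊢
  refine Eq.trans ?_ h2
  show dForm β (f s) _ = dForm β (f s) _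
  congr 1
  ext i
  fin_cases i <;> rfl

/-- The anchor of the conormal bundle of a coisotropic submanifold. -/
def conormalAnchor (hf : Manifold.IsImmersion 𝓘(ℝ, E') 𝓘(ℝ, E) ∞ f) (hco : P.IsCoisotropic E' f)
    (s : S) : conormalSpace E E' f s →ₗ[ℝ] TangentSpace 𝓘(ℝ, E') s where
  toFun ξ := (hco s ξ ξ.2).choose
  -- The chosen preimages of `Pξ` under `df` are unique by injectivity, hence linear in `ξ`.
  map_add' ξ ζ := mfderiv_injective_of_immersion hf s <| by
    rw [(hco s _ (ξ + ζ).2).choose_spec, map_add, (hco s _ ξ.2).choose_spec,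
      (hco s _ ζ.2).choose_spec]
    exact map_add _ _ _
  map_smul' c ξ := mfderiv_injective_of_immersion hf s <| by
    rw [(hco s _ (c • ξ).2).choose_spec, RingHom.id_apply, map_smul, (hco s _ ξ.2).choose_spec]
    exact map_smul _ _ _

theorem mfderiv_conormalAnchor (hf : Manifold.IsImmersion 𝓘(ℝ, E') 𝓘(ℝ, E) ∞ f)
    (hco : P.IsCoisotropic E' f) {s : S} (ξ : conormalSpace E E' f s) :
    mfderiv 𝓘(ℝ, E') 𝓘(ℝ, E) f s (conormalAnchor hf hco s ξ) = P.sharp (f s) ξ :=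
  (hco s ξ ξ.2).choose_spec

theorem IsExtensionAt.vf_eq (hf : Manifold.IsImmersion 𝓘(ℝ, E') 𝓘(ℝ, E) ∞ f)
    (hco : P.IsCoisotropic E' f) {s : S} {β : DForm E X 1} {b : ∀ t, conormalSpace E E' f t}
    (h : IsExtensionAt s β b) :
    P.vf β (f s) = mfderiv 𝓘(ℝ, E') 𝓘(ℝ, E) f s (conormalAnchor hf hco s (b s)) := by
  rw [mfderiv_conormalAnchor, ← h.eq.self_of_nhds]
  rfl

/-- By coisotropy `Pβ` is tangent to `S` along `f`, so it differentiates `g` through `g ∘ f` alone.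
-/
theorem IsExtensionAt.dirDeriv_eq (hf : Manifold.IsImmersion 𝓘(ℝ, E') 𝓘(ℝ, E) ∞ f)
    (hco : P.IsCoisotropic E' f) {s : S} {β : DForm E X 1} {b : ∀ t, conormalSpace E E' f t}
    (h : IsExtensionAt s β b) {g : X → ℝ} (hg : IsSmoothFn E g) {g' : S → ℝ}
    (hgg : ∀ᶠ t in 𝓝 s, g (f t) = g' t) :
    dirDeriv E g (f s) (P.vf β (f s)) = dirDeriv E' g' s (conormalAnchor hf hco s (b s)) := by
  rw [h.vf_eq hf hco, ← dirDeriv_comp ((hf.contMDiff s).mdifferentiableAt (by simp)) hg]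
  exact dirDeriv_congr hgg _

/-- On tangent vectors both `d`-terms of the bracket vanish. The remaining function `β'(Pβ)` is zero
along `S`, because a conormal covector is paired with a tangent vector. -/
theorem IsExtensionAt.formBracket_mem (hf : Manifold.IsImmersion 𝓘(ℝ, E') 𝓘(ℝ, E) ∞ f)
    (hco : P.IsCoisotropic E' f) {s : S} {β β' : DForm E X 1} {b b' : ∀ t, conormalSpace E E' f t}
    (h : IsExtensionAt s β b) (h' : IsExtensionAt s β' b') :
    P.formBracket β β' (f s) ∈ conormalSpace E E' f s := by
  refine mem_conormalSpace_iff.2 fun v => ?_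
  rw [P.pairing_formBracket h.smooth h'.smooth, h.vf_eq hf hco, h'.vf_eq hf hco,
    h.dForm_apply_mfderiv hf.contMDiff, h'.dForm_apply_mfderiv hf.contMDiff, add_zero, sub_zero,
    ← dirDeriv_comp ((hf.contMDiff s).mdifferentiableAt (by simp))
      (isSmoothFn_pairing h'.smooth (P.isSmoothVF h.smooth)), ← dirDeriv_const 0 s v]
  refine dirDeriv_congr ?_ v
  filter_upwards [h.eventually, h'.eq] with t ht ht'
  rw [ht.vf_eq hf hco, ht']
  exact mem_conormalSpace_iff.1 (b' t).2 _

/-- In a coordinate frame the coefficients of `γ` vanish along `S`, and so do their derivatives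
along `Pβ`, which is tangent to `S`; the Leibniz rule involves nothing else. -/
theorem IsExtensionAt.formBracket_eq_zero (hf : Manifold.IsImmersion 𝓘(ℝ, E') 𝓘(ℝ, E) ∞ f)
    (hco : P.IsCoisotropic E' f) {s : S} {β γ : DForm E X 1} {b : ∀ t, conormalSpace E E' f t}
    (h : IsExtensionAt s β b) (hγ : IsSmoothForm γ) (h0 : ∀ᶠ t in 𝓝 s, γ (f t) = 0) :
    P.formBracket β γ (f s) = 0 := by
  obtain ⟨k, W, U, hF, hsU⟩ := exists_coordFrame_at (E := E) (f s)
  have hp : ∀ i, IsSmoothFn E (fun y => pairing y (γ y) (W i y)) :=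
    fun i => isSmoothFn_pairing hγ (hF.smooth_vf i)
  have hexp : ∀ᶠ y in 𝓝 (f s), γ y = ∑ i, pairing y (γ y) (W i y) • dFun E (k i) y :=
    Filter.eventually_of_mem (hF.isOpen.mem_nhds hsU) fun y hy => hF.expand_form hy (γ y)
  rw [P.formBracket_congr (Filter.Eventually.of_forall fun y => rfl : ∀ᶠ y in 𝓝 (f s), β y = β y)
    hexp, P.formBracket_sum_smul h.smooth Finset.univ hp
      fun i => isSmoothForm_dFun (hF.smooth_fn i)]
  refine Finset.sum_eq_zero fun i _ => ?_
  have hz : ∀ᶠ t in 𝓝 s, pairing (f t) (γ (f t)) (W i (f t)) = 0 := by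
    filter_upwards [h0] with t ht
    rw [ht, map_zero, LinearMap.zero_apply]
  rw [hz.self_of_nhds, zero_smul, zero_add, h.dirDeriv_eq hf hco (hp i) hz, dirDeriv_const,
    zero_smul]

/-- Two extensions differ by a form vanishing along `S`. The second argument is changed first;
skewness then handles the first one. -/
theorem IsExtensionAt.formBracket_eq (hf : Manifold.IsImmersion 𝓘(ℝ, E') 𝓘(ℝ, E) ∞ f)
    (hco : P.IsCoisotropic E' f) {s : S} {β₁ β₂ β₁' β₂' : DForm E X 1}
    {b b' : ∀ t, conormalSpace E E' f t} (h₁ : IsExtensionAt s β₁ b) (h₂ : IsExtensionAt s β₂ b)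
    (h₁' : IsExtensionAt s β₁' b') (h₂' : IsExtensionAt s β₂' b') :
    P.formBracket β₁ β₁' (f s) = P.formBracket β₂ β₂' (f s) := by
  have key : ∀ {α β β' : DForm E X 1} {a b : ∀ t, conormalSpace E E' f t}, IsExtensionAt s α a →
      IsExtensionAt s β b → IsExtensionAt s β' b →
      P.formBracket α β (f s) = P.formBracket α β' (f s) := by
    intro α β β' a b ha hb hb'
    have hγ : IsSmoothForm (fun y => β y - β' y) := IsSmoothAlong.sub hb.smooth hb'.smooth
    have hz : ∀ᶠ t in 𝓝 s, β (f t) - β' (f t) = 0 := by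
      filter_upwards [hb.eq, hb'.eq] with t ht ht'
      rw [ht, ht', sub_self]
    have hsum : β = β' + fun y => β y - β' y := by
      funext y
      exact (add_sub_cancel (β' y) (β y)).symm
    rw [hsum, P.formBracket_add ha.smooth hb'.smooth hγ, Pi.add_apply,
      ha.formBracket_eq_zero hf hco hγ hz, add_zero]
  rw [key h₁ h₁' h₂', P.formBracket_skew h₁.smooth h₂'.smooth,
    P.formBracket_skew h₂.smooth h₂'.smooth, Pi.neg_apply, Pi.neg_apply, key h₂' h₁ h₂]

open Classical in
/-- The bracket of sections of the conormal bundle of a coisotropic submanifold. -/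
def conormalBracket (hf : Manifold.IsImmersion 𝓘(ℝ, E') 𝓘(ℝ, E) ∞ f) (hco : P.IsCoisotropic E' f)
    (b b' : ∀ t, conormalSpace E E' f t) (s : S) : conormalSpace E E' f s :=
  -- The default value `0` is never met for smooth sections, which have extensions at every point by
  -- `exists_extension`.
  if h : (∃ β, IsExtensionAt s β b) ∧ ∃ β, IsExtensionAt s β b' then
    ⟨P.formBracket h.1.choose h.2.choose (f s),
      h.1.choose_spec.formBracket_mem hf hco h.2.choose_spec⟩
  else 0

theorem IsExtensionAt.conormalBracket_eq (hf : Manifold.IsImmersion 𝓘(ℝ, E') 𝓘(ℝ, E) ∞ f)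
    (hco : P.IsCoisotropic E' f) {s : S} {β β' : DForm E X 1} {b b' : ∀ t, conormalSpace E E' f t}
    (h : IsExtensionAt s β b) (h' : IsExtensionAt s β' b') :
    (conormalBracket hf hco b b' s : AltForm E 1 (f s)) = P.formBracket β β' (f s) := by
  have hex : (∃ β, IsExtensionAt s β b) ∧ ∃ β, IsExtensionAt s β b' := ⟨⟨β, h⟩, ⟨β', h'⟩⟩
  rw [conormalBracket, dif_pos hex]
  exact hex.1.choose_spec.formBracket_eq hf hco h hex.2.choose_spec h'

/-- An extension at `s` is one at all nearby points, so the bracket on `X` extends the bracket on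
`S` near `s`. This is what allows iterated brackets to be computed on `X`. -/
theorem IsExtensionAt.conormalBracket (hf : Manifold.IsImmersion 𝓘(ℝ, E') 𝓘(ℝ, E) ∞ f)
    (hco : P.IsCoisotropic E' f) {s : S} {β β' : DForm E X 1} {b b' : ∀ t, conormalSpace E E' f t}
    (h : IsExtensionAt s β b) (h' : IsExtensionAt s β' b') :
    IsExtensionAt s (P.formBracket β β') (conormalBracket hf hco b b') := by
  refine ⟨P.isSmoothForm_formBracket h.smooth h'.smooth, ?_⟩
  filter_upwards [h.eventually, h'.eventually] with t ht ht'
  exact (ht.conormalBracket_eq hf hco ht').symm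

theorem IsExtensionAt.add {s : S} {β β' : DForm E X 1} {b b' : ∀ t, conormalSpace E E' f t}
    (h : IsExtensionAt s β b) (h' : IsExtensionAt s β' b') :
    IsExtensionAt s (β + β') (b + b') := by
  refine ⟨isSmoothForm_add h.smooth h'.smooth, ?_⟩
  filter_upwards [h.eq, h'.eq] with t ht ht'
  rw [Pi.add_apply, ht, ht']
  rfl

theorem IsExtensionAt.smul {s : S} {β : DForm E X 1} {b : ∀ t, conormalSpace E E' f t}
    (h : IsExtensionAt s β b) {g : X → ℝ} (hg : IsSmoothFn E g) {g' : S → ℝ}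
    (hgg : ∀ᶠ t in 𝓝 s, g (f t) = g' t) :
    IsExtensionAt s (fun y => g y • β y) (fun t => g' t • b t) := by
  refine ⟨IsSmoothAlong.smul hg h.smooth, ?_⟩
  filter_upwards [h.eq, hgg] with t ht ht'
  rw [ht, ht']
  rfl

end Conormal


/-! ### The conormal Lie algebroid, its uniqueness and the Lagrangian structure -/

section ConormalAlgebroid

variable {E : Type u} [NormedAddCommGroup E] [NormedSpace ℝ E] [FiniteDimensional ℝ E]
  {X : Type v} [TopologicalSpace X] [T2Space X] [ChartedSpace E X] [IsManifold 𝓘(ℝ, E) ∞ X]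
  {E' : Type u'} [NormedAddCommGroup E'] [NormedSpace ℝ E'] [FiniteDimensional ℝ E']
  {S : Type v'} [TopologicalSpace S] [T2Space S] [ChartedSpace E' S] [IsManifold 𝓘(ℝ, E') ∞ S]
  {f : S → X} {P : Bivector E X}

/-- The conormal bundle of a coisotropic submanifold, with its anchor and bracket. -/
def conormalAlgebroid (hf : Manifold.IsImmersion 𝓘(ℝ, E') 𝓘(ℝ, E) ∞ f)
    (hco : P.IsCoisotropic E' f) : AlgebroidData E' (conormalBundle E E' f) where
  anchor := conormalAnchor hf hco
  bracket := conormalBracket hf hco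

theorem isSmoothVF_conormalAnchor (hf : Manifold.IsImmersion 𝓘(ℝ, E') 𝓘(ℝ, E) ∞ f)
    (hco : P.IsCoisotropic E' f) {b : ∀ t, conormalSpace E E' f t}
    (hb : IsSmoothAlong (E := E) (E' := E') f (fun t => (b t : AltForm E 1 (f t)))) :
    IsSmoothVF (fun s => conormalAnchor hf hco s (b s)) := by
  refine isSmoothVF_of_dirDeriv fun g hg s => ?_
  obtain ⟨β, hβ⟩ := exists_extension hf s hb
  obtain ⟨k, hk, hkg⟩ := exists_fn_extension hf s hg
  have h : IsSmoothFn E (fun y => dirDeriv E k y (P.vf β y)) :=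
    isSmoothFn_dirDeriv hk (P.isSmoothVF hβ.smooth)
  refine ((h.comp hf.contMDiff) s).congr_of_eventuallyEq ?_
  filter_upwards [hβ.eventually, hkg.eventually_nhds] with t ht hkt
  exact (ht.dirDeriv_eq hf hco hk hkt).symm

/-- Both sides are tested on a function `g`. With an extension `k` of `g` to `X`, derivatives along
the anchor become derivatives of `k` along `Pβ` and `Pβ'`, where the anchor identity of `T*X`
applies. -/
theorem conormalAnchor_conormalBracket (hP : P.IsPoisson)
    (hf : Manifold.IsImmersion 𝓘(ℝ, E') 𝓘(ℝ, E) ∞ f) (hco : P.IsCoisotropic E' f)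
    {b b' : ∀ t, conormalSpace E E' f t}
    (hb : IsSmoothAlong (E := E) (E' := E') f (fun t => (b t : AltForm E 1 (f t))))
    (hb' : IsSmoothAlong (E := E) (E' := E') f (fun t => (b' t : AltForm E 1 (f t)))) (s : S) :
    conormalAnchor hf hco s (conormalBracket hf hco b b' s) =
      VectorField.mlieBracket 𝓘(ℝ, E') (fun t => conormalAnchor hf hco t (b t))
        (fun t => conormalAnchor hf hco t (b' t)) s := by
  refine tangent_ext fun g hg => ?_
  obtain ⟨β, hβ⟩ := exists_extension hf s hb
  obtain ⟨β', hβ'⟩ := exists_extension hf s hb'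
  obtain ⟨k, hk, hkg⟩ := exists_fn_extension hf s hg
  have hext : ∀ {β : DForm E X 1} {b : ∀ t, conormalSpace E E' f t}, IsExtensionAt s β b →
      ∀ᶠ t in 𝓝 s, dirDeriv E k (f t) (P.vf β (f t)) =
        dirDeriv E' g t (conormalAnchor hf hco t (b t)) := by
    intro β b hβ
    filter_upwards [hβ.eventually, hkg.eventually_nhds] with t ht hkt
    exact ht.dirDeriv_eq hf hco hk hkt
  rw [dirDeriv_mlieBracket (isSmoothVF_conormalAnchor hf hco hb)
    (isSmoothVF_conormalAnchor hf hco hb') hg,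
    ← (hβ.conormalBracket hf hco hβ').dirDeriv_eq hf hco hk hkg,
    Bivector.anchorAt hP (f s) hβ.smooth hβ'.smooth k hk,
    hβ.dirDeriv_eq hf hco (isSmoothFn_dirDeriv hk (P.isSmoothVF hβ'.smooth)) (hext hβ'),
    hβ'.dirDeriv_eq hf hco (isSmoothFn_dirDeriv hk (P.isSmoothVF hβ.smooth)) (hext hβ)]

/-- Each bracket axiom at `s` is the same axiom for extensions at `f s`; the anchor axioms are
tested on locally extended functions. -/
theorem isLieAlgebroid_conormalAlgebroid (hP : P.IsPoisson)
    (hf : Manifold.IsImmersion 𝓘(ℝ, E') 𝓘(ℝ, E) ∞ f) (hco : P.IsCoisotropic E' f) :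
    (conormalAlgebroid hf hco).IsLieAlgebroid where
  isVectorBundle := isVectorBundle_conormalBundle hf
  anchor_smooth _ hb := isSmoothVF_conormalAnchor hf hco hb
  bracket_smooth b b' hb hb' := by
    refine isSmoothAlong_of_eventuallyEq (E := E) (E' := E') fun s => ?_
    obtain ⟨β, hβ⟩ := exists_extension hf s hb
    obtain ⟨β', hβ'⟩ := exists_extension hf s hb'
    have h := hβ.conormalBracket hf hco hβ'
    exact ⟨_, h.smooth.along hf.contMDiff, h.eq.mono fun t ht => ht.symm⟩
  bracket_add a b c ha hb hc := funext fun s => Subtype.ext <| by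
    obtain ⟨α, hα⟩ := exists_extension hf s ha
    obtain ⟨β, hβ⟩ := exists_extension hf s hb
    obtain ⟨γ, hγ⟩ := exists_extension hf s hc
    refine (hα.conormalBracket_eq hf hco (hβ.add hγ)).trans ?_
    rw [P.formBracket_add hα.smooth hβ.smooth hγ.smooth, Pi.add_apply,
      ← hα.conormalBracket_eq hf hco hβ, ← hα.conormalBracket_eq hf hco hγ]
    rfl
  bracket_skew a b ha hb := funext fun s => Subtype.ext <| by
    obtain ⟨α, hα⟩ := exists_extension hf s ha
    obtain ⟨β, hβ⟩ := exists_extension hf s hb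
    refine (hα.conormalBracket_eq hf hco hβ).trans ?_
    rw [P.formBracket_skew hα.smooth hβ.smooth, Pi.neg_apply, ← hβ.conormalBracket_eq hf hco hα]
    rfl
  bracket_leibniz g a b hg ha hb := funext fun s => Subtype.ext <| by
    obtain ⟨α, hα⟩ := exists_extension hf s ha
    obtain ⟨β, hβ⟩ := exists_extension hf s hb
    obtain ⟨k, hk, hkg⟩ := exists_fn_extension hf s hg
    refine (hα.conormalBracket_eq hf hco (hβ.smul hk hkg)).trans ?_
    refine (congrFun (P.formBracket_smul hk hα.smooth hβ.smooth) (f s)).trans ?_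
    rw [hα.dirDeriv_eq hf hco hk hkg, hkg.self_of_nhds, hβ.eq.self_of_nhds,
      ← hα.conormalBracket_eq hf hco hβ]
    rfl
  jacobi a b c ha hb hc := funext fun s => Subtype.ext <| by
    obtain ⟨α, hα⟩ := exists_extension hf s ha
    obtain ⟨β, hβ⟩ := exists_extension hf s hb
    obtain ⟨γ, hγ⟩ := exists_extension hf s hc
    have h := congrFun (Bivector.jacobiator_eq_zero hP hα.smooth hβ.smooth hγ.smooth) (f s)
    refine Eq.trans ?_ h
    exact congrArg₂ (· + ·) (congrArg₂ (· + ·)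
      (hα.conormalBracket_eq hf hco (hβ.conormalBracket hf hco hγ))
      (hβ.conormalBracket_eq hf hco (hγ.conormalBracket hf hco hα)))
      (hγ.conormalBracket_eq hf hco (hα.conormalBracket hf hco hβ))
  anchor_bracket _ _ hb hb' := funext fun s => conormalAnchor_conormalBracket hP hf hco hb hb' s

/-- A decomposition of a conormal section extends to a neighbourhood of `f s` in `X`. -/
theorem exists_extension_of_decomposition (hf : Manifold.IsImmersion 𝓘(ℝ, E') 𝓘(ℝ, E) ∞ f) {s : S}
    {b : ∀ t, conormalSpace E E' f t} {m : ℕ} {g : Fin m → S → ℝ} {a : Fin m → DForm E X 1}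
    (h : IsDecomposition (A := cotangentBundle E X) (B := conormalBundle E E' f) E' f
      (conormalInclusion E E' f) b s g a) :
    ∃ g' : Fin m → X → ℝ, (∀ i, IsSmoothFn E (g' i)) ∧ (∀ i, ∀ᶠ t in 𝓝 s, g' i (f t) = g i t) ∧
      IsExtensionAt s (fun y => ∑ i, g' i y • a i y) b := by
  choose g' hg' hgg using fun i => exists_fn_extension hf s (h.coeff_smooth i)
  refine ⟨g', hg', hgg, isSmoothForm_sum _ fun i => IsSmoothAlong.smul (hg' i) (h.sec_smooth i), ?_⟩
  filter_upwards [h.eq, Filter.eventually_all.2 hgg] with t ht hgt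
  refine Eq.trans ?_ ht.symm
  exact Finset.sum_congr rfl fun i _ => by rw [hgt i]; rfl

theorem exists_decomposition (hf : Manifold.IsImmersion 𝓘(ℝ, E') 𝓘(ℝ, E) ∞ f)
    {b : ∀ t, conormalSpace E E' f t}
    (hb : IsSmoothAlong (E := E) (E' := E') f (fun t => (b t : AltForm E 1 (f t)))) (s : S) :
    ∃ (m : ℕ) (g : Fin m → S → ℝ) (a : Fin m → (cotangentBundle E X).Sec),
      IsDecomposition (A := cotangentBundle E X) (B := conormalBundle E E' f) E' f
        (conormalInclusion E E' f) b s g a := by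
  obtain ⟨h, W, U, hF, hsU⟩ := exists_coordFrame_at (E := E) (f s)
  refine ⟨_, fun i t => pairing (f t) (b t) (W i (f t)), fun i => dFun E (h i),
    fun i => IsSmoothAlong.pairing hf.contMDiff hb (hF.smooth_vf i),
    fun i => isSmoothForm_dFun (hF.smooth_fn i), ?_⟩
  filter_upwards [hf.contMDiff.continuous.continuousAt.eventually (hF.isOpen.mem_nhds hsU)]
    with t ht
  exact hF.expand_form ht (b t)

theorem isAlgebroidMorphism_conormalInclusion (hf : Manifold.IsImmersion 𝓘(ℝ, E') 𝓘(ℝ, E) ∞ f)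
    (hco : P.IsCoisotropic E' f) :
    IsAlgebroidMorphism f (conormalInclusion E E' f) (conormalAlgebroid hf hco)
      (poissonAlgebroid P) where
  base_smooth := hf.contMDiff
  smooth _ hb s := exists_decomposition hf hb s
  anchor _ n := mfderiv_conormalAnchor hf hco n
  bracket b b' _ _ s m m' g a g' a' hd hd' := by
    -- The coefficients of a decomposition are functions on `S`; extended to `X` they turn it into
    -- an extension of the section, to which the Leibniz formula on `X` applies.
    obtain ⟨k, hk, hkg, hext⟩ := exists_extension_of_decomposition hf hd
    obtain ⟨k', hk', hkg', hext'⟩ := exists_extension_of_decomposition hf hd'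
    refine (hext.conormalBracket_eq hf hco hext').trans ?_
    refine (P.formBracket_sum_smul_sum_smul hk hd.sec_smooth hk' hd'.sec_smooth (f s)).trans ?_
    simp only [fun i => hext.dirDeriv_eq hf hco (hk' i) (hkg' i),
      fun i => hext'.dirDeriv_eq hf hco (hk i) (hkg i), fun i => (hkg i).self_of_nhds,
      fun i => (hkg' i).self_of_nhds]
    rfl

theorem anchor_eq_of_isAlgebroidMorphism (hf : Manifold.IsImmersion 𝓘(ℝ, E') 𝓘(ℝ, E) ∞ f)
    {𝒩 𝒩' : AlgebroidData E' (conormalBundle E E' f)}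
    (h : IsAlgebroidMorphism f (conormalInclusion E E' f) 𝒩 (poissonAlgebroid P))
    (h' : IsAlgebroidMorphism f (conormalInclusion E E' f) 𝒩' (poissonAlgebroid P)) :
    𝒩'.anchor = 𝒩.anchor := by
  funext s
  refine LinearMap.ext fun n => mfderiv_injective_of_immersion hf s ?_
  rw [h.anchor, h'.anchor]

/-- Decompositions exist at every point, and in terms of one the morphism condition expresses the
bracket through `T*X` and the anchor, on which both structures agree. -/
theorem bracket_eq_of_isAlgebroidMorphism (hf : Manifold.IsImmersion 𝓘(ℝ, E') 𝓘(ℝ, E) ∞ f)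
    {𝒩 𝒩' : AlgebroidData E' (conormalBundle E E' f)}
    (h : IsAlgebroidMorphism f (conormalInclusion E E' f) 𝒩 (poissonAlgebroid P))
    (h' : IsAlgebroidMorphism f (conormalInclusion E E' f) 𝒩' (poissonAlgebroid P))
    {a b : (conormalBundle E E' f).Sec} (ha : (conormalBundle E E' f).Smooth a)
    (hb : (conormalBundle E E' f).Smooth b) : 𝒩'.bracket a b = 𝒩.bracket a b := by
  funext s
  obtain ⟨m, g, c, hd⟩ := h.smooth a ha s
  obtain ⟨m', g', c', hd'⟩ := h.smooth b hb s
  refine Subtype.ext ?_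
  refine (h'.bracket a b ha hb s m m' g c g' c' hd hd').trans
    (Eq.trans ?_ (h.bracket a b ha hb s m m' g c g' c' hd hd').symm)
  simp only [AlgebroidData.vf, anchor_eq_of_isAlgebroidMorphism hf h h']

theorem dForm_sum_smul {κ : Type*} (I : Finset κ) {g : κ → X → ℝ} {a : κ → DForm E X 1}
    (hg : ∀ i, IsSmoothFn E (g i)) (ha : ∀ i, IsSmoothForm (a i)) (x : X)
    (u v : TangentSpace 𝓘(ℝ, E) x) :
    dForm (fun y => ∑ i ∈ I, g i y • a i y) x ![u, v] =
      ∑ i ∈ I, (g i x * dForm (a i) x ![u, v] + wedgeVal (g i) x (a i x) u v) := by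
  classical
  induction I using Finset.induction_on with
  | empty =>
    simp only [Finset.sum_empty]
    exact congrArg (fun θ => θ x ![u, v]) (dForm_zero (E := E) (M := X) (k := 1))
  | insert i I hi ih =>
    simp only [Finset.sum_insert hi]
    rw [← ih, ← dForm_smul (hg i) (ha i)]
    exact congrArg (fun θ => θ x ![u, v]) (dForm_add (IsSmoothAlong.smul (hg i) (ha i))
      (isSmoothForm_sum I fun i => IsSmoothAlong.smul (hg i) (ha i)))

/-- If `β = ∑ kᵢ aᵢ` extends `b`, the right-hand side is `f*dβ`, which vanishes as `f*β = 0`. The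
symbol vanishes because conormal covectors pull back to zero. -/
theorem isStackPullback_canonicalForm (hf : Manifold.IsImmersion 𝓘(ℝ, E') 𝓘(ℝ, E) ∞ f)
    (𝒩 : AlgebroidData E' (conormalBundle E E' f)) :
    IsStackPullback f (conormalInclusion E E' f) (canonicalForm E X) (deltaTwoForm 𝒩 0) where
  symbol s n := n.2.symm
  op b hb s m g a hd u v := by
    obtain ⟨k, hk, hkg, hext⟩ := exists_extension_of_decomposition hf hd
    have hfd := (hf.contMDiff s).mdifferentiableAt (by simp : (∞ : WithTop ℕ∞) ≠ 0)
    have h0 := hext.dForm_apply_mfderiv hf.contMDiff u v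
    have hL : (deltaTwoForm 𝒩 (0 : DForm E' S 2)).op b s ![u, v] = 0 := by
      show lieDeriv (𝒩.vf b) (0 : DForm E' S 2) s ![u, v] = 0
      rw [lieDeriv_zero]
      rfl
    rw [hL, ← h0, ← two_form_apply, dForm_sum_smul Finset.univ hk hd.sec_smooth]
    refine Finset.sum_congr rfl fun i _ => ?_
    have hdd : ∀ w : TangentSpace 𝓘(ℝ, E') s, dirDeriv E (k i) (f s)
        (mfderiv 𝓘(ℝ, E') 𝓘(ℝ, E) f s w) = dirDeriv E' (g i) s w := fun w => by
      rw [← dirDeriv_comp hfd (hk i)]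
      exact dirDeriv_congr (hkg i) w
    have hpull : pullCov f 2 s (dForm (E := E) (a i) (f s)) ![u, v] = dForm (E := E) (a i) (f s)
        ![mfderiv 𝓘(ℝ, E') 𝓘(ℝ, E) f s u, mfderiv 𝓘(ℝ, E') 𝓘(ℝ, E) f s v] := by
      show dForm (E := E) (a i) (f s) _ = dForm (E := E) (a i) (f s) _
      congr 1
      ext l
      fin_cases l <;> rfl
    have hwedge : wedgeVal (k i) (f s) (show AltForm E 1 (f s) from a i (f s))
        (mfderiv 𝓘(ℝ, E') 𝓘(ℝ, E) f s u) (mfderiv 𝓘(ℝ, E') 𝓘(ℝ, E) f s v) =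
        wedgeVal (g i) s (pullCov f 1 s (show AltForm E 1 (f s) from a i (f s))) u v := by
      simp only [wedgeVal, hdd]
      rfl
    exact congrArg₂ (· + ·) (congrArg₂ (· * ·) (hkg i).self_of_nhds hpull.symm) hwedge

/-- Compose with a linear left inverse of the injective map `df`. -/
theorem exists_pullCov_eq (hf : Manifold.IsImmersion 𝓘(ℝ, E') 𝓘(ℝ, E) ∞ f) {s : S}
    (z : AltForm E' 1 s) : ∃ α : AltForm E 1 (f s), pullCov f 1 s α = z := by
  obtain ⟨r, hr⟩ := LinearMap.exists_leftInverse_of_injective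
    (mfderiv 𝓘(ℝ, E') 𝓘(ℝ, E) f s).toLinearMap
    (LinearMap.ker_eq_bot.2 fun v w h => mfderiv_injective_of_immersion hf s h)
  refine ⟨covectorOfDual (f s) (pairing s z ∘ₗ r), altForm_one_ext fun v => ?_⟩
  exact congrArg (pairing s z) (DFunLike.congr_fun hr v)

/-- A vector annihilated by the conormal space is tangent. -/
theorem exists_mfderiv_eq {s : S} {w : TangentSpace 𝓘(ℝ, E) (f s)}
    (hw : ∀ η ∈ conormalSpace E E' f s, pairing (f s) η w = 0) :
    ∃ v, mfderiv 𝓘(ℝ, E') 𝓘(ℝ, E) f s v = w := by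
  by_contra hne
  obtain ⟨φ, hφ, hker⟩ := Submodule.exists_le_ker_of_notMem
    (p := LinearMap.range (mfderiv 𝓘(ℝ, E') 𝓘(ℝ, E) f s).toLinearMap) (v := w)
    (fun ⟨v, hv⟩ => hne ⟨v, hv⟩)
  exact hφ (hw (covectorOfDual (f s) φ) (mem_conormalSpace_iff.2 fun v => hker ⟨v, rfl⟩))

/-- In degree `0` a cocycle is a pair with `df v = Pα`. It is a boundary when `f*α = 0`, and a
covector `f*α` that kills the image of the anchor comes from a cocycle because `Pα` is then
annihilated by the conormal space, hence tangent. In degree `1`, if `w` acts on conormal covectors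
as `(f*α) ∘ ρ`, then `w + Pα` is tangent for the same reason. -/
theorem isQuasiIso_conormal (hf : Manifold.IsImmersion 𝓘(ℝ, E') 𝓘(ℝ, E) ∞ f)
    (hco : P.IsCoisotropic E' f) (s : S) : IsQuasiIso (V₀ := conormalSpace E E' f s)
    ((conormalAnchor hf hco s).prod (conormalSpace E E' f s).subtype)
    (LinearMap.coprod (mfderiv 𝓘(ℝ, E') 𝓘(ℝ, E) f s).toLinearMap (-(P.sharp (f s))))
    (0 : PUnit.{1} →ₗ[ℝ] AltForm E' 1 s)
    ((conormalAnchor hf hco s).dualMap ∘ₗ pairing s)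
    0
    (LinearMap.coprod (-(flat ((0 : DForm E' S 2) s))) (pullCov f 1 s ∘ₗ LinearMap.id))
    ((LinearMap.id ∘ₗ (conormalSpace E E' f s).subtype).dualMap ∘ₗ
      (pairing (E := E) (f s)).flip) := by
  have hd₁ : ∀ (v : TangentSpace 𝓘(ℝ, E') s) (α : AltForm E 1 (f s)),
      LinearMap.coprod (mfderiv 𝓘(ℝ, E') 𝓘(ℝ, E) f s).toLinearMap (-(P.sharp (f s))) (v, α) =
        mfderiv 𝓘(ℝ, E') 𝓘(ℝ, E) f s v - P.sharp (f s) α :=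
    fun v α => (sub_eq_add_neg _ _).symm
  have hφ₁ : ∀ (v : TangentSpace 𝓘(ℝ, E') s) (α : AltForm E 1 (f s)),
      LinearMap.coprod (-(flat ((0 : DForm E' S 2) s))) (pullCov f 1 s ∘ₗ LinearMap.id) (v, α) =
        pullCov f 1 s α := by
    intro v α
    have h0 : flat ((0 : DForm E' S 2) s) v = 0 := rfl
    rw [LinearMap.coprod_apply, LinearMap.neg_apply, h0, neg_zero, zero_add]
    rfl
  -- The transpose of the conormal anchor is minus that of `P`, by skewness; this sign makes the
  -- square in degrees `0, 1` commute.
  have hpull : ∀ (α : AltForm E 1 (f s)) (n : conormalSpace E E' f s),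
      pairing s (pullCov f 1 s α) (conormalAnchor hf hco s n) =
        - pairing (f s) n (P.sharp (f s) α) := by
    intro α n
    rw [← P.skew', ← mfderiv_conormalAnchor hf hco n]
    rfl
  exact
  { dd := LinearMap.ext fun n => (hd₁ _ _).trans
      (sub_eq_zero.2 (mfderiv_conormalAnchor hf hco n))
    ee := LinearMap.comp_zero _
    comm₀ := LinearMap.ext fun n => (hφ₁ _ _).trans n.2
    comm₁ := LinearMap.ext fun ⟨v, α⟩ => LinearMap.ext fun n => by
      have h1 := mem_conormalSpace_iff.1 n.2 v
      simp only [LinearMap.comp_apply, hd₁, hφ₁]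
      refine Eq.trans ?_ (hpull α n).symm
      refine Eq.trans (map_sub (pairing (f s) n.1) _ _) ?_
      rw [h1, zero_sub]
    inj₀ := fun n h _ => Subtype.ext (congrArg Prod.snd h)
    surj₀ := fun z _ => ⟨0, map_zero _, Subsingleton.elim _ _⟩
    inj₁ := by
      -- The source of `e₀` is zero, so `h'` says that `f*α = 0`.
      rintro ⟨v, α⟩ h ⟨_, h'⟩
      rw [hφ₁] at h'
      rw [hd₁, sub_eq_zero] at h
      refine ⟨⟨α, h'.symm⟩, Prod.ext (mfderiv_injective_of_immersion hf s ?_) rfl⟩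
      exact (mfderiv_conormalAnchor hf hco ⟨α, h'.symm⟩).trans h.symm
    surj₁ := by
      intro z hz
      obtain ⟨α, rfl⟩ := exists_pullCov_eq hf z
      obtain ⟨v, hv⟩ := exists_mfderiv_eq (E' := E') (w := P.sharp (f s) α) fun η hη => by
        rw [← neg_eq_zero, ← hpull α ⟨η, hη⟩]
        exact DFunLike.congr_fun hz ⟨η, hη⟩
      refine ⟨(v, α), ?_, 0, ?_⟩
      · rw [hd₁, hv, sub_self]
      · rw [hφ₁, sub_self, map_zero]
    inj₂ := by
      rintro w ⟨z, hz⟩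
      obtain ⟨α, rfl⟩ := exists_pullCov_eq hf z
      obtain ⟨v, hv⟩ := exists_mfderiv_eq (E' := E') (w := w + P.sharp (f s) α) fun η hη => by
        have h1 : pairing s (pullCov f 1 s α) (conormalAnchor hf hco s ⟨η, hη⟩) =
          pairing (f s) η w := DFunLike.congr_fun hz ⟨η, hη⟩
        rw [map_add, ← h1, hpull, neg_add_cancel]
      refine ⟨(v, α), ?_⟩
      rw [hd₁, hv, add_sub_cancel_right]
    surj₂ := by
      intro z
      -- A functional on the conormal space extends to the whole cotangent space, where it is
      -- evaluation at a tangent vector.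
      obtain ⟨z', hz'⟩ := LinearMap.exists_extend z
      obtain ⟨w, hw⟩ := exists_tangent_of_dual z'
      refine ⟨w, 0, ?_⟩
      rw [map_zero]
      refine (sub_eq_zero.2 ?_).symm
      rw [← hz']
      exact LinearMap.ext fun n => hw n }

theorem isLagrangianStructure_conormal (hf : Manifold.IsImmersion 𝓘(ℝ, E') 𝓘(ℝ, E) ∞ f)
    (hco : P.IsCoisotropic E' f) :
    IsLagrangianStructure f (conormalInclusion E E' f) (conormalAlgebroid hf hco)
      (poissonAlgebroid P) (canonicalForm E X) 0 0 where
  smooth := isSmoothAlong_zero (E := E') (E' := E') (fun x : S => x) 2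
  isotropic₀ := isStackPullback_canonicalForm hf _
  isotropic₁ s := by
    rw [dForm_zero]
    exact (map_zero _).symm
  nondegenerate s := isQuasiIso_conormal hf hco s

end ConormalAlgebroid

end CoisoLag

end

open CoisoLag in
theorem mainTheorem8
    {E : Type*} [NormedAddCommGroup E] [NormedSpace ℝ E] [FiniteDimensional ℝ E]
    {X : Type*} [TopologicalSpace X] [T2Space X] [ChartedSpace E X] [IsManifold 𝓘(ℝ, E) ∞ X]
    {E' : Type*} [NormedAddCommGroup E'] [NormedSpace ℝ E'] [FiniteDimensional ℝ E']
    {S : Type*} [TopologicalSpace S] [T2Space S] [ChartedSpace E' S] [IsManifold 𝓘(ℝ, E') ∞ S]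
    (P : Bivector E X) (hP : P.IsPoisson)
    (f : S → X) (hf : Manifold.IsImmersion 𝓘(ℝ, E') 𝓘(ℝ, E) ∞ f)
    (hco : P.IsCoisotropic E' f) :
    -- the Poisson Lie algebroid, and the canonical 1-shifted symplectic structure on `[X/T*X]`
    (poissonAlgebroid P).IsLieAlgebroid ∧
    IsOneShiftedSymplectic (poissonAlgebroid P) (canonicalForm E X) 0 ∧
    -- the Lie algebroid structure on the conormal bundle
    ∃ 𝒩 : AlgebroidData E' (conormalBundle E E' f),
      𝒩.IsLieAlgebroid ∧
      IsAlgebroidMorphism f (conormalInclusion E E' f) 𝒩 (poissonAlgebroid P) ∧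
      -- it is the only one for which the inclusion in `T*X` is a morphism of Lie algebroids
      (∀ 𝒩' : AlgebroidData E' (conormalBundle E E' f), 𝒩'.IsLieAlgebroid →
        IsAlgebroidMorphism f (conormalInclusion E E' f) 𝒩' (poissonAlgebroid P) →
        𝒩'.anchor = 𝒩.anchor ∧ ∀ a b, (conormalBundle E E' f).Smooth a →
          (conormalBundle E E' f).Smooth b → 𝒩'.bracket a b = 𝒩.bracket a b) ∧
      -- `[S/N*S] → [X/T*X]` is Lagrangian, with the zero isotropic structure
      IsLagrangianStructure f (conormalInclusion E E' f) 𝒩 (poissonAlgebroid P)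
        (canonicalForm E X) 0 0 := by
  have hmor := isAlgebroidMorphism_conormalInclusion hf hco
  exact ⟨isLieAlgebroid_poissonAlgebroid hP, isOneShiftedSymplectic_canonicalForm P,
    conormalAlgebroid hf hco, isLieAlgebroid_conormalAlgebroid hP hf hco, hmor,
    fun _ _ h' => ⟨anchor_eq_of_isAlgebroidMorphism hf hmor h', fun _ _ ha hb =>
      bracket_eq_of_isAlgebroidMorphism hf hmor h' ha hb⟩,
    isLagrangianStructure_conormal hf hco⟩
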